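/- **Setting.** Let $\mathbb F$ be a field and let $X_+,X_-$ be vector spaces over $\mathbb F$ of arbitrary dimension. A $\mathbb Z/2\mathbb Z$-graded Fredholm complex $D=(X,d)$ consists of linear maps $d_+:X_+\to X_-$ and $d_-:X_-\to X_+$ with $d_-d_+=0$, $d_+d_-=0$ such that $H_+(D)=\operatorname{Ker} d_+/\operatorname{Im} d_-$ and $H_-(D)=\operatorname{Ker} d_- /\operatorname{Im} d_+$ are finite dimensional. For a finite dimensional space $V$ put $|V|=\Lambda^{\dim V}(V)$, and put $|D|=|H_+(D)|\otimes|H_-(D)|^*$. For $0\ne v$ in a line, $v^*$ is the dual vector with $v^*(v)=1$. A complex $\Delta=(X,\delta)$ is a finite rank perturbation of $D$ if $d_+-\delta_+$ and $d_--\delta_-$ have finite rank. A pseudo-inverse of a linear map $A:V\to W$ is a linear map $A^\dagger:W\to V$ with $AA^\dagger A=A$ and $A^\dagger AA^\dagger=A^\dagger$. A pseudo-inverse of $D$ is a $\mathbb Z/2\mathbb Z$-graded Fredholm complex $D^\dagger: X_-\xrightarrow{d_+^\dagger}X_+\xrightarrow{d_-^\dagger}X_-$ in which $d_\pm^\dagger$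 is a pseudo-inverse of $d_\pm$. If $T:V\to V$ is invertible and $1-T$ has finite rank, $\det T$ denotes the determinant of $T$ restricted to any finite dimensional invariant subspace containing $\operatorname{Im}(1-T)$. **Perturbation isomorphism of Fredholm operators.** Let $A,B:V\to W$ be linear maps with finite dimensional kernels and cokernels such that $A-B$ has finite rank; they have the same index $\dim\operatorname{Ker}-\dim\operatorname{Coker}$. Choose pseudo-inverses $A^\dagger,B^\dagger$ and put $P_A=1-A^\dagger A$, $Q_B=1-BB^\dagger$, $P_B=1-B^\dagger B$; their images are $\operatorname{Ker}A$, $\operatorname{Ker}B^\dagger$ and $\operatorname{Ker}B$. Identify $\operatorname{Ker}B^\dagger\cong\operatorname{Coker}B$ by the quotient map. Below, vectors of $W$ are read in $\operatorname{Coker}A$ through the quotient map, and vectors of $V$ are read in $\operatorname{Ker}B$ through $P_B$. * If the index is $\le 0$, choose linear maps $L:\operatorname{Ker}A\to W$, inducing an injection into $\operatorname{Coker}A$; $M:\operatorname{Ker}B^\dagger\to V$, inducing a surjection onto $\operatorname{Coker}B^\dagger$; and $N:\operatorname{Ker}B^\dagger\to W$, inducing an isomorphism $\operatorname{Ker}M\to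 W/(\operatorname{Im}A+\operatorname{Im}L)$ and vanishing on a complement of $\operatorname{Ker}M$ in $\operatorname{Ker}B^\dagger$. With $\Sigma=(A+LP_A)(B^\dagger+MQ_B)+NQ_B:W\to W$, set $$P(B,A):\ s\otimes(Ls\wedge Nt_1)^*\mapsto\det(\Sigma)^{-1}\,\bigl(Mt_0\otimes(t_0\wedge t_1)^*\bigr)$$ for non-zero $s\in|\operatorname{Ker}A|$, $t_1\in|\operatorname{Ker}M|$, $t_0\in|\operatorname{Ker}N|$. * If the index is $\ge 0$, choose linear maps $L:\operatorname{Ker}A\to W$, inducing a surjection onto $\operatorname{Coker}A$; $M:\operatorname{Ker}B^\dagger\to V$, inducing an injection into $\operatorname{Coker}B^\dagger$; and $N:\operatorname{Ker}A\to V$, inducing an isomorphism $\operatorname{Ker}L\to V/(\operatorname{Im}M+\operatorname{Im}B^\dagger)$ and vanishing on a complement of $\operatorname{Ker}L$ in $\operatorname{Ker}A$. With $\Sigma=(B^\dagger+MQ_B)(A+LP_A)+NP_A:V\to V$, set $$P(B,A):\ (s_0\wedge s_1)\otimes(Ls_1)^*\mapsto\det(\Sigma)^{-1}\,\bigl((Ns_0\wedge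 Mt)\otimes t^*\bigr)$$ for non-zero $s_0\in|\operatorname{Ker}L|$, $s_1\in|\operatorname{Ker}N|$, $t\in|\operatorname{Ker}B^\dagger|=|\operatorname{Coker}B|$. This gives an isomorphism $P(B,A):|\operatorname{Ker}A|\otimes|\operatorname{Coker}A|^*\to|\operatorname{Ker}B|\otimes|\operatorname{Coker}B|^*$. **Perturbation isomorphism of Fredholm complexes.** Let $\Delta$ be a finite rank perturbation of $D$. Choose pseudo-inverses $D^\dagger$ of $D$ and $\Delta^\dagger$ of $\Delta$ that are finite rank perturbations of each other, and put $\sigma_+=d_++d_-^\dagger$ and $\tau_+=\delta_++\delta_-^\dagger$, which are Fredholm operators $X_+\to X_-$. The inclusion $\operatorname{Ker}\sigma_+\subseteq\operatorname{Ker}d_+$ and the inclusion $\operatorname{Ker}d_-\subseteq X_-$ induce isomorphisms $\operatorname{Ker}\sigma_+\cong H_+(D)$ and $H_-(D)\cong\operatorname{Coker}\sigma_+$, and likewise for $\Delta$ and $\tau_+$. Through these, $P(\tau_+,\sigma_+)$ becomes an isomorphism $P(\Delta,D):|D|\to|\Delta|$, the perturbation isomorphism. **Theorem 3.8.** Let $D^1,D^2,D^3$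 be $\mathbb Z/2\mathbb Z$-graded Fredholm complexes on the same spaces $X_+,X_-$ such that $D^2$ is a finite rank perturbation of $D^1$ and $D^3$ is a finite rank perturbation of $D^2$. Then the perturbation isomorphisms $P(D^2,D^1)$, $P(D^1,D^2)$, $P(D^3,D^2)$ and $P(D^3,D^1)$ exist and do not depend on any of the choices above, and 1. $P(D^1,D^2)=P(D^2,D^1)^{-1}$; 2. $P(D^3,D^2)\circ P(D^2,D^1)=P(D^3,D^1)$. -/

import Mathlib

open scoped TensorProduct

namespace FredholmPerturbation

noncomputable section

variable {F : Type*} [Field F]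

/-! ### Determinant lines -/

section Lines

variable {V W : Type*} [AddCommGroup V] [Module F V] [AddCommGroup W] [Module F W]

/-- The determinant `|V|` of a (finite dimensional) vector space `V`: its top exterior power. -/
abbrev DetLine (F V : Type*) [Field F] [AddCommGroup V] [Module F V] :
    Submodule F (ExteriorAlgebra F V) :=
  ⋀[F]^(Module.finrank F V) V

/-- The isomorphism `⋀ⁿ V ≃ ⋀ⁿ W` induced by an isomorphism `V ≃ W`. -/
def extPowEquiv (n : ℕ) (e : V ≃ₗ[F] W) : (⋀[F]^n V) ≃ₗ[F] (⋀[F]^n W) :=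
  LinearEquiv.ofLinearMap (exteriorPower.map n e.toLinearMap) (exteriorPower.map n e.symm.toLinearMap)
    (by rw [← exteriorPower.map_comp, LinearEquiv.comp_symm, exteriorPower.map_id])
    (by rw [← exteriorPower.map_comp, LinearEquiv.symm_comp, exteriorPower.map_id])

/-- The isomorphism `|e| : |V| → |W|` of determinant lines induced by an isomorphism `e`. -/
def detLineEquiv (e : V ≃ₗ[F] W) : DetLine F V ≃ₗ[F] DetLine F W :=
  (extPowEquiv (Module.finrank F V) e).trans
    (LinearEquiv.ofEq _ _ (by rw [LinearEquiv.finrank_eq e]))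

end Lines

/-! ### Linear maps: finite rank, pseudo-inverses, index, determinants -/

section Operators

variable {V W : Type*} [AddCommGroup V] [Module F V] [AddCommGroup W] [Module F W]

/-- The linear map `T` has finite rank. -/
def HasFiniteRank (T : V →ₗ[F] W) : Prop :=
  FiniteDimensional F (LinearMap.range T)

/-- The index `dim Ker A - dim Coker A` of a Fredholm operator. -/
def opIndex (A : V →ₗ[F] W) : ℤ :=
  (Module.finrank F (LinearMap.ker A) : ℤ) - (Module.finrank F (W ⧸ LinearMap.range A) : ℤ)

/-- `Ad` is a pseudo-inverse of `A`. The first equation says that `A Ad` and `1 - Ad A` are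
idempotents with images `Im A` and `Ker A`; by both equations together, the image of `1 - A Ad`
is `Ker Ad` and the image of `Ad A` is `Im Ad`. -/
structure IsPseudoInverse (A : V →ₗ[F] W) (Ad : W →ₗ[F] V) : Prop where
  left : A ∘ₗ Ad ∘ₗ A = A
  right : Ad ∘ₗ A ∘ₗ Ad = Ad

theorem IsPseudoInverse.symm {A : V →ₗ[F] W} {Ad : W →ₗ[F] V} (h : IsPseudoInverse A Ad) :
    IsPseudoInverse Ad A :=
  ⟨h.right, h.left⟩

/-- The idempotent `1 - Ad A`, as a map from `V` onto its image `Ker A`. -/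
def kerProj {A : V →ₗ[F] W} {Ad : W →ₗ[F] V} (h : IsPseudoInverse A Ad) :
    V →ₗ[F] LinearMap.ker A :=
  LinearMap.codRestrict (LinearMap.ker A) (LinearMap.id - Ad ∘ₗ A) (by
    intro x
    have := LinearMap.congr_fun h.left x
    simp only [LinearMap.comp_apply] at this
    simp [this])

theorem mapsTo_range_one_sub (T : V →ₗ[F] V) :
    ∀ x ∈ LinearMap.range (LinearMap.id - T), T x ∈ LinearMap.range (LinearMap.id - T) := by
  rintro _ ⟨y, rfl⟩
  exact ⟨T y, by simp⟩

/-- The determinant of an operator `T` such that `1 - T` has finite rank: the determinant of the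
restriction of `T` to the finite dimensional invariant subspace `Im (1 - T)`. (It is the same on
every finite dimensional invariant subspace that contains `Im (1 - T)`.) -/
def finDet (T : V →ₗ[F] V) : F :=
  LinearMap.det (T.restrict (mapsTo_range_one_sub T))

end Operators

/-! ### The perturbation isomorphism of two Fredholm operators -/

section OperatorPerturbation

variable {V W : Type*} [AddCommGroup V] [Module F V] [AddCommGroup W] [Module F W]

/-- The line `|Ker A| ⊗ |Coker A|^*` of a Fredholm operator. -/
abbrev OpDet (A : V →ₗ[F] W) : Type _ :=
  DetLine F (LinearMap.ker A) ⊗[F] Module.Dual F (DetLine F (W ⧸ LinearMap.range A))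

/-- Perturbation triples `(L, M, N)` from `A` to `B` (with pseudo-inverse `Bd`), for index `≤ 0`.
The last field says that `N` vanishes on an algebraic complement of `Ker M` (it is injective
on `Ker M`). -/
structure NonposTriple (A : V →ₗ[F] W) (Bd : W →ₗ[F] V) where
  L : LinearMap.ker A →ₗ[F] W
  M : LinearMap.ker Bd →ₗ[F] V
  N : LinearMap.ker Bd →ₗ[F] W
  L_inj : Function.Injective ((LinearMap.range A).mkQ ∘ₗ L)
  M_surj : Function.Surjective ((LinearMap.range Bd).mkQ ∘ₗ M)
  N_bij : Function.Bijective
    ((LinearMap.range A ⊔ LinearMap.range L).mkQ ∘ₗ N ∘ₗ (LinearMap.ker M).subtype)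
  N_compl : IsCompl (LinearMap.ker M) (LinearMap.ker N)

/-- Perturbation triples `(L, M, N)` from `A` to `B` (with pseudo-inverse `Bd`), for index `≥ 0`.
The last field says that `N` vanishes on an algebraic complement of `Ker L` (it is injective
on `Ker L`). -/
structure NonnegTriple (A : V →ₗ[F] W) (Bd : W →ₗ[F] V) where
  L : LinearMap.ker A →ₗ[F] W
  M : LinearMap.ker Bd →ₗ[F] V
  N : LinearMap.ker A →ₗ[F] V
  L_surj : Function.Surjective ((LinearMap.range A).mkQ ∘ₗ L)
  M_inj : Function.Injective ((LinearMap.range Bd).mkQ ∘ₗ M)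
  N_bij : Function.Bijective
    ((LinearMap.range M ⊔ LinearMap.range Bd).mkQ ∘ₗ N ∘ₗ (LinearMap.ker L).subtype)
  N_compl : IsCompl (LinearMap.ker L) (LinearMap.ker N)

variable {A B : V →ₗ[F] W} {Ad Bd : W →ₗ[F] V}

/-- `Σ = (A + L P_A)(Bd + M Q_B) + N Q_B : W → W`, with `P_A = 1 - Ad A`, `Q_B = 1 - B Bd`. -/
def NonposTriple.sigma (t : NonposTriple A Bd) (hA : IsPseudoInverse A Ad)
    (hB : IsPseudoInverse B Bd) : W →ₗ[F] W :=
  (A + t.L ∘ₗ kerProj hA) ∘ₗ (Bd + t.M ∘ₗ kerProj hB.symm) + t.N ∘ₗ kerProj hB.symm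

/-- `Σ = (Bd + M Q_B)(A + L P_A) + N P_A : V → V`, with `P_A = 1 - Ad A`, `Q_B = 1 - B Bd`. -/
def NonnegTriple.sigma (t : NonnegTriple A Bd) (hA : IsPseudoInverse A Ad)
    (hB : IsPseudoInverse B Bd) : V →ₗ[F] V :=
  (Bd + t.M ∘ₗ kerProj hB.symm) ∘ₗ (A + t.L ∘ₗ kerProj hA) + t.N ∘ₗ kerProj hA

/-- Index `≤ 0`: `P` is given by `s ⊗ (Ls ∧ N t₁)^* ↦ det(Σ)⁻¹ • (M t₀ ⊗ (t₀ ∧ t₁)^*)` for all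
non-zero `s ∈ |Ker A|`, `t₁ ∈ |Ker M|`, `t₀ ∈ |Ker N|`. Here `c = Ls ∧ N t₁ ∈ |Coker A|`,
`k = M t₀ ∈ |Ker B|` (through the idempotent `1 - Bd B : V → Ker B`) and
`e = t₀ ∧ t₁ ∈ |Coker B|` (through `Ker Bd → W → Coker B`), all products being taken in the
exterior algebras; `c^*` and `e^*` denote the functionals with `c^* c = 1` and `e^* e = 1`. -/
def NonposTriple.Gives (t : NonposTriple A Bd) (hA : IsPseudoInverse A Ad)
    (hB : IsPseudoInverse B Bd) (P : OpDet A ≃ₗ[F] OpDet B) : Prop :=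
  ∀ (s : DetLine F (LinearMap.ker A)) (t₁ : DetLine F (LinearMap.ker t.M))
    (t₀ : DetLine F (LinearMap.ker t.N)), s ≠ 0 → t₁ ≠ 0 → t₀ ≠ 0 →
    ∃ (c : DetLine F (W ⧸ LinearMap.range A)) (k : DetLine F (LinearMap.ker B))
      (e : DetLine F (W ⧸ LinearMap.range B))
      (cs : Module.Dual F (DetLine F (W ⧸ LinearMap.range A)))
      (es : Module.Dual F (DetLine F (W ⧸ LinearMap.range B))),
      (c : ExteriorAlgebra F (W ⧸ LinearMap.range A)) =
        ExteriorAlgebra.map ((LinearMap.range A).mkQ ∘ₗ t.L) s *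
        ExteriorAlgebra.map ((LinearMap.range A).mkQ ∘ₗ t.N ∘ₗ (LinearMap.ker t.M).subtype) t₁ ∧
      (k : ExteriorAlgebra F (LinearMap.ker B)) =
        ExteriorAlgebra.map (kerProj hB ∘ₗ t.M ∘ₗ (LinearMap.ker t.N).subtype) t₀ ∧
      (e : ExteriorAlgebra F (W ⧸ LinearMap.range B)) =
        ExteriorAlgebra.map ((LinearMap.range B).mkQ ∘ₗ (LinearMap.ker Bd).subtype ∘ₗ
          (LinearMap.ker t.N).subtype) t₀ *
        ExteriorAlgebra.map ((LinearMap.range B).mkQ ∘ₗ (LinearMap.ker Bd).subtype ∘ₗ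
          (LinearMap.ker t.M).subtype) t₁ ∧
      cs c = 1 ∧ es e = 1 ∧
      P (s ⊗ₜ[F] cs) = (finDet (t.sigma hA hB))⁻¹ • (k ⊗ₜ[F] es)

/-- Index `≥ 0`: `P` is given by `(s₀ ∧ s₁) ⊗ (L s₁)^* ↦ det(Σ)⁻¹ • ((N s₀ ∧ M t) ⊗ t^*)` for all
non-zero `s₀ ∈ |Ker L|`, `s₁ ∈ |Ker N|`, `t ∈ |Ker Bd| ≅ |Coker B|`. Here
`a = s₀ ∧ s₁ ∈ |Ker A|`, `c = L s₁ ∈ |Coker A|`, `k = N s₀ ∧ M t ∈ |Ker B|` (through the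
idempotent `1 - Bd B : V → Ker B`) and `e` is the image of `t` in `|Coker B|` (through
`Ker Bd → W → Coker B`); `c^*` and `e^*` are as above. -/
def NonnegTriple.Gives (t : NonnegTriple A Bd) (hA : IsPseudoInverse A Ad)
    (hB : IsPseudoInverse B Bd) (P : OpDet A ≃ₗ[F] OpDet B) : Prop :=
  ∀ (s₀ : DetLine F (LinearMap.ker t.L)) (s₁ : DetLine F (LinearMap.ker t.N))
    (u : DetLine F (LinearMap.ker Bd)), s₀ ≠ 0 → s₁ ≠ 0 → u ≠ 0 →
    ∃ (a : DetLine F (LinearMap.ker A)) (c : DetLine F (W ⧸ LinearMap.range A))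
      (k : DetLine F (LinearMap.ker B)) (e : DetLine F (W ⧸ LinearMap.range B))
      (cs : Module.Dual F (DetLine F (W ⧸ LinearMap.range A)))
      (es : Module.Dual F (DetLine F (W ⧸ LinearMap.range B))),
      (a : ExteriorAlgebra F (LinearMap.ker A)) =
        ExteriorAlgebra.map (LinearMap.ker t.L).subtype s₀ *
        ExteriorAlgebra.map (LinearMap.ker t.N).subtype s₁ ∧
      (c : ExteriorAlgebra F (W ⧸ LinearMap.range A)) =
        ExteriorAlgebra.map
          ((LinearMap.range A).mkQ ∘ₗ t.L ∘ₗ (LinearMap.ker t.N).subtype) s₁ ∧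
      (k : ExteriorAlgebra F (LinearMap.ker B)) =
        ExteriorAlgebra.map (kerProj hB ∘ₗ t.N ∘ₗ (LinearMap.ker t.L).subtype) s₀ *
        ExteriorAlgebra.map (kerProj hB ∘ₗ t.M) u ∧
      (e : ExteriorAlgebra F (W ⧸ LinearMap.range B)) =
        ExteriorAlgebra.map ((LinearMap.range B).mkQ ∘ₗ (LinearMap.ker Bd).subtype) u ∧
      cs c = 1 ∧ es e = 1 ∧
      P (a ⊗ₜ[F] cs) = (finDet (t.sigma hA hB))⁻¹ • (k ⊗ₜ[F] es)

/-- `P` is a perturbation isomorphism from the Fredholm operator `A` to its finite rank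
perturbation `B`: it is given by the defining formula for some choice of pseudo-inverses and of a
perturbation triple. -/
def IsOpPerturbationIso (A B : V →ₗ[F] W) (P : OpDet A ≃ₗ[F] OpDet B) : Prop :=
  ∃ (Ad Bd : W →ₗ[F] V) (hA : IsPseudoInverse A Ad) (hB : IsPseudoInverse B Bd),
    (opIndex A ≤ 0 ∧ ∃ t : NonposTriple A Bd, t.Gives hA hB P) ∨
    (0 ≤ opIndex A ∧ ∃ t : NonnegTriple A Bd, t.Gives hA hB P)

end OperatorPerturbation

/-! ### `ℤ/2ℤ`-graded Fredholm complexes -/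

/-- A `ℤ/2ℤ`-graded complex `X₊ → X₋ → X₊`. -/
structure Z2Complex (F Xp Xm : Type*) [Field F] [AddCommGroup Xp] [Module F Xp]
    [AddCommGroup Xm] [Module F Xm] where
  dPlus : Xp →ₗ[F] Xm
  dMinus : Xm →ₗ[F] Xp
  dMinus_dPlus : dMinus ∘ₗ dPlus = 0
  dPlus_dMinus : dPlus ∘ₗ dMinus = 0

section Complexes

variable {Xp Xm : Type*} [AddCommGroup Xp] [Module F Xp] [AddCommGroup Xm] [Module F Xm]

/-- `H₊(D) = Ker d₊ / Im d₋`. -/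
abbrev Z2Complex.HPlus (D : Z2Complex F Xp Xm) : Type _ :=
  LinearMap.ker D.dPlus ⧸ (LinearMap.range D.dMinus).submoduleOf (LinearMap.ker D.dPlus)

/-- `H₋(D) = Ker d₋ / Im d₊`. -/
abbrev Z2Complex.HMinus (D : Z2Complex F Xp Xm) : Type _ :=
  LinearMap.ker D.dMinus ⧸ (LinearMap.range D.dPlus).submoduleOf (LinearMap.ker D.dMinus)

end Complexes

/-- A `ℤ/2ℤ`-graded Fredholm complex: the homology groups are finite dimensional. -/
structure FredholmComplex (F Xp Xm : Type*) [Field F] [AddCommGroup Xp] [Module F Xp]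
    [AddCommGroup Xm] [Module F Xm] extends Z2Complex F Xp Xm where
  finite_HPlus : FiniteDimensional F toZ2Complex.HPlus
  finite_HMinus : FiniteDimensional F toZ2Complex.HMinus

namespace FredholmComplex

variable {Xp Xm : Type*} [AddCommGroup Xp] [Module F Xp] [AddCommGroup Xm] [Module F Xm]

/-- The determinant line `|D| = |H₊(D)| ⊗ |H₋(D)|^*`. -/
abbrev Det (D : FredholmComplex F Xp Xm) : Type _ :=
  DetLine F D.HPlus ⊗[F] Module.Dual F (DetLine F D.HMinus)

/-- `E` is a finite rank perturbation of `D`. -/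
def IsFiniteRankPerturbation (D E : FredholmComplex F Xp Xm) : Prop :=
  HasFiniteRank (D.dPlus - E.dPlus) ∧ HasFiniteRank (D.dMinus - E.dMinus)

/-- The `ℤ/2ℤ`-graded Fredholm complex `Dd : X₋ → X₊ → X₋`, with differentials
`d₊† = Dd.dPlus : X₋ → X₊` and `d₋† = Dd.dMinus : X₊ → X₋`, is a pseudo-inverse of `D`. -/
structure IsPseudoInv (D : FredholmComplex F Xp Xm) (Dd : FredholmComplex F Xm Xp) : Prop where
  plus : IsPseudoInverse D.dPlus Dd.dPlus
  minus : IsPseudoInverse D.dMinus Dd.dMinus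

/-- The Fredholm operator `σ₊ = d₊ + d₋† : X₊ → X₋`. -/
def sigmaPlus (D : FredholmComplex F Xp Xm) (Dd : FredholmComplex F Xm Xp) : Xp →ₗ[F] Xm :=
  D.dPlus + Dd.dMinus

section Canonical

variable {D : FredholmComplex F Xp Xm} {Dd : FredholmComplex F Xm Xp}

theorem ker_sigmaPlus_le (h : D.IsPseudoInv Dd) :
    LinearMap.ker (D.sigmaPlus Dd) ≤ LinearMap.ker D.dPlus := by
  intro x hx
  have hx' : D.dPlus x + Dd.dMinus x = 0 := by simpa [sigmaPlus] using hx
  have h1 : Dd.dPlus (Dd.dMinus x) = 0 := LinearMap.congr_fun Dd.dPlus_dMinus x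
  have h2 : D.dPlus (Dd.dPlus (D.dPlus x)) = D.dPlus x := LinearMap.congr_fun h.plus.left x
  have h3 : Dd.dPlus (D.dPlus x) = 0 := by
    have := congrArg Dd.dPlus hx'
    simpa [h1] using this
  rw [LinearMap.mem_ker, ← h2, h3, map_zero]

theorem range_dPlus_le (h : D.IsPseudoInv Dd) :
    LinearMap.range D.dPlus ≤ LinearMap.range (D.sigmaPlus Dd) := by
  rintro _ ⟨x, rfl⟩
  refine ⟨Dd.dPlus (D.dPlus x), ?_⟩
  have h1 : Dd.dMinus (Dd.dPlus (D.dPlus x)) = 0 :=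
    LinearMap.congr_fun Dd.dMinus_dPlus (D.dPlus x)
  have h2 : D.dPlus (Dd.dPlus (D.dPlus x)) = D.dPlus x := LinearMap.congr_fun h.plus.left x
  simp [sigmaPlus, h1, h2]

/-- The map `Ker σ₊ → H₊(D)` that sends a vector of `Ker σ₊ ⊆ Ker d₊` to its homology class. -/
def kerToHomology (h : D.IsPseudoInv Dd) : LinearMap.ker (D.sigmaPlus Dd) →ₗ[F] D.HPlus :=
  Submodule.mkQ _ ∘ₗ Submodule.inclusion (ker_sigmaPlus_le h)

/-- The map `H₋(D) → Coker σ₊` induced by the inclusion `Ker d₋ ⊆ X₋`. -/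
def homologyToCoker (h : D.IsPseudoInv Dd) :
    D.HMinus →ₗ[F] Xm ⧸ LinearMap.range (D.sigmaPlus Dd) :=
  Submodule.liftQ _ ((LinearMap.range (D.sigmaPlus Dd)).mkQ ∘ₗ (LinearMap.ker D.dMinus).subtype)
    (by
      intro x hx
      have hx' : (x : Xm) ∈ LinearMap.range D.dPlus := hx
      simpa using range_dPlus_le h hx')

theorem kerToHomology_bijective (h : D.IsPseudoInv Dd) :
    Function.Bijective (kerToHomology h) := by
  constructor
  · rw [injective_iff_map_eq_zero]
    rintro ⟨x, hx⟩ h0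
    have hmem : x ∈ LinearMap.range D.dMinus := by
      have h1 := (Submodule.Quotient.mk_eq_zero
        ((LinearMap.range D.dMinus).submoduleOf (LinearMap.ker D.dPlus))
        (x := Submodule.inclusion (ker_sigmaPlus_le h) ⟨x, hx⟩)).1 h0
      exact h1
    obtain ⟨y, rfl⟩ := hmem
    have hd : D.dPlus (D.dMinus y) = 0 := ker_sigmaPlus_le h hx
    have hx' : D.dPlus (D.dMinus y) + Dd.dMinus (D.dMinus y) = 0 := by
      simpa [sigmaPlus] using hx
    rw [hd, zero_add] at hx'
    have h2 : D.dMinus (Dd.dMinus (D.dMinus y)) = D.dMinus y :=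
      LinearMap.congr_fun h.minus.left y
    rw [hx', map_zero] at h2
    exact Subtype.ext h2.symm
  · intro q
    obtain ⟨⟨x, hx⟩, rfl⟩ := Submodule.mkQ_surjective _ q
    have h1 : D.dPlus (D.dMinus (Dd.dMinus x)) = 0 :=
      LinearMap.congr_fun D.dPlus_dMinus (Dd.dMinus x)
    have h2 : Dd.dMinus (D.dMinus (Dd.dMinus x)) = Dd.dMinus x :=
      LinearMap.congr_fun h.minus.right x
    have hx0 : D.dPlus x = 0 := hx
    refine ⟨⟨x - D.dMinus (Dd.dMinus x), by simp [sigmaPlus, h1, h2, hx0]⟩, ?_⟩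
    refine (Submodule.Quotient.eq _).2 ?_
    change x - D.dMinus (Dd.dMinus x) - x ∈ LinearMap.range D.dMinus
    exact ⟨-Dd.dMinus x, by simp⟩

theorem homologyToCoker_bijective (h : D.IsPseudoInv Dd) :
    Function.Bijective (homologyToCoker h) := by
  constructor
  · rw [injective_iff_map_eq_zero]
    intro q h0
    obtain ⟨⟨x, hx⟩, rfl⟩ := Submodule.mkQ_surjective _ q
    have hmem : x ∈ LinearMap.range (D.sigmaPlus Dd) :=
      (Submodule.Quotient.mk_eq_zero _).1 h0
    obtain ⟨y, rfl⟩ := hmem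
    have h1 : D.dMinus (D.dPlus y) = 0 := LinearMap.congr_fun D.dMinus_dPlus y
    have h2 : Dd.dMinus (D.dMinus (Dd.dMinus y)) = Dd.dMinus y :=
      LinearMap.congr_fun h.minus.right y
    have h3 : D.dMinus (Dd.dMinus y) = 0 := by
      have h4 : D.dMinus (D.dPlus y + Dd.dMinus y) = 0 := hx
      simpa [h1] using h4
    rw [h3, map_zero] at h2
    refine (Submodule.Quotient.mk_eq_zero _).2 ?_
    change D.dPlus y + Dd.dMinus y ∈ LinearMap.range D.dPlus
    exact ⟨y, by simp [← h2]⟩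
  · intro q
    obtain ⟨w, rfl⟩ := Submodule.mkQ_surjective _ q
    have h1 : D.dPlus (D.dMinus w) = 0 := LinearMap.congr_fun D.dPlus_dMinus w
    have h2 : D.dMinus (Dd.dMinus (D.dMinus w)) = D.dMinus w :=
      LinearMap.congr_fun h.minus.left w
    refine ⟨Submodule.mkQ _ ⟨w - Dd.dMinus (D.dMinus w), by simp [h2]⟩, ?_⟩
    refine (Submodule.Quotient.eq _).2 ?_
    change w - Dd.dMinus (D.dMinus w) - w ∈ LinearMap.range (D.sigmaPlus Dd)
    exact ⟨-D.dMinus w, by simp [sigmaPlus, h1]⟩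

/-- The canonical isomorphism `|Ker σ₊| ⊗ |Coker σ₊|^* ≅ |H₊(D)| ⊗ |H₋(D)|^*`. -/
def canonicalIso (h : D.IsPseudoInv Dd) : OpDet (D.sigmaPlus Dd) ≃ₗ[F] D.Det :=
  TensorProduct.congr
    (detLineEquiv (LinearEquiv.ofBijective _ (kerToHomology_bijective h)))
    (detLineEquiv (LinearEquiv.ofBijective _ (homologyToCoker_bijective h))).dualMap

end Canonical

/-- `P : |D| → |E|` is a perturbation isomorphism of the finite rank perturbation `D → E`: for some
pseudo-inverses `Dd` of `D` and `Ed` of `E` that are finite rank perturbations of each other it is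
a perturbation isomorphism from `σ₊ = d₊ + d₋†` to `τ₊ = δ₊ + δ₋†`, up to the canonical
identifications of determinant lines. -/
def IsPerturbationIso (D E : FredholmComplex F Xp Xm) (P : D.Det ≃ₗ[F] E.Det) : Prop :=
  ∃ (Dd Ed : FredholmComplex F Xm Xp) (hD : D.IsPseudoInv Dd) (hE : E.IsPseudoInv Ed),
    Dd.IsFiniteRankPerturbation Ed ∧
    IsOpPerturbationIso (D.sigmaPlus Dd) (E.sigmaPlus Ed)
      (((canonicalIso hD).trans P).trans (canonicalIso hE).symm)

/-- `P` is the perturbation isomorphism `P(E, D) : |D| → |E|`, that is, the one isomorphism that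
every choice of pseudo-inverses and of a perturbation triple leads to. -/
def IsThePerturbationIso (D E : FredholmComplex F Xp Xm) (P : D.Det ≃ₗ[F] E.Det) : Prop :=
  ∀ Q : D.Det ≃ₗ[F] E.Det, IsPerturbationIso D E Q ↔ Q = P

end FredholmComplex

end

end FredholmPerturbation

open scoped TensorProduct

set_option linter.unusedSectionVars false

namespace FredholmPerturbation

/-! ### Calculus of finite rank operators -/

section FiniteRank

variable {F V W Z : Type*} [Field F] [AddCommGroup V] [Module F V] [AddCommGroup W] [Module F W]
  [AddCommGroup Z] [Module F Z]

/-! The explicit formulas for P are replaced by a description that is visibly multiplicative. Choose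
finite dimensional X, Y with dim Ker A + dim X = dim Coker A + dim Y. A frame of A is an isomorphism
T from V × X to W × Y that equals A ⊕ 0 on a complement of Ker A of the form Im A†. Its `symbol` is
the induced isomorphism Ker A × X → Coker A × Y, and this, together with volumes on X and Y, singles
out a vector of |Ker A| ⊗ |Coker A|^*. The predicate `Transports` asks that P send the vector of any
frame T₁ of A to det(T₂T₁⁻¹) times the vector of any frame T₂ of B. Changing a frame changes its
vector by the determinant of the quotient of the symbols (`IsVolume.eq_det_smul`), and that is also
the determinant of the quotient of the frames (`finDet_symm_comp_eq`). Hence a single pair of frames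
suffices (`Transports.of_exists`), and the statements on inverses and composites are
multiplicativity of the determinant (`Transports.symm`, `Transports.trans`).

A triple (L, M, N) of index ≤ 0 yields such frames: T₁ is built from A + L P_A and N, the inverse of
T₂ from B† + M Q_B and the projection to Ker M, and T₁T₂⁻¹ is Σ. This explains the factor det(Σ)⁻¹.
Index ≥ 0 is the same picture with the two spaces and the roles of A and B† exchanged. So for
operators the defining formula amounts to transport (`isOpPerturbationIso_iff_transports`), and no
choice of triple or of pseudo-inverse of the operators matters.

For complexes the operators σ₊, τ₊ themselves depend on the pseudo-inverse complexes. Two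
pseudo-inverses of D give two splittings of X₊ and of X₋ into three summands, and the map matching
the splittings is unipotent, intertwines the two versions of σ₊ and induces the identity on
homology. The maps for D and for Δ differ by finite rank, and two unipotent maps that do so have
relative determinant 1 (`finDet_symm_comp_of_unipotent`), so transport on homology is unaffected
(`Transports.conj`). Pseudo-inverses that are finite rank perturbations of each other exist by
correcting inner inverses (`exists_inner_inverse_of_hasFiniteRank_sub`). -/

theorem HasFiniteRank.of_finite_left [FiniteDimensional F V] (T : V →ₗ[F] W) :
    HasFiniteRank T := by
  unfold HasFiniteRank; infer_instance

theorem HasFiniteRank.comp_left {T : V →ₗ[F] W} (h : HasFiniteRank T) (S : W →ₗ[F] Z) :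
    HasFiniteRank (S ∘ₗ T) := by
  unfold HasFiniteRank at *
  rw [LinearMap.range_comp]
  infer_instance

theorem HasFiniteRank.comp_right {T : W →ₗ[F] Z} (h : HasFiniteRank T) (S : V →ₗ[F] W) :
    HasFiniteRank (T ∘ₗ S) := by
  unfold HasFiniteRank at *
  exact Submodule.finiteDimensional_of_le (LinearMap.range_comp_le_range S T)

theorem HasFiniteRank.add {S T : V →ₗ[F] W} (hS : HasFiniteRank S) (hT : HasFiniteRank T) :
    HasFiniteRank (S + T) := by
  unfold HasFiniteRank at *
  refine Submodule.finiteDimensional_of_le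
    (S₂ := LinearMap.range S ⊔ LinearMap.range T) ?_
  rintro _ ⟨x, rfl⟩
  exact Submodule.add_mem_sup ⟨x, rfl⟩ ⟨x, rfl⟩

theorem HasFiniteRank.neg {T : V →ₗ[F] W} (hT : HasFiniteRank T) : HasFiniteRank (-T) := by
  unfold HasFiniteRank at *
  rwa [LinearMap.range_neg]

theorem HasFiniteRank.sub {S T : V →ₗ[F] W} (hS : HasFiniteRank S) (hT : HasFiniteRank T) :
    HasFiniteRank (S - T) := by
  rw [sub_eq_add_neg]
  exact hS.add hT.neg

theorem HasFiniteRank.symm {S T : V →ₗ[F] W} (h : HasFiniteRank (S - T)) :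
    HasFiniteRank (T - S) := by
  simpa using h.neg

theorem HasFiniteRank.trans {R S T : V →ₗ[F] W} (h : HasFiniteRank (R - S))
    (h' : HasFiniteRank (S - T)) : HasFiniteRank (R - T) := by
  simpa using h.add h'

theorem HasFiniteRank.comp_sub_comp {S S' : W →ₗ[F] Z} {T T' : V →ₗ[F] W}
    (hS : HasFiniteRank (S - S')) (hT : HasFiniteRank (T - T')) :
    HasFiniteRank (S ∘ₗ T - S' ∘ₗ T') := by
  have : S ∘ₗ T - S' ∘ₗ T' = (S - S') ∘ₗ T + S' ∘ₗ (T - T') := by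
    ext x; simp
  rw [this]
  exact (hS.comp_right T).add (hT.comp_left S')

theorem HasFiniteRank.add_sub_add {S S' T T' : V →ₗ[F] W}
    (hS : HasFiniteRank (S - S')) (hT : HasFiniteRank (T - T')) :
    HasFiniteRank (S + T - (S' + T')) := by
  rw [add_sub_add_comm]
  exact hS.add hT

theorem HasFiniteRank.sub_sub_sub {S S' T T' : V →ₗ[F] W}
    (hS : HasFiniteRank (S - S')) (hT : HasFiniteRank (T - T')) :
    HasFiniteRank (S - T - (S' - T')) := by
  rw [sub_sub_sub_comm]
  exact hS.sub hT

theorem HasFiniteRank.sub_self (S : V →ₗ[F] W) : HasFiniteRank (S - S) := by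
  unfold HasFiniteRank
  rw [_root_.sub_self, LinearMap.range_zero]
  infer_instance

end FiniteRank

/-! ### Determinants of finite rank perturbations of the identity -/

section Determinant

variable {F V W Z : Type*} [Field F] [AddCommGroup V] [Module F V] [AddCommGroup W] [Module F W]
  [AddCommGroup Z] [Module F Z]

/-- The Weinstein–Aronszajn identity for linear maps. -/
theorem det_id_add_comp_comm [FiniteDimensional F V] [FiniteDimensional F W]
    (a : V →ₗ[F] W) (b : W →ₗ[F] V) :
    LinearMap.det (LinearMap.id + a ∘ₗ b) = LinearMap.det (LinearMap.id + b ∘ₗ a) := by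
  classical
  have v := Module.finBasis F V
  have w := Module.finBasis F W
  rw [← LinearMap.det_toMatrix w, ← LinearMap.det_toMatrix v, map_add, map_add,
    LinearMap.toMatrix_comp w v w, LinearMap.toMatrix_comp v w v, LinearMap.toMatrix_id,
    LinearMap.toMatrix_id, Matrix.det_one_add_mul_comm]

/-- With ι the inclusion of Im(1 - T) into U and b = -(1 - T) on U, the two restrictions of T are 1
+ ιb and 1 + bι, so the Weinstein–Aronszajn identity compares them. -/
theorem finDet_eq_det_restrict {T : V →ₗ[F] V} {U : Submodule F V} [FiniteDimensional F U]
    (hU : LinearMap.range (LinearMap.id - T) ≤ U) (hT : ∀ x ∈ U, T x ∈ U) :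
    finDet T = LinearMap.det (T.restrict hT) := by
  have : FiniteDimensional F (LinearMap.range (LinearMap.id - T)) :=
    Submodule.finiteDimensional_of_le hU
  let b : U →ₗ[F] LinearMap.range (LinearMap.id - T) :=
    -((LinearMap.id - T).rangeRestrict ∘ₗ U.subtype)
  have h := det_id_add_comp_comm (Submodule.inclusion hU) b
  have h1 : LinearMap.id + Submodule.inclusion hU ∘ₗ b = T.restrict hT := by
    ext x; simp [b]
  have h2 : LinearMap.id + b ∘ₗ Submodule.inclusion hU =
      T.restrict (mapsTo_range_one_sub T) := by
    ext x; simp [b]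
  rw [h1, h2] at h
  exact h.symm

theorem hasFiniteRank_id_sub [FiniteDimensional F Z] (a : Z →ₗ[F] V) (b : V →ₗ[F] Z) :
    HasFiniteRank (LinearMap.id - (LinearMap.id + a ∘ₗ b)) := by
  have : LinearMap.id - (LinearMap.id + a ∘ₗ b) = -(a ∘ₗ b) := by simp
  rw [this]
  exact ((HasFiniteRank.of_finite_left a).comp_right b).neg

/-- `det (1 + a b) = det (1 + b a)` where `b a` acts on a finite dimensional space. -/
theorem finDet_id_add_comp [FiniteDimensional F Z] (a : Z →ₗ[F] V) (b : V →ₗ[F] Z) :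
    finDet (LinearMap.id + a ∘ₗ b) = LinearMap.det (LinearMap.id + b ∘ₗ a) := by
  have hU : LinearMap.range (LinearMap.id - (LinearMap.id + a ∘ₗ b)) ≤ LinearMap.range a := by
    rintro _ ⟨x, rfl⟩
    exact ⟨-b x, by simp⟩
  have hT : ∀ x ∈ LinearMap.range a,
      (LinearMap.id + a ∘ₗ b : V →ₗ[F] V) x ∈ LinearMap.range a := by
    rintro _ ⟨x, rfl⟩
    exact ⟨x + b (a x), by simp⟩
  rw [finDet_eq_det_restrict hU hT]
  have h := det_id_add_comp_comm a.rangeRestrict (b ∘ₗ (LinearMap.range a).subtype)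
  have h1 : LinearMap.id + a.rangeRestrict ∘ₗ b ∘ₗ (LinearMap.range a).subtype =
      (LinearMap.id + a ∘ₗ b).restrict hT := by
    ext x; simp
  have h2 : LinearMap.id + (b ∘ₗ (LinearMap.range a).subtype) ∘ₗ a.rangeRestrict =
      LinearMap.id + b ∘ₗ a := by
    ext x; simp
  rwa [h1, h2] at h

/-- All three determinants can be computed on the common invariant subspace Im(1 - S) + Im(1 - T).
-/
theorem finDet_comp {S T : V →ₗ[F] V} (hS : HasFiniteRank (LinearMap.id - S))
    (hT : HasFiniteRank (LinearMap.id - T)) : finDet (S ∘ₗ T) = finDet S * finDet T := by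
  unfold HasFiniteRank at hS hT
  let U := LinearMap.range (LinearMap.id - S) ⊔ LinearMap.range (LinearMap.id - T)
  have key : ∀ R : V →ₗ[F] V, LinearMap.range (LinearMap.id - R) ≤ U → ∀ x ∈ U, R x ∈ U := by
    intro R hR x hx
    have : R x = x - (LinearMap.id - R : V →ₗ[F] V) x := by simp
    rw [this]
    exact U.sub_mem hx (hR ⟨x, rfl⟩)
  have h1 : LinearMap.range (LinearMap.id - S) ≤ U := le_sup_left
  have h2 : LinearMap.range (LinearMap.id - T) ≤ U := le_sup_right
  have h3 : LinearMap.range (LinearMap.id - S ∘ₗ T) ≤ U := by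
    rintro _ ⟨x, rfl⟩
    have : (LinearMap.id - S ∘ₗ T : V →ₗ[F] V) x =
        (LinearMap.id - T : V →ₗ[F] V) x + (LinearMap.id - S : V →ₗ[F] V) (T x) := by
      simp
    rw [this]
    exact U.add_mem (h2 ⟨x, rfl⟩) (h1 ⟨_, rfl⟩)
  have : FiniteDimensional F U := by infer_instance
  rw [finDet_eq_det_restrict h1 (key S h1), finDet_eq_det_restrict h2 (key T h2),
    finDet_eq_det_restrict h3 (key _ h3), ← LinearMap.det_comp]
  rfl

/-- Factoring T = 1 + ab through Im(1 - T) turns the conjugate into 1 + (ea)(be⁻¹); both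
determinants equal det(1 + ba). -/
theorem finDet_conj (e : V ≃ₗ[F] W) (T : V →ₗ[F] V) (hT : HasFiniteRank (LinearMap.id - T)) :
    finDet (e.toLinearMap ∘ₗ T ∘ₗ e.symm.toLinearMap) = finDet T := by
  unfold HasFiniteRank at hT
  let b : V →ₗ[F] LinearMap.range (LinearMap.id - T) := -(LinearMap.id - T).rangeRestrict
  let a := (LinearMap.range (LinearMap.id - T)).subtype
  have h1 : T = LinearMap.id + a ∘ₗ b := by
    ext x; simp [a, b]
  have h2 : e.toLinearMap ∘ₗ T ∘ₗ e.symm.toLinearMap =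
      LinearMap.id + (e.toLinearMap ∘ₗ a) ∘ₗ (b ∘ₗ e.symm.toLinearMap) := by
    ext x; simp [a, b]
  rw [h2, finDet_id_add_comp]
  conv_rhs => rw [h1, finDet_id_add_comp]
  congr 2
  ext x; simp

theorem hasFiniteRank_conj (e : V ≃ₗ[F] W) {T : V →ₗ[F] V}
    (hT : HasFiniteRank (LinearMap.id - T)) :
    HasFiniteRank (LinearMap.id - e.toLinearMap ∘ₗ T ∘ₗ e.symm.toLinearMap) := by
  have : LinearMap.id - e.toLinearMap ∘ₗ T ∘ₗ e.symm.toLinearMap =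
      e.toLinearMap ∘ₗ (LinearMap.id - T) ∘ₗ e.symm.toLinearMap := by
    ext x; simp
  rw [this]
  exact (hT.comp_right _).comp_left _

theorem hasFiniteRank_id_sub_comp {S T : V →ₗ[F] V} (hS : HasFiniteRank (LinearMap.id - S))
    (hT : HasFiniteRank (LinearMap.id - T)) : HasFiniteRank (LinearMap.id - S ∘ₗ T) := by
  simpa using hS.comp_sub_comp hT

@[simp]
theorem finDet_id : finDet (LinearMap.id : V →ₗ[F] V) = 1 := by
  have := finDet_id_add_comp (F := F) (V := V) (Z := Fin 0 → F) 0 0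
  simpa using this

theorem finDet_mul_finDet_symm (e : V ≃ₗ[F] V)
    (h : HasFiniteRank (LinearMap.id - e.toLinearMap)) :
    finDet e.toLinearMap * finDet e.symm.toLinearMap = 1 := by
  have h' : HasFiniteRank (LinearMap.id - e.symm.toLinearMap) := by
    have : LinearMap.id - e.symm.toLinearMap =
        -((LinearMap.id - e.toLinearMap) ∘ₗ e.symm.toLinearMap) := by
      ext x; simp
    rw [this]
    exact (h.comp_right _).neg
  rw [← finDet_comp h h']
  simp

theorem finDet_ne_zero (e : V ≃ₗ[F] V)
    (h : HasFiniteRank (LinearMap.id - e.toLinearMap)) : finDet e.toLinearMap ≠ 0 :=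
  left_ne_zero_of_mul_eq_one (finDet_mul_finDet_symm e h)

/-- The characteristic polynomial of the nilpotent map -n is a power of X; its value at 1 is det(1 +
n). -/
theorem det_id_add_of_pow_eq_zero [FiniteDimensional F V] {n : Module.End F V} {k : ℕ}
    (h : n ^ k = 0) : LinearMap.det (LinearMap.id + n) = 1 := by
  have h1 : IsNilpotent (-n) := ⟨k, by rw [neg_pow, h, mul_zero]⟩
  have h3 := LinearMap.eval_charpoly (-n) 1
  rw [h1.charpoly_eq_X_pow_finrank] at h3
  simpa [Module.End.one_eq_id] using h3.symm

/-- If `g` and `h` are unipotent and differ by an operator of finite rank, then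
`det (g⁻¹ h) = 1`. -/
theorem finDet_symm_comp_of_unipotent (g h : V ≃ₗ[F] V) {k : ℕ}
    (hg : (g.toLinearMap - LinearMap.id : Module.End F V) ^ (k + 1) = 0)
    (hh : (h.toLinearMap - LinearMap.id : Module.End F V) ^ (k + 1) = 0)
    (hgh : HasFiniteRank (h.toLinearMap - g.toLinearMap)) :
    finDet (g.symm.toLinearMap ∘ₗ h.toLinearMap) = 1 := by
  set n : Module.End F V := g.toLinearMap - LinearMap.id with hn
  set m : Module.End F V := h.toLinearMap - LinearMap.id with hm
  have hgn : ∀ x, g x = x + n x := by simp [hn]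
  have hhm : ∀ x, h x = x + m x := by simp [hm]
  unfold HasFiniteRank at hgh
  set R := LinearMap.range (h.toLinearMap - g.toLinearMap) with hR
  -- The n-stable span of Im(h - g). It is finite dimensional because n is nilpotent, and h
  -- preserves it because h and g agree modulo R. On it g and h are both unipotent, so each has
  -- determinant 1.
  let U : Submodule F V := ⨆ i : Fin (k + 1), R.map (n ^ (i : ℕ))
  have hUle : ∀ i, R.map (n ^ i) ≤ U := by
    intro i
    by_cases hi : i < k + 1
    · exact le_iSup (fun i : Fin (k + 1) => R.map (n ^ (i : ℕ))) ⟨i, hi⟩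
    · rw [pow_eq_zero_of_le (not_lt.1 hi) hg, Submodule.map_zero]
      exact bot_le
  have hRU : R ≤ U := by simpa [Module.End.one_eq_id] using hUle 0
  have hnU : ∀ x ∈ U, n x ∈ U := by
    have : U.map n ≤ U := by
      rw [Submodule.map_iSup]
      refine iSup_le fun i => ?_
      rw [← Submodule.map_comp, ← Module.End.mul_eq_comp, ← pow_succ']
      exact hUle _
    exact fun x hx => this ⟨x, hx, rfl⟩
  have hgU : ∀ x ∈ U, g.toLinearMap x ∈ U := fun x hx => by
    simpa [hgn] using U.add_mem hx (hnU x hx)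
  have hhU : ∀ x ∈ U, h.toLinearMap x ∈ U := fun x hx => by
    have : h.toLinearMap x = g.toLinearMap x + (h.toLinearMap - g.toLinearMap) x := by simp
    rw [this]
    exact U.add_mem (hgU x hx) (hRU ⟨x, rfl⟩)
  have hmU : ∀ x ∈ U, m x ∈ U := fun x hx => by
    simpa [hm] using U.sub_mem (hhU x hx) hx
  have : FiniteDimensional F U := by
    have : ∀ i : Fin (k + 1), FiniteDimensional F (R.map (n ^ (i : ℕ))) := fun i => inferInstance
    exact Submodule.finiteDimensional_iSup _
  have hginj : Function.Injective (g.toLinearMap.restrict hgU) := by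
    intro x y hxy
    have := congrArg Subtype.val hxy
    exact Subtype.ext (g.injective this)
  have hgsU : ∀ x ∈ U, g.symm x ∈ U := by
    intro x hx
    obtain ⟨y, hy⟩ := LinearMap.surjective_of_injective hginj ⟨x, hx⟩
    have : g y = x := congrArg Subtype.val hy
    rw [← this]
    simp
  have hT : ∀ x ∈ U, (g.symm.toLinearMap ∘ₗ h.toLinearMap) x ∈ U :=
    fun x hx => hgsU _ (hhU x hx)
  have hle : LinearMap.range (LinearMap.id - g.symm.toLinearMap ∘ₗ h.toLinearMap) ≤ U := by
    rintro _ ⟨x, rfl⟩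
    have : (LinearMap.id - g.symm.toLinearMap ∘ₗ h.toLinearMap : V →ₗ[F] V) x =
        g.symm (-((h.toLinearMap - g.toLinearMap) x)) := by simp
    rw [this]
    exact hgsU _ (U.neg_mem (hRU ⟨x, rfl⟩))
  rw [finDet_eq_det_restrict hle hT]
  have hdet : ∀ (e : V ≃ₗ[F] V) (l : Module.End F V) (he : ∀ x ∈ U, e.toLinearMap x ∈ U),
      (∀ x ∈ U, l x ∈ U) → (∀ x, e x = x + l x) → l ^ (k + 1) = 0 →
      LinearMap.det (e.toLinearMap.restrict he) = 1 := by
    intro e l he hl hel hpow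
    have h1 : e.toLinearMap.restrict he = LinearMap.id + LinearMap.restrict l hl := by
      ext x; simp [hel]
    rw [h1]
    refine det_id_add_of_pow_eq_zero (k := k + 1) ?_
    rw [Module.End.pow_restrict]
    ext x; simp [hpow]
  have hcomp : g.toLinearMap.restrict hgU ∘ₗ
      (g.symm.toLinearMap ∘ₗ h.toLinearMap).restrict hT = h.toLinearMap.restrict hhU := by
    ext x; simp
  have := congrArg LinearMap.det hcomp
  rw [LinearMap.det_comp, hdet g n hgU hnU hgn hg, hdet h m hhU hmU hhm hh, one_mul] at this
  exact this

end Determinant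

/-! ### Determinant lines and wedge products -/

section Lines

variable {F V W Z : Type*} [Field F] [AddCommGroup V] [Module F V] [AddCommGroup W] [Module F W]
  [AddCommGroup Z] [Module F Z]

theorem coe_exteriorPower_map {n : ℕ} (f : V →ₗ[F] W) (x : ⋀[F]^n V) :
    (exteriorPower.map n f x : ExteriorAlgebra F W) = ExteriorAlgebra.map f x := by
  have h : (⋀[F]^n W).subtype ∘ₗ exteriorPower.map n f =
      (ExteriorAlgebra.map f).toLinearMap ∘ₗ (⋀[F]^n V).subtype := by
    ext v
    simp [ExteriorAlgebra.map_apply_ιMulti]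
  exact LinearMap.congr_fun h x

theorem map_mem_exteriorPower {n : ℕ} (f : V →ₗ[F] W) {x : ExteriorAlgebra F V}
    (hx : x ∈ ⋀[F]^n V) : ExteriorAlgebra.map f x ∈ ⋀[F]^n W := by
  rw [← coe_exteriorPower_map f ⟨x, hx⟩]
  exact Subtype.property _

theorem mul_mem_exteriorPower {m n : ℕ} {x y : ExteriorAlgebra F V}
    (hx : x ∈ ⋀[F]^m V) (hy : y ∈ ⋀[F]^n V) : x * y ∈ ⋀[F]^(m + n) V := by
  rw [ExteriorAlgebra.exteriorPower, pow_add]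
  exact Submodule.mul_mem_mul hx hy

theorem map_map_apply (f : V →ₗ[F] W) (g : W →ₗ[F] Z) (x : ExteriorAlgebra F V) :
    ExteriorAlgebra.map g (ExteriorAlgebra.map f x) = ExteriorAlgebra.map (g ∘ₗ f) x := by
  rw [← ExteriorAlgebra.map_comp_map]
  rfl

theorem coe_detLineEquiv (e : V ≃ₗ[F] W) (x : DetLine F V) :
    (detLineEquiv e x : ExteriorAlgebra F W) = ExteriorAlgebra.map e.toLinearMap x := by
  rw [← coe_exteriorPower_map]
  rfl

theorem one_mem_detLine (h : Module.finrank F V = 0) :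
    (1 : ExteriorAlgebra F V) ∈ DetLine F V := by
  rw [DetLine, h, ExteriorAlgebra.exteriorPower, pow_zero]
  exact Submodule.one_le.1 le_rfl

variable [FiniteDimensional F V]

theorem finrank_detLine : Module.finrank F (DetLine F V) = 1 := by
  rw [exteriorPower.finrank_eq, Nat.choose_self]

theorem exists_eq_smul {x : DetLine F V} (hx : x ≠ 0) (y : DetLine F V) : ∃ a : F, y = a • x := by
  obtain ⟨a, ha⟩ := (finrank_eq_one_iff_of_nonzero' x hx).1 finrank_detLine y
  exact ⟨a, ha.symm⟩

theorem exists_detLine_ne_zero (F V : Type*) [Field F] [AddCommGroup V] [Module F V]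
    [FiniteDimensional F V] : ∃ x : DetLine F V, x ≠ 0 := by
  have : Nontrivial (DetLine F V) :=
    Module.nontrivial_of_finrank_pos (R := F) (by rw [finrank_detLine]; exact one_pos)
  exact exists_ne 0

theorem exists_dual_eq_one {x : DetLine F V} (hx : x ≠ 0) :
    ∃ f : Module.Dual F (DetLine F V), f x = 1 := by
  obtain ⟨f, hf⟩ := (LinearMap.toSpanSingleton F (DetLine F V) x).exists_leftInverse_of_injective
    (LinearMap.ker_toSpanSingleton F hx)
  exact ⟨f, by simpa using LinearMap.congr_fun hf 1⟩

theorem dual_ext {x : DetLine F V} (hx : x ≠ 0) {f g : Module.Dual F (DetLine F V)}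
    (h : f x = g x) : f = g := by
  refine LinearMap.ext fun y => ?_
  obtain ⟨a, rfl⟩ := exists_eq_smul hx y
  rw [map_smul, map_smul, h]

/-- The alternating form `b.det`, extended linearly to the exterior power, takes the value 1 there.
-/
theorem ιMulti_basis_ne_zero {n : ℕ} (b : Module.Basis (Fin n) F V) :
    ExteriorAlgebra.ιMulti F n b ≠ 0 := by
  intro h
  have h' : exteriorPower.ιMulti F n b = 0 := Subtype.ext h
  have h1 := exteriorPower.alternatingMapLinearEquiv_apply_ιMulti b.det b
  rw [h', map_zero, b.det_self] at h1
  exact zero_ne_one h1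

theorem exists_basis_eq_smul_ιMulti {x : DetLine F V} (hx : x ≠ 0) :
    ∃ (a : F) (b : Module.Basis (Fin (Module.finrank F V)) F V), a ≠ 0 ∧
      (x : ExteriorAlgebra F V) = a • ExteriorAlgebra.ιMulti F _ b := by
  let b := Module.finBasis F V
  obtain ⟨a, ha⟩ := exists_eq_smul (x := ⟨_, ExteriorAlgebra.ιMulti_range F _ ⟨b, rfl⟩⟩)
    (fun h => ιMulti_basis_ne_zero b (congrArg Subtype.val h)) x
  refine ⟨a, b, ?_, ?_⟩
  · rintro rfl
    exact hx (by rw [ha, zero_smul])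
  · rw [ha]; rfl

/-- An endomorphism acts on the determinant line by its determinant. -/
theorem map_eq_det_smul (f : V →ₗ[F] V) (x : DetLine F V) :
    ExteriorAlgebra.map f (x : ExteriorAlgebra F V) =
      LinearMap.det f • (x : ExteriorAlgebra F V) := by
  let b := Module.finBasis F V
  have hb : exteriorPower.ιMulti F _ b ≠ 0 :=
    fun h => ιMulti_basis_ne_zero b (congrArg Subtype.val h)
  obtain ⟨a, rfl⟩ := exists_eq_smul hb x
  obtain ⟨c, hc⟩ := exists_eq_smul hb (exteriorPower.ιMulti F _ (f ∘ b))
  have h1 := congrArg (exteriorPower.alternatingMapLinearEquiv b.det) hc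
  rw [map_smul, exteriorPower.alternatingMapLinearEquiv_apply_ιMulti,
    exteriorPower.alternatingMapLinearEquiv_apply_ιMulti, b.det_comp, b.det_self, mul_one,
    smul_eq_mul, mul_one] at h1
  have h2 : ExteriorAlgebra.ιMulti F _ (f ∘ b) = c • ExteriorAlgebra.ιMulti F _ b :=
    congrArg Subtype.val hc
  rw [Submodule.coe_smul, map_smul, exteriorPower.ιMulti_apply_coe,
    ExteriorAlgebra.map_apply_ιMulti, h2, h1, smul_comm]

theorem inl_mul_inr_mem [FiniteDimensional F W] (s : DetLine F V) (t : DetLine F W) :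
    ExteriorAlgebra.map (LinearMap.inl F V W) (s : ExteriorAlgebra F V) *
      ExteriorAlgebra.map (LinearMap.inr F V W) (t : ExteriorAlgebra F W) ∈ DetLine F (V × W) := by
  rw [DetLine, Module.finrank_prod]
  exact mul_mem_exteriorPower (map_mem_exteriorPower _ s.2) (map_mem_exteriorPower _ t.2)

theorem inr_mul_inl_mem [FiniteDimensional F W] (s : DetLine F V) (t : DetLine F W) :
    ExteriorAlgebra.map (LinearMap.inr F V W) (t : ExteriorAlgebra F W) *
    ExteriorAlgebra.map (LinearMap.inl F V W) (s : ExteriorAlgebra F V) ∈ DetLine F (V × W) := by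
  rw [DetLine, Module.finrank_prod, add_comm]
  exact mul_mem_exteriorPower (map_mem_exteriorPower _ t.2) (map_mem_exteriorPower _ s.2)

/-- Both factors are multiples of wedges of bases, and the concatenated family is a basis of the
product. -/
theorem inl_mul_inr_ne_zero [FiniteDimensional F W] {s : DetLine F V} {t : DetLine F W}
    (hs : s ≠ 0) (ht : t ≠ 0) :
    ExteriorAlgebra.map (LinearMap.inl F V W) (s : ExteriorAlgebra F V) *
      ExteriorAlgebra.map (LinearMap.inr F V W) (t : ExteriorAlgebra F W) ≠ 0 := by
  obtain ⟨a, b, ha, hs⟩ := exists_basis_eq_smul_ιMulti hs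
  obtain ⟨a', b', ha', ht⟩ := exists_basis_eq_smul_ιMulti ht
  rw [hs, ht, map_smul, map_smul, smul_mul_smul_comm, ExteriorAlgebra.map_apply_ιMulti,
    ExteriorAlgebra.map_apply_ιMulti, ExteriorAlgebra.ιMulti_mul_ιMulti]
  have h : Fin.append (LinearMap.inl F V W ∘ b) (LinearMap.inr F V W ∘ b') =
      (b.prod b').reindex finSumFinEquiv := by
    ext i : 1
    refine Fin.addCases (fun i => ?_) (fun i => ?_) i <;> simp
  rw [h]
  exact smul_ne_zero (mul_ne_zero ha ha') (ιMulti_basis_ne_zero _)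

end Lines

section Equiv

variable {F V W : Type*} [Field F] [AddCommGroup V] [Module F V] [AddCommGroup W] [Module F W]

theorem map_equiv_ne_zero (e : V ≃ₗ[F] W) {x : ExteriorAlgebra F V} (hx : x ≠ 0) :
    ExteriorAlgebra.map e.toLinearMap x ≠ 0 := by
  intro h
  have h' := congrArg (ExteriorAlgebra.map e.symm.toLinearMap) h
  rw [map_map_apply, LinearEquiv.symm_comp, ExteriorAlgebra.map_id, map_zero] at h'
  exact hx h'

theorem map_equiv_mem_detLine (e : V ≃ₗ[F] W) {x : ExteriorAlgebra F V} (hx : x ∈ DetLine F V) :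
    ExteriorAlgebra.map e.toLinearMap x ∈ DetLine F W := by
  rw [DetLine, ← e.finrank_eq]
  exact map_mem_exteriorPower _ hx

end Equiv

section Coprod

variable {F U V W : Type*} [Field F] [AddCommGroup U] [Module F U] [AddCommGroup V] [Module F V]
  [AddCommGroup W] [Module F W] [FiniteDimensional F U] [FiniteDimensional F V]

theorem map_mul_map_eq (f : U →ₗ[F] W) (g : V →ₗ[F] W) (s : ExteriorAlgebra F U)
    (t : ExteriorAlgebra F V) :
    ExteriorAlgebra.map f s * ExteriorAlgebra.map g t =
      ExteriorAlgebra.map (f.coprod g) (ExteriorAlgebra.map (LinearMap.inl F U V) s *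
        ExteriorAlgebra.map (LinearMap.inr F U V) t) := by
  rw [map_mul, map_map_apply, map_map_apply, LinearMap.coprod_inl, LinearMap.coprod_inr]

/-- The wedge product `f(s) ∧ g(t)` as an element of `|W|`, when `(f, g) : U × V → W` is an
isomorphism. -/
theorem exists_detLine_eq_mul {f : U →ₗ[F] W} {g : V →ₗ[F] W}
    (h : Function.Bijective (f.coprod g)) {s : DetLine F U} {t : DetLine F V}
    (hs : s ≠ 0) (ht : t ≠ 0) :
    ∃ w : DetLine F W, w ≠ 0 ∧ (w : ExteriorAlgebra F W) =
      ExteriorAlgebra.map f (s : ExteriorAlgebra F U) *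
        ExteriorAlgebra.map g (t : ExteriorAlgebra F V) := by
  rw [map_mul_map_eq]
  refine ⟨⟨_, map_equiv_mem_detLine (LinearEquiv.ofBijective _ h) (inl_mul_inr_mem s t)⟩, ?_, rfl⟩
  intro h0
  exact map_equiv_ne_zero (LinearEquiv.ofBijective _ h) (inl_mul_inr_ne_zero hs ht)
    (congrArg Subtype.val h0)

theorem exists_detLine_eq_map {f : U →ₗ[F] W} (h : Function.Bijective f) {s : DetLine F U}
    (hs : s ≠ 0) :
    ∃ w : DetLine F W, w ≠ 0 ∧ (w : ExteriorAlgebra F W) =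
      ExteriorAlgebra.map f (s : ExteriorAlgebra F U) := by
  refine ⟨detLineEquiv (LinearEquiv.ofBijective f h) s, by simpa using hs, ?_⟩
  rw [coe_detLineEquiv]
  rfl

end Coprod

/-! ### Existence of pseudo-inverses -/

section PseudoInverse

variable {F V W : Type*} [Field F] [AddCommGroup V] [Module F V] [AddCommGroup W] [Module F W]

theorem IsPseudoInverse.left_apply {A : V →ₗ[F] W} {Ad : W →ₗ[F] V} (h : IsPseudoInverse A Ad)
    (v : V) : A (Ad (A v)) = A v :=
  LinearMap.congr_fun h.left v

theorem IsPseudoInverse.right_apply {A : V →ₗ[F] W} {Ad : W →ₗ[F] V} (h : IsPseudoInverse A Ad)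
    (w : W) : Ad (A (Ad w)) = Ad w :=
  LinearMap.congr_fun h.right w

theorem exists_inner_inverse (A : V →ₗ[F] W) : ∃ S : W →ₗ[F] V, A ∘ₗ S ∘ₗ A = A := by
  obtain ⟨s, hs⟩ := A.rangeRestrict.exists_rightInverse_of_surjective (LinearMap.range_rangeRestrict A)
  obtain ⟨p, hp⟩ := (LinearMap.range A).subtype.exists_leftInverse_of_injective
    (Submodule.ker_subtype _)
  refine ⟨s ∘ₗ p, ?_⟩
  ext v
  have h1 : p (A v) = A.rangeRestrict v := LinearMap.congr_fun hp (A.rangeRestrict v)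
  have h2 := congrArg Subtype.val (LinearMap.congr_fun hs (A.rangeRestrict v))
  simpa [h1] using h2

/-- An inner inverse S satisfies only the first equation; SAS satisfies both. -/
theorem exists_isPseudoInverse (A : V →ₗ[F] W) : ∃ Ad : W →ₗ[F] V, IsPseudoInverse A Ad := by
  obtain ⟨S, hS⟩ := exists_inner_inverse A
  have h := LinearMap.congr_fun hS
  simp only [LinearMap.comp_apply] at h
  exact ⟨S ∘ₗ A ∘ₗ S, by ext v; simp [h], by ext v; simp [h]⟩

end PseudoInverse

/-! ### Frames of an operator and their symbols -/

section Frames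

variable {F V W K C X Y : Type*} [Field F] [AddCommGroup V] [Module F V] [AddCommGroup W]
  [Module F W] [AddCommGroup K] [Module F K] [AddCommGroup C] [Module F C] [AddCommGroup X]
  [Module F X] [AddCommGroup Y] [Module F Y]

/-- The maps `i : K → V` and `π : W → C` present `K` as the kernel and `C` as the cokernel
of `A : V → W`. -/
structure IsPresentation (A : V →ₗ[F] W) (i : K →ₗ[F] V) (π : W →ₗ[F] C) : Prop where
  injective : Function.Injective i
  range_eq : LinearMap.range i = LinearMap.ker A
  surjective : Function.Surjective π
  ker_eq : LinearMap.ker π = LinearMap.range A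

theorem isPresentation_subtype_mkQ (A : V →ₗ[F] W) :
    IsPresentation A (LinearMap.ker A).subtype (LinearMap.range A).mkQ :=
  ⟨Submodule.subtype_injective _, Submodule.range_subtype _, Submodule.mkQ_surjective _,
    Submodule.ker_mkQ _⟩

/-- `T` agrees with `A ⊕ 0` on the complement `Im Ad` of the kernel of `A`. -/
def AdaptedTo (A : V →ₗ[F] W) (Ad : W →ₗ[F] V) (T : V × X →ₗ[F] W × Y) : Prop :=
  ∀ w, T (Ad w, 0) = (A (Ad w), 0)

/-- A frame of `A`: an isomorphism `V × X ≃ W × Y` that agrees with `A ⊕ 0` on a complement of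
the kernel. -/
def IsFrame (A : V →ₗ[F] W) (T : (V × X) ≃ₗ[F] (W × Y)) : Prop :=
  ∃ Ad : W →ₗ[F] V, IsPseudoInverse A Ad ∧ AdaptedTo A Ad T.toLinearMap

/-- The map from the (stabilized) kernel to the (stabilized) cokernel induced by `T`. -/
def symbol (i : K →ₗ[F] V) (π : W →ₗ[F] C) (T : V × X →ₗ[F] W × Y) : K × X →ₗ[F] C × Y :=
  π.prodMap LinearMap.id ∘ₗ T ∘ₗ i.prodMap LinearMap.id

theorem symbol_apply (i : K →ₗ[F] V) (π : W →ₗ[F] C) (T : V × X →ₗ[F] W × Y) (z : K × X) :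
    symbol i π T z = (π (T (i z.1, z.2)).1, (T (i z.1, z.2)).2) := rfl

variable {A : V →ₗ[F] W} {Ad : W →ₗ[F] V} {i : K →ₗ[F] V} {π : W →ₗ[F] C}

theorem IsPresentation.apply_left (hm : IsPresentation A i π) (k : K) : A (i k) = 0 := by
  have : i k ∈ LinearMap.ker A := hm.range_eq ▸ ⟨k, rfl⟩
  exact this

theorem IsPresentation.apply_right (hm : IsPresentation A i π) (v : V) : π (A v) = 0 := by
  have : A v ∈ LinearMap.ker π := hm.ker_eq ▸ ⟨v, rfl⟩
  exact this

theorem IsPresentation.exists_of_apply_eq_zero (hm : IsPresentation A i π) {w : W}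
    (h : π w = 0) : ∃ v, A v = w := by
  have : w ∈ LinearMap.range A := hm.ker_eq ▸ h
  exact this

/-- The coordinate in `K` of the projection `1 - Ad A` onto the kernel. -/
theorem IsPresentation.exists_kerCoord (hm : IsPresentation A i π) (hA : IsPseudoInverse A Ad) :
    ∃ r : V →ₗ[F] K, (∀ v, i (r v) = v - Ad (A v)) ∧ (∀ k, r (i k) = k) ∧ ∀ w, r (Ad w) = 0 := by
  obtain ⟨l, hl⟩ := i.exists_leftInverse_of_injective (LinearMap.ker_eq_bot.2 hm.injective)
  have key : ∀ v, i (l (v - Ad (A v))) = v - Ad (A v) := by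
    intro v
    have : v - Ad (A v) ∈ LinearMap.range i := by
      rw [hm.range_eq, LinearMap.mem_ker, map_sub, hA.left_apply, sub_self]
    obtain ⟨k, hk⟩ := this
    rw [← hk]
    exact congrArg i (LinearMap.congr_fun hl k)
  refine ⟨l ∘ₗ (LinearMap.id - Ad ∘ₗ A), by simpa using key, fun k => ?_, fun w => ?_⟩
  · have := LinearMap.congr_fun hl k
    simpa [hm.apply_left] using this
  · simp [hA.right_apply]

/-- Split v = A†Av + i(rv); on the first summand T is A ⊕ 0. Modulo Im A, then, T sees only the
kernel coordinate of v. -/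
theorem AdaptedTo.apply_eq {T : V × X →ₗ[F] W × Y} (hT : AdaptedTo A Ad T)
    (hA : IsPseudoInverse A Ad) {r : V →ₗ[F] K} (hr : ∀ v, i (r v) = v - Ad (A v)) (v : V) (x : X) :
    T (v, x) = (A v, 0) + T (i (r v), x) := by
  have h := hT (A v)
  rw [hA.left_apply] at h
  rw [← h, ← map_add, hr]
  simp

/-- T carries Im A† × 0 isomorphically onto Im A × 0, and the map between the quotients K × X and C
× Y is the symbol; this is the five lemma for that filtration. -/
theorem bijective_iff_symbol (hm : IsPresentation A i π) (hA : IsPseudoInverse A Ad)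
    {T : V × X →ₗ[F] W × Y} (hT : AdaptedTo A Ad T) :
    Function.Bijective T ↔ Function.Bijective (symbol i π T) := by
  obtain ⟨r, hr, hri, -⟩ := hm.exists_kerCoord hA
  have hdec := hT.apply_eq hA hr
  have hsym : ∀ v x, symbol i π T (r v, x) = (π (T (v, x)).1, (T (v, x)).2) := by
    intro v x
    rw [symbol_apply, hdec v x]
    simp [hm.apply_right]
  constructor
  · rintro ⟨hinj, hsurj⟩
    constructor
    · rw [injective_iff_map_eq_zero]
      rintro ⟨k, x⟩ h0
      rw [symbol_apply, Prod.mk_eq_zero] at h0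
      obtain ⟨v, hv⟩ := hm.exists_of_apply_eq_zero h0.1
      have h1 : T (i k, x) = T (Ad (A v), 0) := by
        rw [hT, hA.left_apply]
        exact Prod.ext hv.symm h0.2
      have h2 := hinj h1
      rw [Prod.mk.injEq] at h2
      have h3 : Ad (A v) = 0 := by
        rw [← hA.right_apply (A v), ← h2.1, hm.apply_left, map_zero]
      rw [h3] at h2
      exact Prod.ext (hm.injective (h2.1.trans (map_zero i).symm)) h2.2
    · rintro ⟨c, y⟩
      obtain ⟨w, rfl⟩ := hm.surjective c
      obtain ⟨⟨v, x⟩, hvx⟩ := hsurj (w, y)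
      exact ⟨(r v, x), by rw [hsym, hvx]⟩
  · rintro ⟨hinj, hsurj⟩
    constructor
    · rw [injective_iff_map_eq_zero]
      rintro ⟨v, x⟩ h0
      have h1 := hsym v x
      rw [h0, Prod.fst_zero, Prod.snd_zero, map_zero] at h1
      have h2 := (injective_iff_map_eq_zero _).1 hinj _ h1
      rw [Prod.mk_eq_zero] at h2
      have h3 := hdec v x
      rw [h0, h2.1, h2.2, map_zero, Prod.mk_zero_zero, map_zero, add_zero] at h3
      have h4 : A v = 0 := by simpa using (congrArg Prod.fst h3).symm
      have h5 := hr v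
      rw [h2.1, h4] at h5
      exact Prod.ext (by simpa using h5.symm) h2.2
    · rintro ⟨w, y⟩
      obtain ⟨⟨k, x⟩, hk⟩ := hsurj (π w, y)
      rw [symbol_apply, Prod.mk.injEq] at hk
      obtain ⟨v, hv⟩ := hm.exists_of_apply_eq_zero (w := w - (T (i k, x)).1)
        (by rw [map_sub, hk.1, sub_self])
      refine ⟨(Ad (A v), 0) + (i k, x), ?_⟩
      rw [map_add, hT, hA.left_apply, hv]
      exact Prod.ext (by simp) (by simpa using hk.2)

theorem IsFrame.bijective_symbol {T : (V × X) ≃ₗ[F] (W × Y)} (hT : IsFrame A T)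
    (hm : IsPresentation A i π) : Function.Bijective (symbol i π T.toLinearMap) := by
  obtain ⟨Ad, hA, hT⟩ := hT
  exact (bijective_iff_symbol hm hA hT).1 T.bijective

/-- The isomorphism from the stabilized kernel to the stabilized cokernel given by a frame. -/
noncomputable def IsFrame.symbolEquiv {T : (V × X) ≃ₗ[F] (W × Y)} (hT : IsFrame A T)
    (hm : IsPresentation A i π) : (K × X) ≃ₗ[F] (C × Y) :=
  LinearEquiv.ofBijective _ (hT.bijective_symbol hm)

/-- A frame is a finite rank perturbation of `A ⊕ 0`. -/
theorem IsFrame.hasFiniteRank_sub [FiniteDimensional F K] [FiniteDimensional F X]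
    {T : (V × X) ≃ₗ[F] (W × Y)} (hT : IsFrame A T) (hm : IsPresentation A i π) :
    HasFiniteRank (T.toLinearMap - LinearMap.inl F W Y ∘ₗ A ∘ₗ LinearMap.fst F V X) := by
  obtain ⟨Ad, hA, hT⟩ := hT
  obtain ⟨r, hr, -, -⟩ := hm.exists_kerCoord hA
  have : T.toLinearMap - LinearMap.inl F W Y ∘ₗ A ∘ₗ LinearMap.fst F V X =
      -- The difference factors through the finite dimensional space K × X.
      T.toLinearMap ∘ₗ i.prodMap LinearMap.id ∘ₗ r.prodMap LinearMap.id := by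
    refine LinearMap.ext fun ⟨v, x⟩ => ?_
    have := hT.apply_eq hA hr v x
    rw [LinearMap.sub_apply, this]
    simp
  rw [this]
  exact ((HasFiniteRank.of_finite_left _).comp_right _).comp_left _

theorem IsFrame.hasFiniteRank_sub_of_sub {K' C' : Type*} [AddCommGroup K'] [Module F K']
    [AddCommGroup C'] [Module F C'] [FiniteDimensional F K] [FiniteDimensional F K']
    [FiniteDimensional F X] {B : V →ₗ[F] W} {i' : K' →ₗ[F] V} {π' : W →ₗ[F] C'}
    {T T' : (V × X) ≃ₗ[F] (W × Y)} (hT : IsFrame A T) (hT' : IsFrame B T')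
    (hm : IsPresentation A i π) (hm' : IsPresentation B i' π') (h : HasFiniteRank (A - B)) :
    HasFiniteRank (T.toLinearMap - T'.toLinearMap) := by
  have h1 : HasFiniteRank (LinearMap.inl F W Y ∘ₗ A ∘ₗ LinearMap.fst F V X -
      LinearMap.inl F W Y ∘ₗ B ∘ₗ LinearMap.fst F V X) := by
    rw [← LinearMap.comp_sub, ← LinearMap.sub_comp]
    exact (h.comp_right _).comp_left _
  exact ((hT.hasFiniteRank_sub hm).trans h1).trans (hT'.hasFiniteRank_sub hm').symm

theorem hasFiniteRank_id_sub_comp_symm {T T' : V ≃ₗ[F] W}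
    (h : HasFiniteRank (T.toLinearMap - T'.toLinearMap)) :
    HasFiniteRank (LinearMap.id - T'.toLinearMap ∘ₗ T.symm.toLinearMap) := by
  have : LinearMap.id - T'.toLinearMap ∘ₗ T.symm.toLinearMap =
      (T.toLinearMap - T'.toLinearMap) ∘ₗ T.symm.toLinearMap := by
    ext x; simp
  rw [this]
  exact h.comp_right _

theorem hasFiniteRank_id_sub_symm_comp {T T' : V ≃ₗ[F] W}
    (h : HasFiniteRank (T.toLinearMap - T'.toLinearMap)) :
    HasFiniteRank (LinearMap.id - T'.symm.toLinearMap ∘ₗ T.toLinearMap) := by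
  have : LinearMap.id - T'.symm.toLinearMap ∘ₗ T.toLinearMap =
      -(T'.symm.toLinearMap ∘ₗ (T.toLinearMap - T'.toLinearMap)) := by
    ext x; simp
  rw [this]
  exact (h.comp_left _).neg

/-- Two frames of the same operator differ by the determinant of the quotient of their symbols. -/
theorem finDet_symm_comp_eq [FiniteDimensional F K] [FiniteDimensional F X]
    (hm : IsPresentation A i π) {T T' : (V × X) ≃ₗ[F] (W × Y)} (hT : IsFrame A T)
    (hT' : IsFrame A T') :
    finDet (T'.symm.toLinearMap ∘ₗ T.toLinearMap) =
      LinearMap.det ((hT'.symbolEquiv hm).symm.toLinearMap ∘ₗ symbol i π T.toLinearMap) := by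
  have hT'0 := hT'
  obtain ⟨Ad, hA, hTA⟩ := hT
  obtain ⟨Ad', hA', hTA'⟩ := hT'
  obtain ⟨r, hr, hri, hrA⟩ := hm.exists_kerCoord hA
  obtain ⟨r', hr', hri', hrA'⟩ := hm.exists_kerCoord hA'
  let I : K × X →ₗ[F] V × X := i.prodMap LinearMap.id
  let P : V × X →ₗ[F] K × X := r.prodMap LinearMap.id
  let b : V × X →ₗ[F] K × X := LinearMap.inl F K X ∘ₗ (r - r') ∘ₗ LinearMap.fst F V X
  -- S fixes the image of I and carries the complement Im A† to Im A'†. Since bI = 0, its inverse is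
  -- 1 - Ib and its determinant is 1. The remaining factor S⁻¹T'⁻¹T is the identity on Im A† × 0,
  -- hence of the form 1 + aP.
  let S : V × X →ₗ[F] V × X := LinearMap.id + I ∘ₗ b
  let a : K × X →ₗ[F] V × X :=
    (LinearMap.id - I ∘ₗ b) ∘ₗ T'.symm.toLinearMap ∘ₗ T.toLinearMap ∘ₗ I - I
  have hbI : b ∘ₗ I = 0 := by
    refine LinearMap.ext fun ⟨k, x⟩ => ?_
    simp [b, I, hri, hri']
  have hbI' : ∀ z, b (I z) = 0 := LinearMap.congr_fun hbI
  have hS : finDet S = 1 := by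
    rw [finDet_id_add_comp, hbI, add_zero, LinearMap.det_id]
  have hfac : T'.symm.toLinearMap ∘ₗ T.toLinearMap = S ∘ₗ (LinearMap.id + a ∘ₗ P) := by
    refine LinearMap.ext fun ⟨v, x⟩ => ?_
    have h1 : T (v, x) = (A v, 0) + T (I (P (v, x))) := hTA.apply_eq hA hr v x
    have h2 : T'.symm (A v, 0) = (Ad' (A v), 0) := by
      rw [LinearEquiv.symm_apply_eq]
      have := hTA' (A v)
      rw [hA'.left_apply] at this
      exact this.symm
    have h3 : (v, x) - I (P (v, x)) + I (b (v, x)) = (Ad' (A v), 0) := by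
      simp [I, P, b, hr, hr']
    simp only [S, a, LinearMap.comp_apply, LinearMap.add_apply, LinearMap.sub_apply,
      LinearMap.id_apply, map_add, map_sub, hbI', map_zero, LinearEquiv.coe_coe]
    rw [h1, map_add, h2, ← h3]
    abel
  -- As ri = 1, the composite P(1 - Ib) is r' × 1, the coordinate adapted to T'; the symbol of T'
  -- turns it into T' reduced modulo Im A.
  have hdet : LinearMap.id + P ∘ₗ a =
      (hT'0.symbolEquiv hm).symm.toLinearMap ∘ₗ symbol i π T.toLinearMap := by
    have hsym : ∀ z : V × X, symbol i π T'.toLinearMap (r' z.1, z.2) =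
        (π (T' z).1, (T' z).2) := by
      intro z
      rw [symbol_apply]
      have := hTA'.apply_eq hA' hr' z.1 z.2
      simp only [LinearEquiv.coe_coe] at this ⊢
      rw [Prod.mk.eta] at this
      rw [this]
      simp [hm.apply_right]
    refine LinearMap.ext fun z => ?_
    rw [LinearMap.comp_apply, LinearEquiv.coe_coe, LinearEquiv.eq_symm_apply]
    have h1 : (LinearMap.id + P ∘ₗ a : K × X →ₗ[F] K × X) z =
        (r' (T'.symm (T (I z))).1, (T'.symm (T (I z))).2) := by
      obtain ⟨k, x⟩ := z
      simp [a, P, I, b, hri]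
    rw [h1]
    change symbol i π T'.toLinearMap _ = _
    rw [hsym, LinearEquiv.apply_symm_apply]
    rfl
  rw [hfac, finDet_comp (hasFiniteRank_id_sub I b) (hasFiniteRank_id_sub a P), hS, one_mul,
    finDet_id_add_comp, hdet]

/-- A presented operator of the appropriate index has a frame. -/
theorem exists_isFrame [FiniteDimensional F K] [FiniteDimensional F C] [FiniteDimensional F X]
    [FiniteDimensional F Y] (hm : IsPresentation A i π)
    (hd : Module.finrank F K + Module.finrank F X = Module.finrank F C + Module.finrank F Y) :
    ∃ T : (V × X) ≃ₗ[F] (W × Y), IsFrame A T := by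
  obtain ⟨Ad, hA⟩ := exists_isPseudoInverse A
  obtain ⟨r, hr, hri, hrA⟩ := hm.exists_kerCoord hA
  obtain ⟨ρ, hρ⟩ := π.exists_rightInverse_of_surjective (LinearMap.range_eq_top.2 hm.surjective)
  have hρ' : ∀ c, π (ρ c) = c := LinearMap.congr_fun hρ
  -- Any isomorphism will do as symbol: transplanted along r and a section of π and added to A ⊕ 0,
  -- it gives a frame.
  let R : (K × X) ≃ₗ[F] (C × Y) := LinearEquiv.ofFinrankEq _ _ (by simpa using hd)
  let T : V × X →ₗ[F] W × Y := LinearMap.inl F W Y ∘ₗ A ∘ₗ LinearMap.fst F V X +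
    ρ.prodMap LinearMap.id ∘ₗ R.toLinearMap ∘ₗ r.prodMap LinearMap.id
  have hT : AdaptedTo A Ad T := fun w => by
    simp [T, hrA, Prod.mk_zero_zero]
  have hsym : symbol i π T = R.toLinearMap := by
    refine LinearMap.ext fun ⟨k, x⟩ => ?_
    simp [symbol_apply, T, hri, hm.apply_left, hρ']
  refine ⟨LinearEquiv.ofBijective T ((bijective_iff_symbol hm hA hT).2 ?_), Ad, hA, hT⟩
  rw [hsym]
  exact R.bijective

end Frames

/-! ### The vector of a determinant line defined by a symbol -/

section Volumes

variable {F K C X Y : Type*} [Field F] [AddCommGroup K] [Module F K] [AddCommGroup C] [Module F C]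
  [AddCommGroup X] [Module F X] [AddCommGroup Y] [Module F Y]

/-- `v = s ⊗ c^*` for some `s`, `c` with `R (s ∧ εX) = εY ∧ c`. -/
def IsVolume (R : K × X →ₗ[F] C × Y) (εX : DetLine F X) (εY : DetLine F Y)
    (v : DetLine F K ⊗[F] Module.Dual F (DetLine F C)) : Prop :=
  ∃ (s : DetLine F K) (c : DetLine F C) (cs : Module.Dual F (DetLine F C)),
    cs c = 1 ∧ v = s ⊗ₜ[F] cs ∧
    ExteriorAlgebra.map R
      (ExteriorAlgebra.map (LinearMap.inl F K X) (s : ExteriorAlgebra F K) *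
        ExteriorAlgebra.map (LinearMap.inr F K X) (εX : ExteriorAlgebra F X)) =
      ExteriorAlgebra.map (LinearMap.inr F C Y) (εY : ExteriorAlgebra F Y) *
        ExteriorAlgebra.map (LinearMap.inl F C Y) (c : ExteriorAlgebra F C)

theorem IsVolume.smul {R : K × X →ₗ[F] C × Y} {εX : DetLine F X} {εY : DetLine F Y}
    {v : DetLine F K ⊗[F] Module.Dual F (DetLine F C)} (hv : IsVolume R εX εY v) {a b : F}
    (ha : a ≠ 0) : IsVolume R (a • εX) (b • εY) ((b * a⁻¹) • v) := by
  obtain ⟨s, c, cs, hc, rfl, h⟩ := hv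
  refine ⟨(b * a⁻¹) • s, c, cs, hc, by rw [TensorProduct.smul_tmul'], ?_⟩
  simp only [Submodule.coe_smul, map_smul, smul_mul_smul_comm, h]
  rw [mul_assoc, inv_mul_cancel₀ ha, mul_one, smul_mul_assoc]

variable [FiniteDimensional F K] [FiniteDimensional F C] [FiniteDimensional F X]
  [FiniteDimensional F Y]

theorem inr_mul_inl_ne_zero {c : DetLine F C} {εY : DetLine F Y} (hc : c ≠ 0) (hY : εY ≠ 0) :
    ExteriorAlgebra.map (LinearMap.inr F C Y) (εY : ExteriorAlgebra F Y) *
        ExteriorAlgebra.map (LinearMap.inl F C Y) (c : ExteriorAlgebra F C) ≠ 0 := by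
  have h := map_equiv_ne_zero (LinearEquiv.prodComm F Y C) (inl_mul_inr_ne_zero hY hc)
  rw [map_mul, map_map_apply, map_map_apply] at h
  exact h

theorem IsVolume.left_ne_zero {R : (K × X) →ₗ[F] (C × Y)} {εX : DetLine F X} {εY : DetLine F Y}
    (hY : εY ≠ 0) {s : DetLine F K} {c : DetLine F C} (hc : c ≠ 0)
    (h : ExteriorAlgebra.map R
      (ExteriorAlgebra.map (LinearMap.inl F K X) (s : ExteriorAlgebra F K) *
        ExteriorAlgebra.map (LinearMap.inr F K X) (εX : ExteriorAlgebra F X)) =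
      ExteriorAlgebra.map (LinearMap.inr F C Y) (εY : ExteriorAlgebra F Y) *
        ExteriorAlgebra.map (LinearMap.inl F C Y) (c : ExteriorAlgebra F C)) : s ≠ 0 := by
  rintro rfl
  refine inr_mul_inl_ne_zero hc hY ?_
  rw [← h]
  simp

theorem exists_isVolume (R : (K × X) ≃ₗ[F] (C × Y)) {εX : DetLine F X} {εY : DetLine F Y}
    (hX : εX ≠ 0) (hY : εY ≠ 0) : ∃ v, IsVolume R.toLinearMap εX εY v := by
  obtain ⟨s, hs⟩ := exists_detLine_ne_zero F K
  obtain ⟨c, hc⟩ := exists_detLine_ne_zero F C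
  obtain ⟨cs, hcs⟩ := exists_dual_eq_one hc
  let z : DetLine F (K × X) := ⟨_, inl_mul_inr_mem s εX⟩
  let w : DetLine F (C × Y) := ⟨_, inr_mul_inl_mem c εY⟩
  have hw : w ≠ 0 := fun h => inr_mul_inl_ne_zero hc hY (congrArg Subtype.val h)
  have hz : z ≠ 0 := fun h => inl_mul_inr_ne_zero hs hX (congrArg Subtype.val h)
  have hz' : detLineEquiv R z ≠ 0 := by simpa using hz
  obtain ⟨a, ha⟩ := exists_eq_smul hz' w
  refine ⟨(a • s) ⊗ₜ cs, a • s, c, cs, hcs, rfl, ?_⟩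
  have h := congrArg Subtype.val ha
  rw [Submodule.coe_smul, coe_detLineEquiv] at h
  change _ = (w : ExteriorAlgebra F (C × Y))
  rw [h, Submodule.coe_smul, map_smul, smul_mul_assoc, map_smul]

/-- Pairing s ⊗ c^* with a functional that is 1 on s, and with c, gives 1. -/
theorem IsVolume.ne_zero {R : (K × X) →ₗ[F] (C × Y)} {εX : DetLine F X} {εY : DetLine F Y}
    (hY : εY ≠ 0) {v} (hv : IsVolume R εX εY v) : v ≠ 0 := by
  obtain ⟨s, c, cs, hc, rfl, h⟩ := hv
  have hc0 : c ≠ 0 := by rintro rfl; simp at hc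
  have hs0 := IsVolume.left_ne_zero hY hc0 h
  obtain ⟨f, hf⟩ := exists_dual_eq_one hs0
  intro h0
  have h1 := congrArg ((TensorProduct.lid F F).toLinearMap ∘ₗ
    TensorProduct.map f (LinearMap.applyₗ (R := F) c)) h0
  simp [hf, hc] at h1

/-- Changing the symbol changes the volume by a determinant. -/
theorem IsVolume.eq_det_smul {R R' : (K × X) ≃ₗ[F] (C × Y)} {εX : DetLine F X} {εY : DetLine F Y}
    (hX : εX ≠ 0) (hY : εY ≠ 0) {v v'} (hv : IsVolume R.toLinearMap εX εY v)
    (hv' : IsVolume R'.toLinearMap εX εY v') :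
    v' = LinearMap.det (R'.symm.toLinearMap ∘ₗ R.toLinearMap) • v := by
  obtain ⟨s, c, cs, hc, rfl, h⟩ := hv
  obtain ⟨s', c', cs', hc', rfl, h'⟩ := hv'
  have hc0 : c ≠ 0 := by rintro rfl; simp at hc
  have hc0' : c' ≠ 0 := by rintro rfl; simp at hc'
  have hs0 := IsVolume.left_ne_zero hY hc0 h
  obtain ⟨β, rfl⟩ := exists_eq_smul hc0 c'
  obtain ⟨α, rfl⟩ := exists_eq_smul hs0 s'
  have hcs : cs = β • cs' := by
    refine dual_ext hc0 ?_
    rw [hc, LinearMap.smul_apply, ← map_smul, hc']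
  let z : DetLine F (K × X) := ⟨_, inl_mul_inr_mem s εX⟩
  have hz : (z : ExteriorAlgebra F (K × X)) ≠ 0 := inl_mul_inr_ne_zero hs0 hX
  have h1 := map_eq_det_smul (R'.symm.toLinearMap ∘ₗ R.toLinearMap) z
  set d := LinearMap.det (R'.symm.toLinearMap ∘ₗ R.toLinearMap) with hd
  have h2 : ExteriorAlgebra.map R.toLinearMap (z : ExteriorAlgebra F (K × X)) =
      d • ExteriorAlgebra.map R'.toLinearMap (z : ExteriorAlgebra F (K × X)) := by
    rw [← map_smul, ← h1, map_map_apply, ← LinearMap.comp_assoc, LinearEquiv.comp_symm,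
      LinearMap.id_comp]
  have h3 : α • ExteriorAlgebra.map R'.toLinearMap (z : ExteriorAlgebra F (K × X)) =
      β • ExteriorAlgebra.map R.toLinearMap (z : ExteriorAlgebra F (K × X)) := by
    have e1 : ExteriorAlgebra.map R.toLinearMap (z : ExteriorAlgebra F (K × X)) = _ := h
    rw [e1]
    simp only [Submodule.coe_smul, map_smul, smul_mul_assoc, mul_smul_comm] at h'
    exact h'
  rw [h2, smul_smul] at h3
  -- With s' = αs and c' = βc one has c'^* = β⁻¹c^*, so the vector is multiplied by αβ⁻¹, which is
  -- d.
  have h4 : α = β * d := smul_left_injective F (map_equiv_ne_zero R' hz) h3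
  rw [hcs, h4, TensorProduct.smul_tmul', ← TensorProduct.smul_tmul, smul_smul, mul_comm]

theorem finrank_detLine_tensor_dual :
    Module.finrank F (DetLine F K ⊗[F] Module.Dual F (DetLine F C)) = 1 := by
  rw [Module.finrank_tensorProduct, Subspace.dual_finrank_eq, finrank_detLine, finrank_detLine,
    one_mul]

theorem exists_equiv_apply_eq {L L' : Type*} [AddCommMonoid L] [Module F L] [AddCommMonoid L']
    [Module F L'] (hL : Module.finrank F L = 1) (hL' : Module.finrank F L' = 1) {v : L} {w : L'}
    (hv : v ≠ 0) (hw : w ≠ 0) : ∃ P : L ≃ₗ[F] L', P v = w := by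
  -- Only additive monoids are assumed; negation is multiplication by -1.
  let : AddCommGroup L := Module.addCommMonoidToAddCommGroup F
  let : AddCommGroup L' := Module.addCommMonoidToAddCommGroup F
  have := Module.finite_of_finrank_eq_succ hL
  have := Module.finite_of_finrank_eq_succ hL'
  let e : L ≃ₗ[F] L' := LinearEquiv.ofFinrankEq _ _ (hL.trans hL'.symm)
  obtain ⟨a, ha⟩ := (finrank_eq_one_iff_of_nonzero' (e v) (by simpa using hv)).1 hL' w
  have ha0 : a ≠ 0 := by rintro rfl; exact hw (by rw [← ha, zero_smul])
  exact ⟨e.trans (LinearEquiv.smulOfNeZero F L' a ha0), ha⟩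

theorem equiv_ext_of_apply_eq {L L' : Type*} [AddCommMonoid L] [Module F L] [AddCommMonoid L']
    [Module F L'] (hL : Module.finrank F L = 1) {v : L} (hv : v ≠ 0) {P Q : L ≃ₗ[F] L'}
    (h : P v = Q v) : P = Q := by
  let : AddCommGroup L := Module.addCommMonoidToAddCommGroup F
  ext x
  obtain ⟨a, rfl⟩ := (finrank_eq_one_iff_of_nonzero' v hv).1 hL x
  rw [map_smul, map_smul, h]

end Volumes

/-! ### Relative determinants of two isomorphisms -/

section RelativeDeterminant

variable {F V W : Type*} [Field F] [AddCommGroup V] [Module F V] [AddCommGroup W] [Module F W]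

/-- TS⁻¹ is the conjugate of S⁻¹T by S. This allows relative determinants to be multiplied on the
source while transport is stated on the target. -/
theorem finDet_comp_symm {S T : V ≃ₗ[F] W} (h : HasFiniteRank (S.toLinearMap - T.toLinearMap)) :
    finDet (T.toLinearMap ∘ₗ S.symm.toLinearMap) = finDet (S.symm.toLinearMap ∘ₗ T.toLinearMap) := by
  rw [← finDet_conj S _ (hasFiniteRank_id_sub_symm_comp h.symm)]
  congr 1
  ext x; simp

theorem finDet_symm_comp_mul {R S T : V ≃ₗ[F] W}
    (h : HasFiniteRank (R.toLinearMap - S.toLinearMap))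
    (h' : HasFiniteRank (S.toLinearMap - T.toLinearMap)) :
    finDet (R.symm.toLinearMap ∘ₗ S.toLinearMap) * finDet (S.symm.toLinearMap ∘ₗ T.toLinearMap) =
      finDet (R.symm.toLinearMap ∘ₗ T.toLinearMap) := by
  rw [← finDet_comp (hasFiniteRank_id_sub_symm_comp h.symm)
    (hasFiniteRank_id_sub_symm_comp h'.symm)]
  congr 1
  ext x; simp

end RelativeDeterminant

/-! ### Transport of volumes: existence, uniqueness, inverse, composition -/

section Perturbation

variable {F V W X Y K₁ C₁ K₂ C₂ K₃ C₃ : Type*} [Field F] [AddCommGroup V] [Module F V]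
  [AddCommGroup W] [Module F W] [AddCommGroup X] [Module F X] [AddCommGroup Y] [Module F Y]
  [AddCommGroup K₁] [Module F K₁] [AddCommGroup C₁] [Module F C₁]
  [AddCommGroup K₂] [Module F K₂] [AddCommGroup C₂] [Module F C₂]
  [AddCommGroup K₃] [Module F K₃] [AddCommGroup C₃] [Module F C₃]
  [FiniteDimensional F K₁] [FiniteDimensional F C₁] [FiniteDimensional F K₂]
  [FiniteDimensional F C₂] [FiniteDimensional F K₃] [FiniteDimensional F C₃]
  [FiniteDimensional F X] [FiniteDimensional F Y]

/-- The operators `A` and `B`, the symbols taken with respect to `(i₁, π₁)` and `(i₂, π₂)`: the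
isomorphism `P` maps the volume of a frame `T₁` of `A` to `det (T₂ T₁⁻¹)` times the volume of a
frame `T₂` of `B`. -/
def Transports (X Y : Type*) [AddCommGroup X] [Module F X] [AddCommGroup Y] [Module F Y]
    (A B : V →ₗ[F] W) (i₁ : K₁ →ₗ[F] V) (π₁ : W →ₗ[F] C₁) (i₂ : K₂ →ₗ[F] V) (π₂ : W →ₗ[F] C₂)
    (P : (DetLine F K₁ ⊗[F] Module.Dual F (DetLine F C₁)) ≃ₗ[F]
      (DetLine F K₂ ⊗[F] Module.Dual F (DetLine F C₂))) : Prop :=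
  ∀ (T₁ T₂ : (V × X) ≃ₗ[F] (W × Y)), IsFrame A T₁ → IsFrame B T₂ →
    ∀ (εX : DetLine F X) (εY : DetLine F Y), εX ≠ 0 → εY ≠ 0 →
    ∀ v₁ v₂, IsVolume (symbol i₁ π₁ T₁.toLinearMap) εX εY v₁ →
      IsVolume (symbol i₂ π₂ T₂.toLinearMap) εX εY v₂ →
      P v₁ = finDet (T₂.toLinearMap ∘ₗ T₁.symm.toLinearMap) • v₂

variable {A B C : V →ₗ[F] W} {i₁ : K₁ →ₗ[F] V} {π₁ : W →ₗ[F] C₁} {i₂ : K₂ →ₗ[F] V}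
  {π₂ : W →ₗ[F] C₂} {i₃ : K₃ →ₗ[F] V} {π₃ : W →ₗ[F] C₃}

/-- Rescaling the volumes of X and Y multiplies v₁ and v₂ by the same scalar. Replacing the frames
multiplies v₁ and v₂ by relative determinants of frames, and these are absorbed by the cocycle rule
for determinants. -/
theorem Transports.of_exists (hA : IsPresentation A i₁ π₁) (hB : IsPresentation B i₂ π₂)
    (hAB : HasFiniteRank (A - B))
    {P : (DetLine F K₁ ⊗[F] Module.Dual F (DetLine F C₁)) ≃ₗ[F]
      (DetLine F K₂ ⊗[F] Module.Dual F (DetLine F C₂))}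
    {T₁ T₂ : (V × X) ≃ₗ[F] (W × Y)} (hT₁ : IsFrame A T₁) (hT₂ : IsFrame B T₂)
    {εX : DetLine F X} {εY : DetLine F Y} (hX : εX ≠ 0) (hY : εY ≠ 0) {v₁ v₂}
    (hv₁ : IsVolume (symbol i₁ π₁ T₁.toLinearMap) εX εY v₁)
    (hv₂ : IsVolume (symbol i₂ π₂ T₂.toLinearMap) εX εY v₂)
    (h : P v₁ = finDet (T₂.toLinearMap ∘ₗ T₁.symm.toLinearMap) • v₂) :
    Transports X Y A B i₁ π₁ i₂ π₂ P := by
  intro T₁' T₂' hT₁' hT₂' εX' εY' hX' hY' v₁' v₂' hv₁' hv₂'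
  obtain ⟨a, rfl⟩ := exists_eq_smul hX εX'
  obtain ⟨b, rfl⟩ := exists_eq_smul hY εY'
  have ha : a ≠ 0 := by rintro rfl; simp at hX'
  have e₁ := IsVolume.eq_det_smul (R := hT₁.symbolEquiv hA) (R' := hT₁'.symbolEquiv hA) hX' hY'
    (hv₁.smul ha) hv₁'
  have e₂ := IsVolume.eq_det_smul (R := hT₂.symbolEquiv hB) (R' := hT₂'.symbolEquiv hB) hX' hY'
    (hv₂.smul ha) hv₂'
  have d₁ : finDet (T₁'.symm.toLinearMap ∘ₗ T₁.toLinearMap) = _ := finDet_symm_comp_eq hA hT₁ hT₁'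
  have d₂ : finDet (T₂'.symm.toLinearMap ∘ₗ T₂.toLinearMap) = _ := finDet_symm_comp_eq hB hT₂ hT₂'
  change v₁' = LinearMap.det ((hT₁'.symbolEquiv hA).symm.toLinearMap ∘ₗ
    symbol i₁ π₁ T₁.toLinearMap) • _ at e₁
  change v₂' = LinearMap.det ((hT₂'.symbolEquiv hB).symm.toLinearMap ∘ₗ
    symbol i₂ π₂ T₂.toLinearMap) • _ at e₂
  rw [← d₁] at e₁
  rw [← d₂] at e₂
  have f₁₁ := hT₁'.hasFiniteRank_sub_of_sub hT₁ hA hA (HasFiniteRank.sub_self A)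
  have f₁₂ := hT₁.hasFiniteRank_sub_of_sub hT₂ hA hB hAB
  have f₁₂' := hT₁'.hasFiniteRank_sub_of_sub hT₂' hA hB hAB
  have f₂₂ := hT₂'.hasFiniteRank_sub_of_sub hT₂ hB hB (HasFiniteRank.sub_self B)
  -- Both products equal det(T₁'⁻¹T₂), computed through T₁ and through T₂'.
  have c := (finDet_symm_comp_mul f₁₁ f₁₂).trans (finDet_symm_comp_mul f₁₂' f₂₂).symm
  rw [e₁, e₂, map_smul, map_smul, h, finDet_comp_symm f₁₂, finDet_comp_symm f₁₂', smul_smul,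
    smul_smul, smul_smul, smul_smul, ← c]
  congr 1
  ring

theorem exists_frames_and_volumes (hA : IsPresentation A i₁ π₁) (hB : IsPresentation B i₂ π₂)
    (hd₁ : Module.finrank F K₁ + Module.finrank F X = Module.finrank F C₁ + Module.finrank F Y)
    (hd₂ : Module.finrank F K₂ + Module.finrank F X = Module.finrank F C₂ + Module.finrank F Y) :
    ∃ (T₁ T₂ : (V × X) ≃ₗ[F] (W × Y)) (εX : DetLine F X) (εY : DetLine F Y),
      IsFrame A T₁ ∧ IsFrame B T₂ ∧ εX ≠ 0 ∧ εY ≠ 0 ∧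
      ∃ v₁ v₂, v₁ ≠ 0 ∧ v₂ ≠ 0 ∧ IsVolume (symbol i₁ π₁ T₁.toLinearMap) εX εY v₁ ∧
        IsVolume (symbol i₂ π₂ T₂.toLinearMap) εX εY v₂ := by
  obtain ⟨T₁, hT₁⟩ := exists_isFrame hA hd₁
  obtain ⟨T₂, hT₂⟩ := exists_isFrame hB hd₂
  obtain ⟨εX, hX⟩ := exists_detLine_ne_zero F X
  obtain ⟨εY, hY⟩ := exists_detLine_ne_zero F Y
  obtain ⟨v₁, hv₁⟩ := exists_isVolume (hT₁.symbolEquiv hA) hX hY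
  obtain ⟨v₂, hv₂⟩ := exists_isVolume (hT₂.symbolEquiv hB) hX hY
  exact ⟨T₁, T₂, εX, εY, hT₁, hT₂, hX, hY, v₁, v₂, hv₁.ne_zero hY, hv₂.ne_zero hY, hv₁, hv₂⟩

theorem exists_transports (hA : IsPresentation A i₁ π₁) (hB : IsPresentation B i₂ π₂)
    (hAB : HasFiniteRank (A - B))
    (hd₁ : Module.finrank F K₁ + Module.finrank F X = Module.finrank F C₁ + Module.finrank F Y)
    (hd₂ : Module.finrank F K₂ + Module.finrank F X = Module.finrank F C₂ + Module.finrank F Y) :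
    ∃ P, Transports X Y A B i₁ π₁ i₂ π₂ P := by
  obtain ⟨T₁, T₂, εX, εY, hT₁, hT₂, hX, hY, v₁, v₂, hv₁0, hv₂0, hv₁, hv₂⟩ :=
    exists_frames_and_volumes (X := X) (Y := Y) hA hB hd₁ hd₂
  have f₁₂ := hT₁.hasFiniteRank_sub_of_sub hT₂ hA hB hAB
  have hne : finDet (T₂.toLinearMap ∘ₗ T₁.symm.toLinearMap) ≠ 0 :=
    finDet_ne_zero (T₁.symm.trans T₂) (hasFiniteRank_id_sub_comp_symm f₁₂)
  obtain ⟨P, hP⟩ := exists_equiv_apply_eq (finrank_detLine_tensor_dual (F := F) (K := K₁) (C := C₁))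
    (finrank_detLine_tensor_dual (F := F) (K := K₂) (C := C₂)) hv₁0 (smul_ne_zero hne hv₂0)
  exact ⟨P, Transports.of_exists hA hB hAB hT₁ hT₂ hX hY hv₁ hv₂ hP⟩

theorem Transports.unique (hA : IsPresentation A i₁ π₁) (hB : IsPresentation B i₂ π₂)
    (hd₁ : Module.finrank F K₁ + Module.finrank F X = Module.finrank F C₁ + Module.finrank F Y)
    (hd₂ : Module.finrank F K₂ + Module.finrank F X = Module.finrank F C₂ + Module.finrank F Y)
    {P Q} (hP : Transports X Y A B i₁ π₁ i₂ π₂ P) (hQ : Transports X Y A B i₁ π₁ i₂ π₂ Q) :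
    P = Q := by
  obtain ⟨T₁, T₂, εX, εY, hT₁, hT₂, hX, hY, v₁, v₂, hv₁0, hv₂0, hv₁, hv₂⟩ :=
    exists_frames_and_volumes (X := X) (Y := Y) hA hB hd₁ hd₂
  refine equiv_ext_of_apply_eq (finrank_detLine_tensor_dual (F := F) (K := K₁) (C := C₁)) hv₁0 ?_
  rw [hP T₁ T₂ hT₁ hT₂ εX εY hX hY v₁ v₂ hv₁ hv₂, hQ T₁ T₂ hT₁ hT₂ εX εY hX hY v₁ v₂ hv₁ hv₂]

theorem Transports.symm (hA : IsPresentation A i₁ π₁) (hB : IsPresentation B i₂ π₂)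
    (hAB : HasFiniteRank (A - B)) {P} (hP : Transports X Y A B i₁ π₁ i₂ π₂ P) :
    Transports X Y B A i₂ π₂ i₁ π₁ P.symm := by
  intro T₂ T₁ hT₂ hT₁ εX εY hX hY v₂ v₁ hv₂ hv₁
  have f₁₂ := hT₁.hasFiniteRank_sub_of_sub hT₂ hA hB hAB
  have h := finDet_mul_finDet_symm (T₂.symm.trans T₁) (hasFiniteRank_id_sub_comp_symm f₁₂.symm)
  rw [LinearEquiv.symm_apply_eq, map_smul, hP T₁ T₂ hT₁ hT₂ εX εY hX hY v₁ v₂ hv₁ hv₂, smul_smul]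
  exact (one_smul F v₂).symm.trans (congrArg (· • v₂) h.symm)

/-- Insert a frame T₂ of the middle operator; the claim becomes det(T₂T₁⁻¹) det(T₃T₂⁻¹) =
det(T₃T₁⁻¹). -/
theorem Transports.trans (hA : IsPresentation A i₁ π₁) (hB : IsPresentation B i₂ π₂)
    (hC : IsPresentation C i₃ π₃) (hAB : HasFiniteRank (A - B)) (hBC : HasFiniteRank (B - C))
    (hd : Module.finrank F K₂ + Module.finrank F X = Module.finrank F C₂ + Module.finrank F Y)
    {P Q} (hP : Transports X Y A B i₁ π₁ i₂ π₂ P) (hQ : Transports X Y B C i₂ π₂ i₃ π₃ Q) :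
    Transports X Y A C i₁ π₁ i₃ π₃ (P.trans Q) := by
  intro T₁ T₃ hT₁ hT₃ εX εY hX hY v₁ v₃ hv₁ hv₃
  obtain ⟨T₂, hT₂⟩ := exists_isFrame hB hd
  obtain ⟨v₂, hv₂⟩ := exists_isVolume (hT₂.symbolEquiv hB) hX hY
  have f₁₂ := hT₁.hasFiniteRank_sub_of_sub hT₂ hA hB hAB
  have f₂₃ := hT₂.hasFiniteRank_sub_of_sub hT₃ hB hC hBC
  rw [LinearEquiv.trans_apply, hP T₁ T₂ hT₁ hT₂ εX εY hX hY v₁ v₂ hv₁ hv₂, map_smul,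
    hQ T₂ T₃ hT₂ hT₃ εX εY hX hY v₂ v₃ hv₂ hv₃, smul_smul, finDet_comp_symm f₁₂,
    finDet_comp_symm f₂₃, finDet_comp_symm (f₁₂.trans f₂₃), finDet_symm_comp_mul f₁₂ f₂₃]

end Perturbation

/-! ### Invariance of the index -/

section Index

variable {F V W : Type*} [Field F] [AddCommGroup V] [Module F V] [AddCommGroup W] [Module F W]

/-- The restriction A⁻¹(U) → U has the same kernel and, as U meets every class modulo Im A, the same
cokernel as A; between finite dimensional spaces the index is the difference of dimensions. -/
theorem opIndex_eq_finrank_comap_sub {A : V →ₗ[F] W} [FiniteDimensional F (LinearMap.ker A)]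
    {U : Submodule F W} [FiniteDimensional F U] (hU : U ⊔ LinearMap.range A = ⊤) :
    opIndex A = (Module.finrank F (U.comap A) : ℤ) - Module.finrank F U := by
  let f : U.comap A →ₗ[F] U := A.restrict fun x hx => hx
  have hker : Module.finrank F (LinearMap.ker f) = Module.finrank F (LinearMap.ker A) := by
    have h : (LinearMap.ker f).map (U.comap A).subtype = LinearMap.ker A := by
      ext x
      constructor
      · rintro ⟨y, hy, rfl⟩
        exact congrArg Subtype.val (LinearMap.mem_ker.1 hy)
      · intro hx
        have hx' : A x = 0 := hx
        exact ⟨⟨x, by simp [hx']⟩, Subtype.ext hx', rfl⟩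
    rw [← h]
    exact (Submodule.equivMapOfInjective _ (Submodule.subtype_injective _) _).finrank_eq
  have hcoker : Module.finrank F (U ⧸ LinearMap.range f) =
      Module.finrank F (W ⧸ LinearMap.range A) := by
    let g : U →ₗ[F] W ⧸ LinearMap.range A := (LinearMap.range A).mkQ ∘ₗ U.subtype
    have hg : Function.Surjective g := by
      intro q
      obtain ⟨w, rfl⟩ := Submodule.mkQ_surjective _ q
      obtain ⟨u, hu, a, ha, rfl⟩ := Submodule.mem_sup.1 (hU ▸ Submodule.mem_top (x := w))
      refine ⟨⟨u, hu⟩, ?_⟩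
      have : (LinearMap.range A).mkQ a = 0 := by simpa using ha
      rw [map_add, this, add_zero]
      rfl
    have hker : LinearMap.ker g = LinearMap.range f := by
      ext u
      simp only [g, LinearMap.mem_ker, LinearMap.comp_apply, Submodule.mkQ_apply,
        Submodule.Quotient.mk_eq_zero, LinearMap.mem_range, Submodule.subtype_apply]
      constructor
      · rintro ⟨v, hv⟩
        exact ⟨⟨v, by simp [hv]⟩, Subtype.ext hv⟩
      · rintro ⟨v, hv⟩
        exact ⟨v, congrArg Subtype.val hv⟩
    rw [← hker]
    exact (g.quotKerEquivOfSurjective hg).finrank_eq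
  have h := LinearMap.index_eq_of_finiteDimensional (f := f)
  rw [LinearMap.index_eq_finrank_sub, hker, hcoker] at h
  exact h

theorem exists_finiteDimensional_sup_eq_top (S : Submodule F W) [FiniteDimensional F (W ⧸ S)] :
    ∃ U : Submodule F W, FiniteDimensional F U ∧ U ⊔ S = ⊤ := by
  obtain ⟨U, hU⟩ := S.exists_isCompl
  exact ⟨U, (Submodule.quotientEquivOfIsCompl S U hU).finiteDimensional,
    sup_comm S U ▸ hU.sup_eq_top⟩

/-- The index is invariant under finite rank perturbations. -/
theorem opIndex_eq_of_hasFiniteRank_sub {A B : V →ₗ[F] W} [FiniteDimensional F (LinearMap.ker A)]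
    [FiniteDimensional F (LinearMap.ker B)] [FiniteDimensional F (W ⧸ LinearMap.range A)]
    [FiniteDimensional F (W ⧸ LinearMap.range B)] (h : HasFiniteRank (A - B)) :
    opIndex A = opIndex B := by
  unfold HasFiniteRank at h
  obtain ⟨U₁, _, hU₁⟩ := exists_finiteDimensional_sup_eq_top (LinearMap.range A)
  obtain ⟨U₂, _, hU₂⟩ := exists_finiteDimensional_sup_eq_top (LinearMap.range B)
  -- The summand Im(A - B) forces A⁻¹(U) = B⁻¹(U), so one pair of dimensions computes both indices.
  let U := U₁ ⊔ U₂ ⊔ LinearMap.range (A - B)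
  have hA : U ⊔ LinearMap.range A = ⊤ :=
    top_le_iff.1 (hU₁ ▸ sup_le_sup_right (le_sup_left.trans le_sup_left) _)
  have hB : U ⊔ LinearMap.range B = ⊤ :=
    top_le_iff.1 (hU₂ ▸ sup_le_sup_right (le_sup_right.trans le_sup_left) _)
  have hAB : U.comap A = U.comap B := by
    ext x
    have hx : A x - B x ∈ U := le_sup_right (a := U₁ ⊔ U₂) ⟨x, rfl⟩
    simp only [Submodule.mem_comap]
    exact ⟨fun h => by simpa using U.sub_mem h hx, fun h => by simpa using U.add_mem hx h⟩
  rw [opIndex_eq_finrank_comap_sub hA, opIndex_eq_finrank_comap_sub hB, hAB]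

end Index

/-! ### Kernel of a pseudo-inverse and cokernel of the operator -/

section KerCoker

variable {F V W : Type*} [Field F] [AddCommGroup V] [Module F V] [AddCommGroup W] [Module F W]
  {A : V →ₗ[F] W} {Ad : W →ₗ[F] V}

theorem kerProj_apply (h : IsPseudoInverse A Ad) (v : V) :
    (kerProj h v : V) = v - Ad (A v) := rfl

theorem kerProj_coe (h : IsPseudoInverse A Ad) (k : LinearMap.ker A) : kerProj h k = k := by
  ext
  rw [kerProj_apply, k.2, map_zero, sub_zero]

theorem kerProj_pseudoInverse (h : IsPseudoInverse A Ad) (w : W) : kerProj h (Ad w) = 0 := by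
  ext
  rw [kerProj_apply, h.right_apply, sub_self]
  rfl

theorem IsPseudoInverse.bijective_ker_coker (h : IsPseudoInverse A Ad) :
    Function.Bijective ((LinearMap.range A).mkQ ∘ₗ (LinearMap.ker Ad).subtype) := by
  constructor
  · rw [injective_iff_map_eq_zero]
    intro t ht
    obtain ⟨v, hv⟩ := (Submodule.Quotient.mk_eq_zero _).1 ht
    have ht' : Ad (t : W) = 0 := t.2
    ext
    change A v = (t : W) at hv
    rw [← hv, ← h.left_apply, hv, ht', map_zero]
    rfl
  · intro q
    obtain ⟨w, rfl⟩ := Submodule.mkQ_surjective _ q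
    refine ⟨kerProj h.symm w, (Submodule.Quotient.eq _).2 ?_⟩
    exact ⟨-Ad w, by simp [kerProj_apply]⟩

theorem mkQ_kerProj (h : IsPseudoInverse A Ad) (v : V) :
    (LinearMap.range Ad).mkQ (kerProj h v : V) = (LinearMap.range Ad).mkQ v := by
  refine (Submodule.Quotient.eq _).2 ⟨-A v, ?_⟩
  simp [kerProj_apply]

theorem AdaptedTo.symbol_kerProj {X Y : Type*} [AddCommGroup X] [Module F X] [AddCommGroup Y]
    [Module F Y] {T : V × X →ₗ[F] W × Y} (hT : AdaptedTo A Ad T) (h : IsPseudoInverse A Ad)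
    (v : V) (x : X) :
    symbol (LinearMap.ker A).subtype (LinearMap.range A).mkQ T (kerProj h v, x) =
      ((LinearMap.range A).mkQ (T (v, x)).1, (T (v, x)).2) := by
  have h1 := hT.apply_eq h (r := kerProj h) (i := (LinearMap.ker A).subtype) (fun _ => rfl) v x
  rw [symbol_apply, h1]
  simp

end KerCoker

/-! ### The two frames attached to a triple of index ≤ 0 -/

namespace NonposTriple

variable {F V W X Y : Type*} [Field F] [AddCommGroup V] [Module F V] [AddCommGroup W] [Module F W]
  [AddCommGroup X] [Module F X] [AddCommGroup Y] [Module F Y]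
  {A B : V →ₗ[F] W} {Ad Bd : W →ₗ[F] V}

/-- The projection of `Ker Bd` onto `Ker M` along `Ker N`. -/
noncomputable def proj (t : NonposTriple A Bd) : LinearMap.ker Bd →ₗ[F] LinearMap.ker t.M :=
  Submodule.projectionOnto _ _ t.N_compl

/-- `(v, x) ↦ (A + L P_A) v + N j x`. -/
noncomputable def frameMap (t : NonposTriple A Bd) (hA : IsPseudoInverse A Ad)
    (Y : Type*) [AddCommGroup Y] [Module F Y] (j : X ≃ₗ[F] LinearMap.ker t.M) :
    V × X →ₗ[F] W × Y :=
  LinearMap.inl F W Y ∘ₗ (A + t.L ∘ₗ kerProj hA).coprod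
    (t.N ∘ₗ (LinearMap.ker t.M).subtype ∘ₗ j.toLinearMap)

/-- `w ↦ ((Bd + M Q_B) w, j⁻¹ Q_B w)`, where `Ker Bd` is projected to `Ker M` along `Ker N`. -/
noncomputable def coframeMap (t : NonposTriple A Bd) (hB : IsPseudoInverse B Bd)
    (Y : Type*) [AddCommGroup Y] [Module F Y] (j : X ≃ₗ[F] LinearMap.ker t.M) :
    W × Y →ₗ[F] V × X :=
  (Bd + t.M ∘ₗ kerProj hB.symm).prod (j.symm.toLinearMap ∘ₗ t.proj ∘ₗ kerProj hB.symm) ∘ₗ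
    LinearMap.fst F W Y

variable (t : NonposTriple A Bd) (hA : IsPseudoInverse A Ad) (hB : IsPseudoInverse B Bd)
  (j : X ≃ₗ[F] LinearMap.ker t.M)

theorem proj_of_mem_ker_M (m : LinearMap.ker t.M) : t.proj m = m :=
  Submodule.projectionOnto_apply_left _ _

theorem proj_of_mem_ker_N (m : LinearMap.ker t.N) : t.proj m = 0 :=
  Submodule.projectionOnto_apply_right _ _

theorem sub_proj_mem (m : LinearMap.ker Bd) : m - t.proj m ∈ LinearMap.ker t.N :=
  Submodule.sub_projection_mem t.N_compl m

/-- The projection is along Ker N, so N does not notice it. This is what makes the composite of the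
two frames exactly Σ. -/
theorem N_proj (m : LinearMap.ker Bd) : t.N (t.proj m : LinearMap.ker Bd) = t.N m := by
  have h := t.sub_proj_mem m
  rw [LinearMap.mem_ker, map_sub, sub_eq_zero] at h
  exact h.symm

theorem frameMap_apply (v : V) (x : X) :
    t.frameMap hA Y j (v, x) = (A v + t.L (kerProj hA v) + t.N (j x), 0) := rfl

theorem coframeMap_apply (w : W) (y : Y) :
    t.coframeMap hB Y j (w, y) =
      (Bd w + t.M (kerProj hB.symm w), j.symm (t.proj (kerProj hB.symm w))) := rfl

theorem adaptedTo_frameMap : AdaptedTo A Ad (t.frameMap hA Y j) := by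
  intro w
  rw [frameMap_apply, kerProj_pseudoInverse]
  simp

theorem adaptedTo_coframeMap : AdaptedTo Bd B (t.coframeMap hB Y j) := by
  intro v
  rw [coframeMap_apply, kerProj_pseudoInverse]
  simp

/-- L embeds Ker A in Coker A, and N identifies Ker M with the quotient of Coker A by that image. -/
theorem bijective_coprod_coker : Function.Bijective
    (((LinearMap.range A).mkQ ∘ₗ t.L).coprod
      ((LinearMap.range A).mkQ ∘ₗ t.N ∘ₗ (LinearMap.ker t.M).subtype)) := by
  constructor
  · rw [injective_iff_map_eq_zero]
    rintro ⟨k, m⟩ h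
    have h' : (LinearMap.range A).mkQ (t.L k + t.N m) = 0 := by simpa using h
    obtain ⟨v, hv⟩ := (Submodule.Quotient.mk_eq_zero _).1 h'
    have hm : m = 0 := by
      refine (injective_iff_map_eq_zero _).1 t.N_bij.1 m ((Submodule.Quotient.mk_eq_zero _).2 ?_)
      refine Submodule.mem_sup.2 ⟨A v, ⟨v, rfl⟩, -t.L k, ⟨-k, map_neg _ _⟩, ?_⟩
      rw [hv]
      simp
    subst hm
    have hk : k = 0 := (injective_iff_map_eq_zero _).1 t.L_inj k (by simpa using h')
    rw [hk]
    rfl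
  · intro q
    obtain ⟨w, rfl⟩ := Submodule.mkQ_surjective _ q
    obtain ⟨m, hm⟩ := t.N_bij.2 (Submodule.mkQ _ w)
    obtain ⟨_, ⟨v, rfl⟩, _, ⟨k, rfl⟩, h⟩ := Submodule.mem_sup.1 ((Submodule.Quotient.eq _).1 hm)
    refine ⟨(-k, m), (Submodule.Quotient.eq _).2 ⟨v, ?_⟩⟩
    rw [eq_sub_of_add_eq h]
    simp
    abel

theorem bijective_symbol_frameMap [Subsingleton Y] : Function.Bijective
    (symbol (LinearMap.ker A).subtype (LinearMap.range A).mkQ (t.frameMap hA Y j)) := by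
  have h : symbol (LinearMap.ker A).subtype (LinearMap.range A).mkQ (t.frameMap hA Y j) =
      LinearMap.inl F _ Y ∘ₗ ((LinearMap.range A).mkQ ∘ₗ t.L).coprod
      ((LinearMap.range A).mkQ ∘ₗ t.N ∘ₗ (LinearMap.ker t.M).subtype) ∘ₗ
      LinearMap.prodMap LinearMap.id j.toLinearMap := by
    refine LinearMap.ext fun ⟨k, x⟩ => ?_
    have hk : A (k : V) = 0 := k.2
    simp [symbol_apply, frameMap_apply, kerProj_coe, hk]
  rw [h, LinearMap.coe_comp, LinearMap.coe_comp]
  refine Function.Bijective.comp ⟨LinearMap.inl_injective, ?_⟩ (t.bijective_coprod_coker.comp ?_)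
  · rintro ⟨q, y⟩
    exact ⟨q, Prod.ext rfl (Subsingleton.elim _ _)⟩
  · exact (LinearEquiv.prodCongr (LinearEquiv.refl F _) j).bijective

/-- The frame `(v, x) ↦ (A + L P_A) v + N j x`. -/
noncomputable def frame (Y : Type*) [AddCommGroup Y] [Module F Y] [Subsingleton Y] :
    (V × X) ≃ₗ[F] (W × Y) :=
  LinearEquiv.ofBijective (t.frameMap hA Y j)
    ((bijective_iff_symbol (isPresentation_subtype_mkQ A) hA (t.adaptedTo_frameMap hA j)).2
      (t.bijective_symbol_frameMap hA j))

variable [FiniteDimensional F (LinearMap.ker A)] [FiniteDimensional F (LinearMap.ker Bd)]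
  [FiniteDimensional F (W ⧸ LinearMap.range A)] [FiniteDimensional F (V ⧸ LinearMap.range Bd)]

theorem bijective_coker_prod
    (hd : Module.finrank F (LinearMap.ker A) + Module.finrank F (LinearMap.ker Bd) =
      Module.finrank F (W ⧸ LinearMap.range A) + Module.finrank F (V ⧸ LinearMap.range Bd)) :
    Function.Bijective (((LinearMap.range Bd).mkQ ∘ₗ t.M).prod t.proj) := by
  have hs : Function.Surjective (((LinearMap.range Bd).mkQ ∘ₗ t.M).prod t.proj) := by
    rintro ⟨q, m⟩
    obtain ⟨k, rfl⟩ := t.M_surj q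
    refine ⟨k - t.proj k + m, Prod.ext ?_ ?_⟩
    · have hm : t.M m = 0 := m.2
      simp [hm]
    · simp [proj_of_mem_ker_M]
  refine ⟨?_, hs⟩
  -- This gives dim Ker M = dim Coker A - dim Ker A; with the index equality `hd`, source and target
  -- have equal dimension, and surjectivity suffices.
  have h := (LinearEquiv.ofBijective _ t.bijective_coprod_coker).finrank_eq
  rw [Module.finrank_prod] at h
  refine (LinearMap.injective_iff_surjective_of_finrank_eq_finrank ?_).2 hs
  rw [Module.finrank_prod]
  omega

theorem bijective_coker_M
    (hd : Module.finrank F (LinearMap.ker A) + Module.finrank F (LinearMap.ker Bd) =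
      Module.finrank F (W ⧸ LinearMap.range A) + Module.finrank F (V ⧸ LinearMap.range Bd)) :
    Function.Bijective
      ((LinearMap.range Bd).mkQ ∘ₗ t.M ∘ₗ (LinearMap.ker t.N).subtype) := by
  have h := t.bijective_coker_prod hd
  constructor
  · rw [injective_iff_map_eq_zero]
    intro m hm
    refine Subtype.ext ((injective_iff_map_eq_zero _).1 h.1 (m : LinearMap.ker Bd)
      (Prod.ext hm (t.proj_of_mem_ker_N m)))
  · intro q
    obtain ⟨m, hm⟩ := h.2 (q, 0)
    have h1 : t.proj m = 0 := congrArg Prod.snd hm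
    have h2 := t.sub_proj_mem m
    rw [h1] at h2
    exact ⟨⟨m, by simpa using h2⟩, congrArg Prod.fst hm⟩

theorem bijective_symbol_coframeMap [Subsingleton Y]
    (hd : Module.finrank F (LinearMap.ker A) + Module.finrank F (LinearMap.ker Bd) =
      Module.finrank F (W ⧸ LinearMap.range A) + Module.finrank F (V ⧸ LinearMap.range Bd)) :
    Function.Bijective
      (symbol (LinearMap.ker Bd).subtype (LinearMap.range Bd).mkQ (t.coframeMap hB Y j)) := by
  have h : symbol (LinearMap.ker Bd).subtype (LinearMap.range Bd).mkQ (t.coframeMap hB Y j) =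
      LinearMap.prodMap LinearMap.id j.symm.toLinearMap ∘ₗ
      ((LinearMap.range Bd).mkQ ∘ₗ t.M).prod t.proj ∘ₗ LinearMap.fst F _ Y := by
    refine LinearMap.ext fun ⟨k, y⟩ => ?_
    have hk : Bd (k : W) = 0 := k.2
    simp [symbol_apply, coframeMap_apply, kerProj_coe, hk]
  rw [h, LinearMap.coe_comp, LinearMap.coe_comp]
  refine Function.Bijective.comp ?_ ((t.bijective_coker_prod hd).comp
    ⟨?_, LinearMap.fst_surjective⟩)
  · exact (LinearEquiv.prodCongr (LinearEquiv.refl F _) j.symm).bijective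
  · rintro ⟨k, y⟩ ⟨k', y'⟩ h
    exact Prod.ext h (Subsingleton.elim _ _)

/-- The frame `w ↦ ((Bd + M Q_B) w, j⁻¹ Q_B w)`. -/
noncomputable def coframe (Y : Type*) [AddCommGroup Y] [Module F Y] [Subsingleton Y]
    (hd : Module.finrank F (LinearMap.ker A) + Module.finrank F (LinearMap.ker Bd) =
      Module.finrank F (W ⧸ LinearMap.range A) + Module.finrank F (V ⧸ LinearMap.range Bd)) :
    (W × Y) ≃ₗ[F] (V × X) :=
  LinearEquiv.ofBijective (t.coframeMap hB Y j)
    ((bijective_iff_symbol (isPresentation_subtype_mkQ Bd) hB.symm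
      (t.adaptedTo_coframeMap hB j)).2 (t.bijective_symbol_coframeMap hB j hd))

end NonposTriple

section Frames

variable {F V W X Y : Type*} [Field F] [AddCommGroup V] [Module F V] [AddCommGroup W] [Module F W]
  [AddCommGroup X] [Module F X] [AddCommGroup Y] [Module F Y]
  {A B : V →ₗ[F] W} {Ad Bd : W →ₗ[F] V}

/-- B and B† are mutually inverse between Im B† and Im B, so inverting a frame of B† gives a frame
of B. -/
theorem AdaptedTo.symm {G : (W × Y) ≃ₗ[F] (V × X)} (hB : IsPseudoInverse B Bd)
    (h : AdaptedTo Bd B G.toLinearMap) : AdaptedTo B Bd G.symm.toLinearMap := by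
  intro w
  have h1 := h (Bd w)
  rw [hB.right_apply] at h1
  rw [LinearEquiv.coe_coe, LinearEquiv.symm_apply_eq]
  exact h1.symm

namespace NonposTriple

variable (t : NonposTriple A Bd) (hA : IsPseudoInverse A Ad) (hB : IsPseudoInverse B Bd)
  (j : X ≃ₗ[F] LinearMap.ker t.M)

theorem isFrame_frame [Subsingleton Y] : IsFrame A (t.frame hA j Y) :=
  ⟨Ad, hA, t.adaptedTo_frameMap hA j⟩

variable [FiniteDimensional F (LinearMap.ker A)] [FiniteDimensional F (LinearMap.ker Bd)]
  [FiniteDimensional F (W ⧸ LinearMap.range A)] [FiniteDimensional F (V ⧸ LinearMap.range Bd)]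
  (hd : Module.finrank F (LinearMap.ker A) + Module.finrank F (LinearMap.ker Bd) =
      Module.finrank F (W ⧸ LinearMap.range A) + Module.finrank F (V ⧸ LinearMap.range Bd))

theorem adaptedTo_coframe_symm [Subsingleton Y] :
    AdaptedTo B Bd (t.coframe hB j Y hd).symm.toLinearMap :=
  AdaptedTo.symm hB (t.adaptedTo_coframeMap hB j)

theorem coframe_symm_apply_M [Subsingleton Y] (m : LinearMap.ker t.N) :
    (t.coframe hB j Y hd).symm (t.M m, 0) = (((m : LinearMap.ker Bd) : W), 0) := by
  rw [LinearEquiv.symm_apply_eq]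
  have hm : Bd ((m : LinearMap.ker Bd) : W) = 0 := (m : LinearMap.ker Bd).2
  change _ = t.coframeMap hB Y j _
  rw [coframeMap_apply, hm, kerProj_coe, proj_of_mem_ker_N, map_zero, zero_add]

theorem coframe_symm_apply_zero [Subsingleton Y] (x : X) :
    (t.coframe hB j Y hd).symm (0, x) = (((j x : LinearMap.ker Bd) : W), 0) := by
  rw [LinearEquiv.symm_apply_eq]
  have hm : Bd ((j x : LinearMap.ker Bd) : W) = 0 := (j x : LinearMap.ker Bd).2
  have hm' : t.M (j x) = 0 := (j x).2
  change _ = t.coframeMap hB Y j _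
  rw [coframeMap_apply, hm, kerProj_coe, proj_of_mem_ker_M, hm', zero_add,
    LinearEquiv.symm_apply_apply]

theorem frame_coframe_apply [Subsingleton Y] (w : W) (y : Y) :
    t.frame hA j Y (t.coframe hB j Y hd (w, y)) = (t.sigma hA hB w, 0) := by
  change t.frameMap hA Y j (t.coframeMap hB Y j _) = _
  rw [coframeMap_apply, frameMap_apply, LinearEquiv.apply_symm_apply, N_proj]
  rfl

end NonposTriple

/-- Under Ker B ≅ Coker B†, the idempotent 1 - B†B becomes the quotient map. -/
theorem bijective_kerProj_comp_iff {U : Type*} [AddCommGroup U] [Module F U]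
    (hB : IsPseudoInverse B Bd) (f : U →ₗ[F] V)
    (h : Function.Bijective ((LinearMap.range Bd).mkQ ∘ₗ f)) :
    Function.Bijective (kerProj hB ∘ₗ f) := by
  have e : (LinearMap.range Bd).mkQ ∘ₗ f =
      ((LinearMap.range Bd).mkQ ∘ₗ (LinearMap.ker B).subtype) ∘ₗ (kerProj hB ∘ₗ f) := by
    ext u
    exact (mkQ_kerProj hB (f u)).symm
  rw [e, LinearMap.coe_comp] at h
  exact (Function.Bijective.of_comp_iff' hB.symm.bijective_ker_coker _).1 h

theorem bijective_coprod_of_isCompl {p q : Submodule F V} (h : IsCompl p q) :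
    Function.Bijective (p.subtype.coprod q.subtype) :=
  (Submodule.prodEquivOfIsCompl p q h).bijective

theorem bijective_comp_coprod_of_isCompl {p q : Submodule F V} (h : IsCompl p q) {f : V →ₗ[F] W}
    (hf : Function.Bijective f) :
    Function.Bijective ((f ∘ₗ p.subtype).coprod (f ∘ₗ q.subtype)) := by
  rw [← LinearMap.comp_coprod]
  exact hf.comp (bijective_coprod_of_isCompl h)

theorem finDet_conj_prod [Subsingleton Y] (S : W →ₗ[F] W)
    (h : HasFiniteRank (LinearMap.id - S)) (T : W × Y →ₗ[F] W × Y)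
    (hT : ∀ w y, T (w, y) = (S w, 0)) : finDet T = finDet S := by
  let e : W ≃ₗ[F] (W × Y) := LinearEquiv.ofBijective (LinearMap.inl F W Y)
    ⟨LinearMap.inl_injective, fun z => ⟨z.1, Prod.ext rfl (Subsingleton.elim _ _)⟩⟩
  rw [← finDet_conj e S h]
  congr 1
  refine LinearMap.ext fun z => ?_
  obtain ⟨w, rfl⟩ := e.surjective z
  simp only [LinearMap.comp_apply, LinearEquiv.coe_coe, LinearEquiv.symm_apply_apply]
  exact hT w 0

theorem hasFiniteRank_of_prod [Subsingleton Y] (S : W →ₗ[F] W) (T : W × Y →ₗ[F] W × Y)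
    (hT : ∀ w y, T (w, y) = (S w, 0)) (h : HasFiniteRank (LinearMap.id - T)) :
    HasFiniteRank (LinearMap.id - S) := by
  have e : LinearMap.id - S = LinearMap.fst F W Y ∘ₗ (LinearMap.id - T) ∘ₗ LinearMap.inl F W Y := by
    ext w; simp [hT]
  rw [e]
  exact (h.comp_right _).comp_left _

end Frames

/-! ### Volumes of frames given by explicit factors -/

section MapCongr

variable {F U V V' V'' W : Type*} [Field F] [AddCommGroup U] [Module F U] [AddCommGroup V]
  [Module F V] [AddCommGroup V'] [Module F V'] [AddCommGroup V''] [Module F V'']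
  [AddCommGroup W] [Module F W]

theorem map_map_congr {f : V →ₗ[F] W} {g : U →ₗ[F] V} {f' : V' →ₗ[F] W} {g' : U →ₗ[F] V'}
    (h : ∀ x, f (g x) = f' (g' x)) (x : ExteriorAlgebra F U) :
    ExteriorAlgebra.map f (ExteriorAlgebra.map g x) =
      ExteriorAlgebra.map f' (ExteriorAlgebra.map g' x) := by
  rw [map_map_apply, map_map_apply, LinearMap.ext (f := f ∘ₗ g) (g := f' ∘ₗ g') h]

theorem map_map_map_congr {f : V →ₗ[F] W} {g : V'' →ₗ[F] V} {k : U →ₗ[F] V''} {f' : V' →ₗ[F] W}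
    {g' : U →ₗ[F] V'} (h : ∀ x, f (g (k x)) = f' (g' x)) (x : ExteriorAlgebra F U) :
    ExteriorAlgebra.map f (ExteriorAlgebra.map g (ExteriorAlgebra.map k x)) =
      ExteriorAlgebra.map f' (ExteriorAlgebra.map g' x) := by
  rw [map_map_apply k]
  exact map_map_congr h x

end MapCongr

section VolumeFactors

variable {F K C X Y U U' : Type*} [Field F] [AddCommGroup K] [Module F K] [AddCommGroup C]
  [Module F C] [AddCommGroup X] [Module F X] [AddCommGroup Y] [Module F Y] [AddCommGroup U]
  [Module F U] [AddCommGroup U'] [Module F U'] {R : K × X →ₗ[F] C × Y} {εX : DetLine F X}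
  {εY : DetLine F Y} {s : DetLine F K} {c : DetLine F C} {cs : Module.Dual F (DetLine F C)}
  {x : ExteriorAlgebra F U} {y : ExteriorAlgebra F U'}

/-- The shape met when the index is ≤ 0: Y is trivial, and the class in the cokernel is a product in
the same order as s ∧ εX, so no sign appears. -/
theorem isVolume_of_coker_factors {f : U →ₗ[F] K} {g : U →ₗ[F] C} {p : U' →ₗ[F] X}
    {h : U' →ₗ[F] C} (hcs : cs c = 1) (hs : (s : ExteriorAlgebra F K) = ExteriorAlgebra.map f x)
    (hX : (εX : ExteriorAlgebra F X) = ExteriorAlgebra.map p y)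
    (hY : (εY : ExteriorAlgebra F Y) = 1)
    (hc : (c : ExteriorAlgebra F C) = ExteriorAlgebra.map g x * ExteriorAlgebra.map h y)
    (hf : ∀ u, R (f u, 0) = (g u, 0)) (hp : ∀ u, R (0, p u) = (h u, 0)) :
    IsVolume R εX εY (s ⊗ₜ cs) := by
  refine ⟨s, c, cs, hcs, rfl, ?_⟩
  rw [hs, hX, hY, hc, map_one, one_mul, map_mul, map_mul]
  exact congrArg₂ _ (map_map_map_congr hf x) (map_map_map_congr hp y)

/-- The shape met when the index is ≥ 0: X is trivial. The convention that εY precedes c matches the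
order s₀ ∧ s₁ and avoids a sign. -/
theorem isVolume_of_ker_factors {f : U →ₗ[F] K} {g : U' →ₗ[F] K} {p : U →ₗ[F] Y}
    {q : U' →ₗ[F] C} (hcs : cs c = 1)
    (hs : (s : ExteriorAlgebra F K) = ExteriorAlgebra.map f x * ExteriorAlgebra.map g y)
    (hX : (εX : ExteriorAlgebra F X) = 1)
    (hY : (εY : ExteriorAlgebra F Y) = ExteriorAlgebra.map p x)
    (hc : (c : ExteriorAlgebra F C) = ExteriorAlgebra.map q y)
    (hf : ∀ u, R (f u, 0) = (0, p u)) (hg : ∀ u, R (g u, 0) = (q u, 0)) :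
    IsVolume R εX εY (s ⊗ₜ cs) := by
  refine ⟨s, c, cs, hcs, rfl, ?_⟩
  rw [hs, hX, hY, hc, map_one, mul_one, map_mul, map_mul]
  exact congrArg₂ _ (map_map_map_congr hf x) (map_map_map_congr hg y)

end VolumeFactors

/-! ### The transport isomorphism satisfies the defining formulas -/

section Gives

variable {F V W X Y : Type*} [Field F] [AddCommGroup V] [Module F V] [AddCommGroup W] [Module F W]
  [AddCommGroup X] [Module F X] [AddCommGroup Y] [Module F Y]
  {A B : V →ₗ[F] W} {Ad Bd : W →ₗ[F] V}
  [FiniteDimensional F (LinearMap.ker A)] [FiniteDimensional F (LinearMap.ker B)]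
  [FiniteDimensional F (W ⧸ LinearMap.range A)] [FiniteDimensional F (W ⧸ LinearMap.range B)]
  [FiniteDimensional F X] [FiniteDimensional F Y]

theorem ker_coker_finrank (hB : IsPseudoInverse B Bd) :
    FiniteDimensional F (LinearMap.ker Bd) ∧ FiniteDimensional F (V ⧸ LinearMap.range Bd) ∧
    Module.finrank F (LinearMap.ker Bd) = Module.finrank F (W ⧸ LinearMap.range B) ∧
    Module.finrank F (V ⧸ LinearMap.range Bd) = Module.finrank F (LinearMap.ker B) := by
  let e₁ := LinearEquiv.ofBijective _ hB.bijective_ker_coker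
  let e₂ := LinearEquiv.ofBijective _ hB.symm.bijective_ker_coker
  exact ⟨e₁.symm.finiteDimensional, e₂.finiteDimensional, e₁.finrank_eq, e₂.finrank_eq.symm⟩

/-- A triple of index `≥ 0` from `A` to `B` is a triple of index `≤ 0` in the opposite direction. -/
def NonnegTriple.dual (t : NonnegTriple A Bd) : NonposTriple Bd A where
  L := t.M
  M := t.L
  N := t.N
  L_inj := t.M_inj
  M_surj := t.L_surj
  N_bij := by
    have h := t.N_bij
    rwa [sup_comm] at h
  N_compl := t.N_compl

theorem exists_detLine_eq_one (F Y : Type*) [Field F] [AddCommGroup Y] [Module F Y]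
    [Subsingleton Y] : ∃ ε : DetLine F Y, ε ≠ 0 ∧ (ε : ExteriorAlgebra F Y) = 1 :=
  ⟨⟨1, one_mem_detLine (Module.finrank_zero_of_subsingleton)⟩,
    fun h => one_ne_zero (congrArg Subtype.val h), rfl⟩

/-- Give X the volume corresponding to t₁. Then T₁ has the vector s ⊗ (Ls ∧ Nt₁)^* and T₂ has Mt₀ ⊗
(t₀ ∧ t₁)^*, while T₁T₂⁻¹ = Σ; transport between these is the formula. -/
theorem NonposTriple.gives_of_transports [Subsingleton Y] (t : NonposTriple A Bd)
    (hA : IsPseudoInverse A Ad) (hB : IsPseudoInverse B Bd) (hAB : HasFiniteRank (A - B))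
    (hd : Module.finrank F (LinearMap.ker A) + Module.finrank F X =
      Module.finrank F (W ⧸ LinearMap.range A))
    {P : OpDet A ≃ₗ[F] OpDet B}
    (hP : Transports X Y A B (LinearMap.ker A).subtype (LinearMap.range A).mkQ
      (LinearMap.ker B).subtype (LinearMap.range B).mkQ P) : t.Gives hA hB P := by
  obtain ⟨_, _, hk, hc⟩ := ker_coker_finrank hB
  have hi := opIndex_eq_of_hasFiniteRank_sub hAB
  unfold opIndex at hi
  have hd' : Module.finrank F (LinearMap.ker A) + Module.finrank F (LinearMap.ker Bd) =
      Module.finrank F (W ⧸ LinearMap.range A) + Module.finrank F (V ⧸ LinearMap.range Bd) := by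
    omega
  have hX : Module.finrank F X = Module.finrank F (LinearMap.ker t.M) := by
    have h := (LinearEquiv.ofBijective _ t.bijective_coprod_coker).finrank_eq
    rw [Module.finrank_prod] at h
    omega
  let j : X ≃ₗ[F] LinearMap.ker t.M := LinearEquiv.ofFinrankEq _ _ hX
  intro s t₁ t₀ hs ht₁ ht₀
  obtain ⟨c, hc0, hc⟩ := exists_detLine_eq_mul t.bijective_coprod_coker hs ht₁
  obtain ⟨k, hk0, hk⟩ := exists_detLine_eq_map
    (bijective_kerProj_comp_iff hB _ (t.bijective_coker_M hd')) ht₀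
  obtain ⟨e, he0, he⟩ := exists_detLine_eq_mul
    (bijective_comp_coprod_of_isCompl t.N_compl.symm hB.bijective_ker_coker) ht₀ ht₁
  obtain ⟨cs, hcs⟩ := exists_dual_eq_one hc0
  obtain ⟨es, hes⟩ := exists_dual_eq_one he0
  refine ⟨c, k, e, cs, es, hc, hk, he, hcs, hes, ?_⟩
  obtain ⟨εX, hεX, eX⟩ : ∃ εX : DetLine F X, εX ≠ 0 ∧ (εX : ExteriorAlgebra F X) =
      ExteriorAlgebra.map j.symm.toLinearMap t₁ :=
    ⟨detLineEquiv j.symm t₁, by simpa using ht₁, coe_detLineEquiv _ _⟩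
  obtain ⟨εY, hεY, eY⟩ := exists_detLine_eq_one F Y
  let T₁ := t.frame hA j Y
  let T₂ := (t.coframe hB j Y hd').symm
  have hT₁ : IsFrame A T₁ := t.isFrame_frame hA j
  have hT₂' := t.adaptedTo_coframe_symm (Y := Y) hB j hd'
  have hT₂ : IsFrame B T₂ := ⟨Bd, hB, hT₂'⟩
  have hv₁ : IsVolume (symbol (LinearMap.ker A).subtype (LinearMap.range A).mkQ T₁.toLinearMap)
      εX εY (s ⊗ₜ cs) := by
    refine isVolume_of_coker_factors hcs (f := LinearMap.id) (by simp) eX eY hc (fun x => ?_)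
      (fun x => ?_)
    · have hx : A (x : V) = 0 := x.2
      simp [symbol_apply, T₁, frame, frameMap_apply, kerProj_coe, hx]
    · simp [symbol_apply, T₁, frame, frameMap_apply]
  have hv₂ : IsVolume (symbol (LinearMap.ker B).subtype (LinearMap.range B).mkQ T₂.toLinearMap)
      εX εY (k ⊗ₜ es) := by
    refine isVolume_of_coker_factors hes hk eX eY he (fun x => ?_) (fun x => ?_)
    -- Mx need not lie in Ker B. The symbol of its projection to Ker B is the class of T₂(Mx, 0)
    -- modulo Im B.
    · have h1 := hT₂'.symbol_kerProj hB (t.M x) 0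
      rw [LinearEquiv.coe_coe, t.coframe_symm_apply_M hB j hd' x] at h1
      exact h1
    · have h1 := t.coframe_symm_apply_zero (Y := Y) hB j hd' (j.symm x)
      simp [symbol_apply, T₂, h1]
  rw [hP T₁ T₂ hT₁ hT₂ εX εY hεX hεY _ _ hv₁ hv₂]
  have f₁₂ := hT₁.hasFiniteRank_sub_of_sub hT₂ (isPresentation_subtype_mkQ A)
    (isPresentation_subtype_mkQ B) hAB
  have hsig : ∀ w y, (T₁.toLinearMap ∘ₗ T₂.symm.toLinearMap) (w, y) = (t.sigma hA hB w, 0) :=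
    t.frame_coframe_apply hA hB j hd'
  have hfin := hasFiniteRank_id_sub_comp_symm f₁₂.symm
  have h1 := finDet_mul_finDet_symm (T₂.symm.trans T₁) hfin
  have h2 : finDet (T₁.toLinearMap ∘ₗ T₂.symm.toLinearMap) = finDet (t.sigma hA hB) :=
    finDet_conj_prod _ (hasFiniteRank_of_prod _ _ hsig hfin) _ hsig
  have h3 : finDet (t.sigma hA hB) * finDet (T₂.toLinearMap ∘ₗ T₁.symm.toLinearMap) = 1 := by
    rw [← h2]
    exact h1
  rw [eq_inv_of_mul_eq_one_right h3]

/-- In the dual triple V and W trade places: its coframe is directly a frame of A, and the inverse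
of its frame is a frame of B. Hence Σ is now T₂⁻¹T₁, an operator on the source. -/
theorem NonnegTriple.exists_frames [Subsingleton X] (t : NonnegTriple A Bd)
    (hA : IsPseudoInverse A Ad) (hB : IsPseudoInverse B Bd) (j : Y ≃ₗ[F] LinearMap.ker t.L)
    [FiniteDimensional F (LinearMap.ker Bd)] [FiniteDimensional F (V ⧸ LinearMap.range Bd)]
    (hd : Module.finrank F (LinearMap.ker Bd) + Module.finrank F (LinearMap.ker A) =
      Module.finrank F (V ⧸ LinearMap.range Bd) + Module.finrank F (W ⧸ LinearMap.range A)) :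
    ∃ T₁ T₂ : (V × X) ≃ₗ[F] (W × Y), AdaptedTo A Ad T₁.toLinearMap ∧
      AdaptedTo B Bd T₂.toLinearMap ∧
      (∀ k : LinearMap.ker t.L, T₁ (((k : LinearMap.ker A) : V), 0) = (0, j.symm k)) ∧
      (∀ k : LinearMap.ker t.N, T₁ (((k : LinearMap.ker A) : V), 0) = (t.L k, 0)) ∧
      (∀ k : LinearMap.ker t.L, T₂ (t.N k, 0) = (0, j.symm k)) ∧
      (∀ m : LinearMap.ker Bd, T₂ (t.M m, 0) = ((m : W), 0)) ∧
      ∀ v x, T₂.symm (T₁ (v, x)) = (t.sigma hA hB v, 0) := by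
  let j' : Y ≃ₗ[F] LinearMap.ker t.dual.M := j
  let G := t.dual.frame hB.symm j' X
  let T₁ := t.dual.coframe hA.symm j' X hd
  have hG : ∀ w y, G (w, y) = (Bd w + t.M (kerProj hB.symm w) + t.N (j y), 0) := fun w y => rfl
  let p : LinearMap.ker A →ₗ[F] LinearMap.ker t.L := t.dual.proj
  have hT₁ : ∀ v x, T₁ (v, x) = (A v + t.L (kerProj hA v), j.symm (p (kerProj hA v))) :=
    fun v x => rfl
  refine ⟨T₁, G.symm, t.dual.adaptedTo_coframeMap hA.symm j',
    AdaptedTo.symm hB (t.dual.adaptedTo_frameMap hB.symm j'), fun k => ?_, fun k => ?_, fun k => ?_,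
    fun m => ?_, fun v x => ?_⟩
  · have hk : A ((k : LinearMap.ker A) : V) = 0 := (k : LinearMap.ker A).2
    have hk' : t.L k = 0 := k.2
    have hk'' : p k = k := t.dual.proj_of_mem_ker_M k
    rw [hT₁, kerProj_coe, hk, hk', zero_add, hk'']
  · have hk : A ((k : LinearMap.ker A) : V) = 0 := (k : LinearMap.ker A).2
    have hk' : p k = 0 := t.dual.proj_of_mem_ker_N k
    rw [hT₁, kerProj_coe, hk, zero_add, hk']
    exact Prod.ext rfl (map_zero j.symm)
  · rw [LinearEquiv.symm_apply_eq, hG]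
    simp
  · have hm : Bd (m : W) = 0 := m.2
    rw [LinearEquiv.symm_apply_eq, hG, hm, kerProj_coe]
    simp
  · rw [LinearEquiv.symm_symm, hT₁, hG, LinearEquiv.apply_symm_apply, add_assoc]
    have h : t.N (p (kerProj hA v) : LinearMap.ker A) = t.N (kerProj hA v) :=
      t.dual.N_proj _
    rw [h, ← add_assoc]
    rfl

theorem NonnegTriple.bijective_coprod (t : NonnegTriple A Bd) (hB : IsPseudoInverse B Bd) :
    Function.Bijective ((kerProj hB ∘ₗ t.N ∘ₗ (LinearMap.ker t.L).subtype).coprod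
      (kerProj hB ∘ₗ t.M)) := by
  rw [← LinearMap.comp_coprod]
  refine bijective_kerProj_comp_iff hB _ ?_
  have h := t.dual.bijective_coprod_coker.comp
    (LinearEquiv.prodComm F (LinearMap.ker t.L) (LinearMap.ker Bd)).bijective
  convert h using 1
  refine funext fun ⟨z₁, z₂⟩ => ?_
  exact congrArg (Submodule.mkQ _) (add_comm (t.N z₁) (t.M z₂))

theorem NonnegTriple.bijective_coker_L (t : NonnegTriple A Bd)
    [FiniteDimensional F (LinearMap.ker Bd)] [FiniteDimensional F (V ⧸ LinearMap.range Bd)]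
    (hd : Module.finrank F (LinearMap.ker Bd) + Module.finrank F (LinearMap.ker A) =
      Module.finrank F (V ⧸ LinearMap.range Bd) + Module.finrank F (W ⧸ LinearMap.range A)) :
    Function.Bijective ((LinearMap.range A).mkQ ∘ₗ t.L ∘ₗ (LinearMap.ker t.N).subtype) :=
  t.dual.bijective_coker_M hd

theorem NonnegTriple.gives_of_transports [Subsingleton X] (t : NonnegTriple A Bd)
    (hA : IsPseudoInverse A Ad) (hB : IsPseudoInverse B Bd) (hAB : HasFiniteRank (A - B))
    (hd : Module.finrank F (LinearMap.ker A) =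
      Module.finrank F (W ⧸ LinearMap.range A) + Module.finrank F Y)
    {P : OpDet A ≃ₗ[F] OpDet B}
    (hP : Transports X Y A B (LinearMap.ker A).subtype (LinearMap.range A).mkQ
      (LinearMap.ker B).subtype (LinearMap.range B).mkQ P) : t.Gives hA hB P := by
  obtain ⟨_, _, hk, hc⟩ := ker_coker_finrank hB
  have hi := opIndex_eq_of_hasFiniteRank_sub hAB
  unfold opIndex at hi
  have hd' : Module.finrank F (LinearMap.ker Bd) + Module.finrank F (LinearMap.ker A) =
      Module.finrank F (V ⧸ LinearMap.range Bd) + Module.finrank F (W ⧸ LinearMap.range A) := by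
    omega
  have hY : Module.finrank F Y = Module.finrank F (LinearMap.ker t.L) := by
    have h := (LinearEquiv.ofBijective _ (t.bijective_coprod hB)).finrank_eq
    rw [Module.finrank_prod] at h
    omega
  let j : Y ≃ₗ[F] LinearMap.ker t.L := LinearEquiv.ofFinrankEq _ _ hY
  intro s₀ s₁ u hs₀ hs₁ hu
  obtain ⟨a, ha0, ha⟩ := exists_detLine_eq_mul (bijective_coprod_of_isCompl t.N_compl) hs₀ hs₁
  obtain ⟨c, hc0, hc⟩ := exists_detLine_eq_map (t.bijective_coker_L hd') hs₁
  obtain ⟨k, hk0, hk⟩ := exists_detLine_eq_mul (t.bijective_coprod hB) hs₀ hu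
  obtain ⟨e, he0, he⟩ := exists_detLine_eq_map hB.bijective_ker_coker hu
  obtain ⟨cs, hcs⟩ := exists_dual_eq_one hc0
  obtain ⟨es, hes⟩ := exists_dual_eq_one he0
  refine ⟨a, c, k, e, cs, es, ha, hc, hk, he, hcs, hes, ?_⟩
  obtain ⟨εY, hεY, eY⟩ : ∃ εY : DetLine F Y, εY ≠ 0 ∧ (εY : ExteriorAlgebra F Y) =
      ExteriorAlgebra.map j.symm.toLinearMap s₀ :=
    ⟨detLineEquiv j.symm s₀, by simpa using hs₀, coe_detLineEquiv _ _⟩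
  obtain ⟨εX, hεX, eX⟩ := exists_detLine_eq_one F X
  obtain ⟨T₁, T₂, hT₁', hT₂', hL, hN, hT₂L, hT₂M, hsig'⟩ :=
    t.exists_frames (X := X) hA hB j hd'
  have hT₁ : IsFrame A T₁ := ⟨Ad, hA, hT₁'⟩
  have hT₂ : IsFrame B T₂ := ⟨Bd, hB, hT₂'⟩
  have hv₁ : IsVolume (symbol (LinearMap.ker A).subtype (LinearMap.range A).mkQ T₁.toLinearMap)
      εX εY (a ⊗ₜ cs) := by
    refine isVolume_of_ker_factors hcs ha eX eY hc (fun x => ?_) (fun x => ?_)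
    · simp [symbol_apply, hL]
    · simp [symbol_apply, hN]
  have hv₂ : IsVolume (symbol (LinearMap.ker B).subtype (LinearMap.range B).mkQ T₂.toLinearMap)
      εX εY (k ⊗ₜ es) := by
    refine isVolume_of_ker_factors hes hk eX eY he (fun x => ?_) (fun x => ?_)
    · have h1 := hT₂'.symbol_kerProj hB (t.N x) 0
      rw [LinearEquiv.coe_coe, hT₂L] at h1
      simpa using h1
    · have h1 := hT₂'.symbol_kerProj hB (t.M x) 0
      rw [LinearEquiv.coe_coe, hT₂M] at h1
      simpa using h1
  rw [hP T₁ T₂ hT₁ hT₂ εX εY hεX hεY _ _ hv₁ hv₂]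
  have f₁₂ := hT₁.hasFiniteRank_sub_of_sub hT₂ (isPresentation_subtype_mkQ A)
    (isPresentation_subtype_mkQ B) hAB
  have hsig : ∀ v x, (T₂.symm.toLinearMap ∘ₗ T₁.toLinearMap) (v, x) = (t.sigma hA hB v, 0) := hsig'
  have hfin := hasFiniteRank_id_sub_symm_comp f₁₂
  have h1 := finDet_mul_finDet_symm (T₁.trans T₂.symm) hfin
  have h2 : finDet (T₂.symm.toLinearMap ∘ₗ T₁.toLinearMap) = finDet (t.sigma hA hB) :=
    finDet_conj_prod _ (hasFiniteRank_of_prod _ _ hsig hfin) _ hsig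
  have h3 : finDet (t.sigma hA hB) * finDet (T₂.toLinearMap ∘ₗ T₁.symm.toLinearMap) = 1 := by
    rw [← h2, finDet_comp_symm f₁₂]
    exact h1
  rw [eq_inv_of_mul_eq_one_right h3]

end Gives

/-! ### Existence of perturbation triples -/

section Triples

variable {F V W : Type*} [Field F] [AddCommGroup V] [Module F V] [AddCommGroup W] [Module F W]
  {A B : V →ₗ[F] W} {Ad Bd : W →ₗ[F] V}

theorem exists_injective_of_finrank_le {V W : Type*} [AddCommGroup V] [Module F V]
    [AddCommGroup W] [Module F W] [FiniteDimensional F V] [FiniteDimensional F W]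
    (h : Module.finrank F V ≤ Module.finrank F W) : ∃ f : V →ₗ[F] W, Function.Injective f :=
  finrank_le_iff_exists_linearMap.1 h

theorem exists_surjective_of_finrank_le {V W : Type*} [AddCommGroup V] [Module F V]
    [AddCommGroup W] [Module F W] [FiniteDimensional F V] [FiniteDimensional F W]
    (h : Module.finrank F W ≤ Module.finrank F V) : ∃ f : V →ₗ[F] W, Function.Surjective f := by
  obtain ⟨g, hg⟩ := exists_injective_of_finrank_le h
  obtain ⟨f, hf⟩ := g.exists_leftInverse_of_injective (LinearMap.ker_eq_bot.2 hg)
  exact ⟨f, fun w => ⟨g w, LinearMap.congr_fun hf w⟩⟩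

theorem exists_section_mkQ (S : Submodule F W) : ∃ r : W ⧸ S →ₗ[F] W, ∀ q, S.mkQ (r q) = q := by
  obtain ⟨r, hr⟩ := S.mkQ.exists_rightInverse_of_surjective
    (LinearMap.range_eq_top.2 S.mkQ_surjective)
  exact ⟨r, LinearMap.congr_fun hr⟩

theorem NonposTriple.nonempty [FiniteDimensional F (LinearMap.ker A)]
    [FiniteDimensional F (LinearMap.ker Bd)] [FiniteDimensional F (W ⧸ LinearMap.range A)]
    [FiniteDimensional F (V ⧸ LinearMap.range Bd)]
    (hle : Module.finrank F (LinearMap.ker A) ≤ Module.finrank F (W ⧸ LinearMap.range A))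
    (hd : Module.finrank F (LinearMap.ker A) + Module.finrank F (LinearMap.ker Bd) =
      Module.finrank F (W ⧸ LinearMap.range A) + Module.finrank F (V ⧸ LinearMap.range Bd)) :
    Nonempty (NonposTriple A Bd) := by
  obtain ⟨f, hf⟩ := exists_injective_of_finrank_le hle
  obtain ⟨g, hg⟩ := exists_surjective_of_finrank_le (F := F) (V := LinearMap.ker Bd)
    (W := V ⧸ LinearMap.range Bd) (by omega)
  obtain ⟨r, hr⟩ := exists_section_mkQ (LinearMap.range A)
  obtain ⟨r', hr'⟩ := exists_section_mkQ (LinearMap.range Bd)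
  let L : LinearMap.ker A →ₗ[F] W := r ∘ₗ f
  let M : LinearMap.ker Bd →ₗ[F] V := r' ∘ₗ g
  have hL : (LinearMap.range A).mkQ ∘ₗ L = f := LinearMap.ext fun x => hr _
  have hM : (LinearMap.range Bd).mkQ ∘ₗ M = g := LinearMap.ext fun x => hr' _
  have hker : LinearMap.ker M = LinearMap.ker g := by
    refine le_antisymm ?_ fun x hx => ?_
    · rw [← hM]
      exact LinearMap.ker_le_ker_comp _ _
    · have hx' : g x = 0 := hx
      simp [M, hx']
  obtain ⟨r'', hr''⟩ := exists_section_mkQ (LinearMap.range A ⊔ LinearMap.range L)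
  -- Both sides are dim Coker A - dim Ker A: on the left by surjectivity of g and `hd`, on the right
  -- by injectivity of f.
  have hfin : Module.finrank F (LinearMap.ker M) =
      Module.finrank F (W ⧸ (LinearMap.range A ⊔ LinearMap.range L)) := by
    rw [hker, ← (Submodule.quotientQuotientEquivQuotientSup (LinearMap.range A)
      (LinearMap.range L)).finrank_eq, ← LinearMap.range_comp, hL]
    have h1 := (LinearMap.range f).finrank_quotient_add_finrank
    have h2 := g.finrank_range_add_finrank_ker
    rw [LinearMap.range_eq_top.2 hg, finrank_top] at h2
    rw [LinearMap.finrank_range_of_inj hf] at h1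
    omega
  have : FiniteDimensional F (W ⧸ (LinearMap.range A ⊔ LinearMap.range L)) :=
    (Submodule.quotientQuotientEquivQuotientSup (LinearMap.range A)
      (LinearMap.range L)).finiteDimensional
  let e := LinearEquiv.ofFinrankEq _ _ hfin
  obtain ⟨S, hS⟩ := (LinearMap.ker M).exists_isCompl
  let p := Submodule.projectionOnto _ _ hS
  refine ⟨⟨L, M, r'' ∘ₗ e.toLinearMap ∘ₗ p, hL ▸ hf, hM ▸ hg, ?_, ?_⟩⟩
  · convert e.bijective using 1
    refine funext fun x => (hr'' _).trans (congrArg e ?_)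
    exact Submodule.projectionOnto_apply_left hS x
  · convert hS
    refine le_antisymm (fun x hx => ?_) fun x hx => ?_
    · have h1 : r'' (e (p x)) = 0 := hx
      have h2 := hr'' (e (p x))
      rw [h1, map_zero] at h2
      have h3 : p x = 0 := e.injective (h2.symm.trans (map_zero e).symm)
      have h4 : x ∈ LinearMap.ker p := h3
      rwa [Submodule.ker_projectionOnto] at h4
    · have h3 : p x = 0 := Submodule.projectionOnto_apply_right hS ⟨x, hx⟩
      simp [h3]

/-- The triple of index `≥ 0` that is dual to a triple of index `≤ 0` in the opposite direction. -/
def NonposTriple.dual (t : NonposTriple Bd A) : NonnegTriple A Bd where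
  L := t.M
  M := t.L
  N := t.N
  L_surj := t.M_surj
  M_inj := t.L_inj
  N_bij := by
    have h := t.N_bij
    rwa [sup_comm] at h
  N_compl := t.N_compl

end Triples

/-! ### The defining formula for operators is equivalent to transport -/

section Uniqueness

variable {F V W X Y : Type*} [Field F] [AddCommGroup V] [Module F V] [AddCommGroup W] [Module F W]
  [AddCommGroup X] [Module F X] [AddCommGroup Y] [Module F Y]
  {A B : V →ₗ[F] W} {Ad Bd : W →ₗ[F] V}

theorem tmul_dual_ne_zero {K C : Type*} [AddCommGroup K] [Module F K] [AddCommGroup C] [Module F C]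
    [FiniteDimensional F K] {s : DetLine F K} {c : DetLine F C}
    {cs : Module.Dual F (DetLine F C)} (hs : s ≠ 0) (hc : cs c = 1) : s ⊗ₜ[F] cs ≠ 0 := by
  obtain ⟨f, hf⟩ := exists_dual_eq_one hs
  intro h0
  have h1 := congrArg ((TensorProduct.lid F F).toLinearMap ∘ₗ
    TensorProduct.map f (LinearMap.applyₗ (R := F) c)) h0
  simp [hf, hc] at h1

variable [FiniteDimensional F (LinearMap.ker A)] [FiniteDimensional F (LinearMap.ker B)]
  [FiniteDimensional F (W ⧸ LinearMap.range A)] [FiniteDimensional F (W ⧸ LinearMap.range B)]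

theorem ne_zero_of_dual_apply {C : Type*} [AddCommGroup C] [Module F C] {c : DetLine F C}
    {cs : Module.Dual F (DetLine F C)} (hc : cs c = 1) : c ≠ 0 := by
  rintro rfl
  simp at hc

/-- The formula prescribes the value on one non-zero vector of a line; the auxiliary c, k, e and the
dual vectors are forced. -/
theorem NonposTriple.Gives.unique {t : NonposTriple A Bd} {hA : IsPseudoInverse A Ad}
    {hB : IsPseudoInverse B Bd} {P Q : OpDet A ≃ₗ[F] OpDet B} (hP : t.Gives hA hB P)
    (hQ : t.Gives hA hB Q) : P = Q := by
  obtain ⟨_, _, -, -⟩ := ker_coker_finrank hB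
  obtain ⟨s, hs⟩ := exists_detLine_ne_zero F (LinearMap.ker A)
  obtain ⟨t₁, ht₁⟩ := exists_detLine_ne_zero F (LinearMap.ker t.M)
  obtain ⟨t₀, ht₀⟩ := exists_detLine_ne_zero F (LinearMap.ker t.N)
  obtain ⟨c, k, e, cs, es, hc, hk, he, hcs, hes, h⟩ := hP s t₁ t₀ hs ht₁ ht₀
  obtain ⟨c', k', e', cs', es', hc', hk', he', hcs', hes', h'⟩ := hQ s t₁ t₀ hs ht₁ ht₀
  obtain rfl : c = c' := Subtype.ext (hc.trans hc'.symm)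
  obtain rfl : k = k' := Subtype.ext (hk.trans hk'.symm)
  obtain rfl : e = e' := Subtype.ext (he.trans he'.symm)
  obtain rfl : cs = cs' := dual_ext (ne_zero_of_dual_apply hcs) (hcs.trans hcs'.symm)
  obtain rfl : es = es' := dual_ext (ne_zero_of_dual_apply hes) (hes.trans hes'.symm)
  exact equiv_ext_of_apply_eq (finrank_detLine_tensor_dual (F := F) (K := LinearMap.ker A)
    (C := W ⧸ LinearMap.range A)) (tmul_dual_ne_zero hs hcs) (h.trans h'.symm)

theorem NonnegTriple.Gives.unique {t : NonnegTriple A Bd} {hA : IsPseudoInverse A Ad}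
    {hB : IsPseudoInverse B Bd} {P Q : OpDet A ≃ₗ[F] OpDet B} (hP : t.Gives hA hB P)
    (hQ : t.Gives hA hB Q) : P = Q := by
  obtain ⟨_, _, -, -⟩ := ker_coker_finrank hB
  obtain ⟨s₀, hs₀⟩ := exists_detLine_ne_zero F (LinearMap.ker t.L)
  obtain ⟨s₁, hs₁⟩ := exists_detLine_ne_zero F (LinearMap.ker t.N)
  obtain ⟨u, hu⟩ := exists_detLine_ne_zero F (LinearMap.ker Bd)
  obtain ⟨a, c, k, e, cs, es, ha, hc, hk, he, hcs, hes, h⟩ := hP s₀ s₁ u hs₀ hs₁ hu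
  obtain ⟨a', c', k', e', cs', es', ha', hc', hk', he', hcs', hes', h'⟩ := hQ s₀ s₁ u hs₀ hs₁ hu
  obtain rfl : a = a' := Subtype.ext (ha.trans ha'.symm)
  obtain rfl : c = c' := Subtype.ext (hc.trans hc'.symm)
  obtain rfl : k = k' := Subtype.ext (hk.trans hk'.symm)
  obtain rfl : e = e' := Subtype.ext (he.trans he'.symm)
  obtain rfl : cs = cs' := dual_ext (ne_zero_of_dual_apply hcs) (hcs.trans hcs'.symm)
  obtain rfl : es = es' := dual_ext (ne_zero_of_dual_apply hes) (hes.trans hes'.symm)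
  obtain ⟨a', ha0, ha'⟩ := exists_detLine_eq_mul (bijective_coprod_of_isCompl t.N_compl) hs₀ hs₁
  obtain rfl : a = a' := Subtype.ext (ha.trans ha'.symm)
  exact equiv_ext_of_apply_eq (finrank_detLine_tensor_dual (F := F) (K := LinearMap.ker A)
    (C := W ⧸ LinearMap.range A)) (tmul_dual_ne_zero ha0 hcs) (h.trans h'.symm)

/-- A transporting isomorphism satisfies the formula of every triple of the right sign, and each
formula has at most one solution. Taking p or q to be zero makes one stabilising space trivial; in
index 0 both are, so the two kinds of triples give the same isomorphism. -/
theorem isOpPerturbationIso_iff_transports {p q : ℕ} (hpq : p = 0 ∨ q = 0)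
    (hd : Module.finrank F (LinearMap.ker A) + p = Module.finrank F (W ⧸ LinearMap.range A) + q)
    (hAB : HasFiniteRank (A - B)) {P : OpDet A ≃ₗ[F] OpDet B} :
    IsOpPerturbationIso A B P ↔
      Transports (Fin p → F) (Fin q → F) A B (LinearMap.ker A).subtype (LinearMap.range A).mkQ
        (LinearMap.ker B).subtype (LinearMap.range B).mkQ P := by
  have hi := opIndex_eq_of_hasFiniteRank_sub hAB
  have hd₁ : Module.finrank F (LinearMap.ker A) + Module.finrank F (Fin p → F) =
      Module.finrank F (W ⧸ LinearMap.range A) + Module.finrank F (Fin q → F) := by simpa using hd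
  have hd₂ : Module.finrank F (LinearMap.ker B) + Module.finrank F (Fin p → F) =
      Module.finrank F (W ⧸ LinearMap.range B) + Module.finrank F (Fin q → F) := by
    unfold opIndex at hi
    omega
  have hiA : opIndex A = (q : ℤ) - p := by
    unfold opIndex
    omega
  have hgen : ∀ {P₀ : OpDet A ≃ₗ[F] OpDet B}, Transports (Fin p → F) (Fin q → F) A B
      (LinearMap.ker A).subtype (LinearMap.range A).mkQ
      (LinearMap.ker B).subtype (LinearMap.range B).mkQ P₀ →
      ∀ {Ad Bd : W →ₗ[F] V} (hA : IsPseudoInverse A Ad) (hB : IsPseudoInverse B Bd),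
      (opIndex A ≤ 0 → ∀ t : NonposTriple A Bd, t.Gives hA hB P₀) ∧
      (0 ≤ opIndex A → ∀ t : NonnegTriple A Bd, t.Gives hA hB P₀) := by
    intro P₀ hP₀ Ad Bd hA hB
    refine ⟨fun h t => ?_, fun h t => ?_⟩
    · obtain rfl : q = 0 := by omega
      exact t.gives_of_transports hA hB hAB (by simpa using hd₁) hP₀
    · obtain rfl : p = 0 := by omega
      exact t.gives_of_transports hA hB hAB (by simpa using hd₁) hP₀
  constructor
  · rintro ⟨Ad, Bd, hA, hB, h⟩
    obtain ⟨P₀, hP₀⟩ := exists_transports (isPresentation_subtype_mkQ A)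
      (isPresentation_subtype_mkQ B) hAB hd₁ hd₂
    obtain ⟨h₁, h₂⟩ := hgen hP₀ hA hB
    rcases h with ⟨hle, t, ht⟩ | ⟨hle, t, ht⟩
    · rwa [ht.unique (h₁ hle t)]
    · rwa [ht.unique (h₂ hle t)]
  · intro hP
    obtain ⟨Ad, hA⟩ := exists_isPseudoInverse A
    obtain ⟨Bd, hB⟩ := exists_isPseudoInverse B
    obtain ⟨h₁, h₂⟩ := hgen hP hA hB
    obtain ⟨_, _, hk, hc⟩ := ker_coker_finrank hB
    unfold opIndex at hi
    refine ⟨Ad, Bd, hA, hB, ?_⟩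
    rcases le_total (opIndex A) 0 with hle | hle
    · obtain ⟨t⟩ := NonposTriple.nonempty (A := A) (Bd := Bd) (by unfold opIndex at hle; omega)
        (by omega)
      exact Or.inl ⟨hle, t, h₁ hle t⟩
    · obtain ⟨t⟩ := NonposTriple.nonempty (A := Bd) (Bd := A)
        (by unfold opIndex at hle; omega) (by omega)
      exact Or.inr ⟨hle, t.dual, h₂ hle t.dual⟩

end Uniqueness

/-! ### Change of the models of kernel and cokernel -/

section ChangeOfPresentation

variable {F V W X Y K C K' C' K₁ C₁ K₂ C₂ K₁' C₁' K₂' C₂' : Type*} [Field F] [AddCommGroup V]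
  [Module F V] [AddCommGroup W] [Module F W] [AddCommGroup X] [Module F X] [AddCommGroup Y]
  [Module F Y] [AddCommGroup K] [Module F K] [AddCommGroup C] [Module F C]
  [AddCommGroup K'] [Module F K'] [AddCommGroup C'] [Module F C']
  [AddCommGroup K₁] [Module F K₁] [AddCommGroup C₁] [Module F C₁]
  [AddCommGroup K₂] [Module F K₂] [AddCommGroup C₂] [Module F C₂]
  [AddCommGroup K₁'] [Module F K₁'] [AddCommGroup C₁'] [Module F C₁']
  [AddCommGroup K₂'] [Module F K₂'] [AddCommGroup C₂'] [Module F C₂']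
  {A B : V →ₗ[F] W}

theorem IsPresentation.comp_equiv {i : K →ₗ[F] V} {π : W →ₗ[F] C} (h : IsPresentation A i π)
    (κ : K' ≃ₗ[F] K) (γ : C ≃ₗ[F] C') :
    IsPresentation A (i ∘ₗ κ.toLinearMap) (γ.toLinearMap ∘ₗ π) := by
  refine ⟨h.injective.comp κ.injective, ?_, γ.surjective.comp h.surjective, ?_⟩
  · rw [LinearMap.range_comp, LinearEquiv.range, Submodule.map_top, h.range_eq]
  · rw [LinearMap.ker_comp, LinearEquiv.ker, ← LinearMap.ker, h.ker_eq]

/-- The isomorphism of determinant lines induced by `κ : K ≃ K'` and `γ : C' ≃ C`. -/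
noncomputable abbrev detCongr (κ : K ≃ₗ[F] K') (γ : C' ≃ₗ[F] C) :
    (DetLine F K ⊗[F] Module.Dual F (DetLine F C)) ≃ₗ[F]
      (DetLine F K' ⊗[F] Module.Dual F (DetLine F C')) :=
  TensorProduct.congr (detLineEquiv κ) (detLineEquiv γ).dualMap

theorem IsVolume.detCongr {R : K × X →ₗ[F] C × Y} {R' : K' × X →ₗ[F] C' × Y}
    {εX : DetLine F X} {εY : DetLine F Y} {v : DetLine F K ⊗[F] Module.Dual F (DetLine F C)}
    (hv : IsVolume R εX εY v) (κ : K ≃ₗ[F] K') (γ : C' ≃ₗ[F] C)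
    (h : ∀ k x, R' (κ k, x) = (γ.symm (R (k, x)).1, (R (k, x)).2)) :
    IsVolume R' εX εY (detCongr κ γ v) := by
  obtain ⟨s, c, cs, hc, rfl, hR⟩ := hv
  refine ⟨detLineEquiv κ s, (detLineEquiv γ).symm c, (detLineEquiv γ).dualMap cs, ?_, rfl, ?_⟩
  · rw [LinearEquiv.dualMap_apply, LinearEquiv.apply_symm_apply, hc]
  · have hc' : (((detLineEquiv γ).symm c : DetLine F C') : ExteriorAlgebra F C') =
        ExteriorAlgebra.map γ.symm.toLinearMap (c : ExteriorAlgebra F C) := by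
      obtain ⟨c, rfl⟩ := (detLineEquiv γ).surjective c
      rw [LinearEquiv.symm_apply_apply, coe_detLineEquiv, map_map_apply, LinearEquiv.symm_comp,
        ExteriorAlgebra.map_id]
      rfl
    have e₁ : R' ∘ₗ κ.toLinearMap.prodMap LinearMap.id =
        γ.symm.toLinearMap.prodMap LinearMap.id ∘ₗ R :=
      LinearMap.ext fun z => h z.1 z.2
    have e₂ : (κ.toLinearMap.prodMap LinearMap.id) ∘ₗ LinearMap.inr F K X =
        LinearMap.inr F K' X := by
      ext x <;> simp
    have e₃ : (γ.symm.toLinearMap.prodMap LinearMap.id) ∘ₗ LinearMap.inr F C Y =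
        LinearMap.inr F C' Y := by
      ext x <;> simp
    have e₄ : ExteriorAlgebra.map (LinearMap.inl F K' X) (ExteriorAlgebra.map κ.toLinearMap s) *
          ExteriorAlgebra.map (LinearMap.inr F K' X) (εX : ExteriorAlgebra F X) =
        ExteriorAlgebra.map (κ.toLinearMap.prodMap LinearMap.id)
          (ExteriorAlgebra.map (LinearMap.inl F K X) (s : ExteriorAlgebra F K) *
          ExteriorAlgebra.map (LinearMap.inr F K X) (εX : ExteriorAlgebra F X)) := by
      rw [map_mul, map_map_apply (LinearMap.inr F K X), e₂]
      exact congrArg (· * _) (map_map_congr (fun x => by simp) _)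
    rw [hc', coe_detLineEquiv, e₄, map_map_apply, e₁, ← map_map_apply, hR, map_mul,
      map_map_apply (LinearMap.inr F C Y), e₃]
    exact congrArg (_ * ·) (map_map_congr (fun x => by simp) _)

theorem Transports.detCongr {i₁ : K₁ →ₗ[F] V} {π₁ : W →ₗ[F] C₁} {i₂ : K₂ →ₗ[F] V}
    {π₂ : W →ₗ[F] C₂} (κ₁ : K₁ ≃ₗ[F] K₁') (γ₁ : C₁' ≃ₗ[F] C₁) (κ₂ : K₂ ≃ₗ[F] K₂')
    (γ₂ : C₂' ≃ₗ[F] C₂) {Q}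
    (hQ : Transports X Y A B (i₁ ∘ₗ κ₁.symm.toLinearMap) (γ₁.symm.toLinearMap ∘ₗ π₁)
      (i₂ ∘ₗ κ₂.symm.toLinearMap) (γ₂.symm.toLinearMap ∘ₗ π₂) Q) :
    Transports X Y A B i₁ π₁ i₂ π₂
      (((FredholmPerturbation.detCongr κ₁ γ₁).trans Q).trans
        (FredholmPerturbation.detCongr κ₂ γ₂).symm) := by
  intro T₁ T₂ hT₁ hT₂ εX εY hX hY v₁ v₂ hv₁ hv₂
  have h := hQ T₁ T₂ hT₁ hT₂ εX εY hX hY _ _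
    (hv₁.detCongr κ₁ γ₁ fun k x => by simp [symbol_apply])
    (hv₂.detCongr κ₂ γ₂ fun k x => by simp [symbol_apply])
  rw [LinearEquiv.trans_apply, LinearEquiv.trans_apply, h, map_smul, LinearEquiv.symm_apply_apply]

end ChangeOfPresentation

/-! ### Conjugation by unipotent isomorphisms -/

section Conjugation

variable {F V W X Y K₁ C₁ K₂ C₂ : Type*} [Field F] [AddCommGroup V]
  [Module F V] [AddCommGroup W] [Module F W] [AddCommGroup X] [Module F X] [AddCommGroup Y]
  [Module F Y] [AddCommGroup K₁] [Module F K₁] [AddCommGroup C₁] [Module F C₁]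
  [AddCommGroup K₂] [Module F K₂] [AddCommGroup C₂] [Module F C₂]
  {A B A' B' : V →ₗ[F] W}

/-- Conjugation of a stabilized isomorphism. -/
noncomputable def conjProd (gV : V ≃ₗ[F] V) (gW : W ≃ₗ[F] W) (T : (V × X) ≃ₗ[F] (W × Y)) :
    (V × X) ≃ₗ[F] (W × Y) :=
  ((gV.prodCongr (LinearEquiv.refl F X)).symm.trans T).trans (gW.prodCongr (LinearEquiv.refl F Y))

theorem conjProd_apply (gV : V ≃ₗ[F] V) (gW : W ≃ₗ[F] W) (T : (V × X) ≃ₗ[F] (W × Y)) (v : V)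
    (x : X) : conjProd gV gW T (gV v, x) = (gW (T (v, x)).1, (T (v, x)).2) := by
  simp [conjProd]

theorem IsFrame.conjProd {gV : V ≃ₗ[F] V} {gW : W ≃ₗ[F] W} (h : ∀ v, A' (gV v) = gW (A v))
    {T : (V × X) ≃ₗ[F] (W × Y)} (hT : IsFrame A T) :
    IsFrame A' (conjProd gV gW T) := by
  obtain ⟨Ad, hA, hT⟩ := hT
  have h' : ∀ w, T (Ad w, 0) = (A (Ad w), 0) := hT
  -- The pseudo-inverse is conjugated along with the operator.
  refine ⟨gV.toLinearMap ∘ₗ Ad ∘ₗ gW.symm.toLinearMap, ⟨?_, ?_⟩, fun w => ?_⟩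
  · ext v
    obtain ⟨v, rfl⟩ := gV.surjective v
    simp [h, hA.left_apply]
  · ext w
    simp [h, hA.right_apply]
  · simp only [LinearMap.comp_apply, LinearEquiv.coe_coe, h, conjProd_apply, h']

theorem symbol_conjProd {gV : V ≃ₗ[F] V} {gW : W ≃ₗ[F] W} {i i' : K₁ →ₗ[F] V} {π π' : W →ₗ[F] C₁}
    (hi : ∀ k, i' k = gV (i k)) (hπ : ∀ w, π' (gW w) = π w) (T : (V × X) ≃ₗ[F] (W × Y)) :
    symbol i' π' (conjProd gV gW T).toLinearMap = symbol i π T.toLinearMap := by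
  refine LinearMap.ext fun ⟨k, x⟩ => ?_
  simp [symbol_apply, hi, conjProd_apply, hπ]

theorem finDet_prodCongr_of_unipotent {g h : V ≃ₗ[F] V} {k : ℕ}
    (hg : (g.toLinearMap - LinearMap.id : Module.End F V) ^ (k + 1) = 0)
    (hh : (h.toLinearMap - LinearMap.id : Module.End F V) ^ (k + 1) = 0)
    (hgh : HasFiniteRank (h.toLinearMap - g.toLinearMap)) :
    HasFiniteRank ((h.prodCongr (LinearEquiv.refl F X)).toLinearMap -
      (g.prodCongr (LinearEquiv.refl F X)).toLinearMap) ∧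
    finDet ((g.prodCongr (LinearEquiv.refl F X)).symm.toLinearMap ∘ₗ
      (h.prodCongr (LinearEquiv.refl F X)).toLinearMap) = 1 := by
  have key : ∀ {f : V ≃ₗ[F] V}, (f.toLinearMap - LinearMap.id : Module.End F V) ^ (k + 1) = 0 →
      ((f.prodCongr (LinearEquiv.refl F X)).toLinearMap - LinearMap.id :
        Module.End F (V × X)) ^ (k + 1) = 0 := by
    intro f hf
    have e : ∀ m : ℕ, ((f.prodCongr (LinearEquiv.refl F X)).toLinearMap - LinearMap.id :
        Module.End F (V × X)) ^ (m + 1) = LinearMap.prodMap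
          ((f.toLinearMap - LinearMap.id : Module.End F V) ^ (m + 1)) 0 := by
      intro m
      induction m with
      | zero => refine LinearMap.ext fun z => ?_; ext <;> simp
      | succ m ih =>
        rw [pow_succ, ih, pow_succ _ (m + 1)]
        refine LinearMap.ext fun z => ?_
        simp [Module.End.mul_apply]
    rw [e, hf]
    rfl
  have hfin : HasFiniteRank ((h.prodCongr (LinearEquiv.refl F X)).toLinearMap -
      (g.prodCongr (LinearEquiv.refl F X)).toLinearMap) := by
    have e : (h.prodCongr (LinearEquiv.refl F X)).toLinearMap -
        (g.prodCongr (LinearEquiv.refl F X)).toLinearMap =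
        LinearMap.inl F V X ∘ₗ (h.toLinearMap - g.toLinearMap) ∘ₗ LinearMap.fst F V X := by
      refine LinearMap.ext fun z => ?_
      simp
    rw [e]
    exact (hgh.comp_right _).comp_left _
  exact ⟨hfin, finDet_symm_comp_of_unipotent _ _ (key hg) (key hh) hfin⟩

theorem finDet_conjProd {gV hV : V ≃ₗ[F] V} {gW hW : W ≃ₗ[F] W} {k : ℕ}
    (hgV : (gV.toLinearMap - LinearMap.id : Module.End F V) ^ (k + 1) = 0)
    (hhV : (hV.toLinearMap - LinearMap.id : Module.End F V) ^ (k + 1) = 0)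
    (hgW : (gW.toLinearMap - LinearMap.id : Module.End F W) ^ (k + 1) = 0)
    (hhW : (hW.toLinearMap - LinearMap.id : Module.End F W) ^ (k + 1) = 0)
    (hV' : HasFiniteRank (hV.toLinearMap - gV.toLinearMap))
    (hW' : HasFiniteRank (hW.toLinearMap - gW.toLinearMap))
    {T₁ T₂ : (V × X) ≃ₗ[F] (W × Y)} (hT : HasFiniteRank (T₁.toLinearMap - T₂.toLinearMap)) :
    finDet ((conjProd hV hW T₂).toLinearMap ∘ₗ (conjProd gV gW T₁).symm.toLinearMap) =
      finDet (T₂.toLinearMap ∘ₗ T₁.symm.toLinearMap) := by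
  obtain ⟨fV, dV⟩ := finDet_prodCongr_of_unipotent (X := X) hhV hgV hV'.symm
  obtain ⟨fW, dW⟩ := finDet_prodCongr_of_unipotent (X := Y) hgW hhW hW'
  set GV := gV.prodCongr (LinearEquiv.refl F X)
  set HV := hV.prodCongr (LinearEquiv.refl F X)
  set GW := gW.prodCongr (LinearEquiv.refl F Y)
  set HW := hW.prodCongr (LinearEquiv.refl F Y)
  -- Neither gW nor hV need be a finite rank perturbation of 1. The product is regrouped so that
  -- only GW⁻¹HW and HV⁻¹GV, which are, get a determinant of their own; both have determinant 1.
  have e : (conjProd hV hW T₂).toLinearMap ∘ₗ (conjProd gV gW T₁).symm.toLinearMap =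
      GW.toLinearMap ∘ₗ ((GW.symm.toLinearMap ∘ₗ HW.toLinearMap) ∘ₗ
        ((T₂.toLinearMap ∘ₗ (HV.symm.toLinearMap ∘ₗ GV.toLinearMap) ∘ₗ T₂.symm.toLinearMap) ∘ₗ
          (T₂.toLinearMap ∘ₗ T₁.symm.toLinearMap))) ∘ₗ GW.symm.toLinearMap := by
    refine LinearMap.ext fun z => ?_
    simp [conjProd, GV, HV, GW, HW]
  have f₁ := hasFiniteRank_id_sub_symm_comp fW
  have f₂ := hasFiniteRank_id_sub_symm_comp fV
  have f₂' := hasFiniteRank_conj T₂ f₂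
  have f₃ := hasFiniteRank_id_sub_comp_symm hT
  have f₂₃ := hasFiniteRank_id_sub_comp f₂' f₃
  rw [e, finDet_conj GW _ (hasFiniteRank_id_sub_comp f₁ f₂₃), finDet_comp f₁ f₂₃,
    finDet_comp f₂' f₃, finDet_conj T₂ _ f₂, dV, dW, one_mul, one_mul]

/-- Conjugated frames have the same symbols, hence the same vectors, and the same relative
determinant by `finDet_conjProd`; one pair of frames is enough. -/
theorem Transports.conj [FiniteDimensional F K₁] [FiniteDimensional F C₁] [FiniteDimensional F K₂]
    [FiniteDimensional F C₂] [FiniteDimensional F X] [FiniteDimensional F Y]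
    {i₁ i₁' : K₁ →ₗ[F] V} {π₁ π₁' : W →ₗ[F] C₁} {i₂ i₂' : K₂ →ₗ[F] V} {π₂ π₂' : W →ₗ[F] C₂}
    (hA : IsPresentation A i₁ π₁) (hB : IsPresentation B i₂ π₂) (hAB : HasFiniteRank (A - B))
    (hA' : IsPresentation A' i₁' π₁') (hB' : IsPresentation B' i₂' π₂')
    (hAB' : HasFiniteRank (A' - B'))
    (hd₁ : Module.finrank F K₁ + Module.finrank F X = Module.finrank F C₁ + Module.finrank F Y)
    (hd₂ : Module.finrank F K₂ + Module.finrank F X = Module.finrank F C₂ + Module.finrank F Y)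
    {gV hV : V ≃ₗ[F] V} {gW hW : W ≃ₗ[F] W} {k : ℕ}
    (hgV : (gV.toLinearMap - LinearMap.id : Module.End F V) ^ (k + 1) = 0)
    (hhV : (hV.toLinearMap - LinearMap.id : Module.End F V) ^ (k + 1) = 0)
    (hgW : (gW.toLinearMap - LinearMap.id : Module.End F W) ^ (k + 1) = 0)
    (hhW : (hW.toLinearMap - LinearMap.id : Module.End F W) ^ (k + 1) = 0)
    (hV' : HasFiniteRank (hV.toLinearMap - gV.toLinearMap))
    (hW' : HasFiniteRank (hW.toLinearMap - gW.toLinearMap))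
    (hgA : ∀ v, A' (gV v) = gW (A v)) (hhB : ∀ v, B' (hV v) = hW (B v))
    (hi₁ : ∀ k, i₁' k = gV (i₁ k)) (hπ₁ : ∀ w, π₁' (gW w) = π₁ w)
    (hi₂ : ∀ k, i₂' k = hV (i₂ k)) (hπ₂ : ∀ w, π₂' (hW w) = π₂ w) {P}
    (hP : Transports X Y A B i₁ π₁ i₂ π₂ P) : Transports X Y A' B' i₁' π₁' i₂' π₂' P := by
  obtain ⟨T₁, T₂, εX, εY, hT₁, hT₂, hX, hY, v₁, v₂, -, -, hv₁, hv₂⟩ :=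
    exists_frames_and_volumes (X := X) (Y := Y) hA hB hd₁ hd₂
  have h := hP T₁ T₂ hT₁ hT₂ εX εY hX hY v₁ v₂ hv₁ hv₂
  have f₁₂ := hT₁.hasFiniteRank_sub_of_sub hT₂ hA hB hAB
  rw [← finDet_conjProd hgV hhV hgW hhW hV' hW' f₁₂] at h
  rw [← symbol_conjProd hi₁ hπ₁] at hv₁
  rw [← symbol_conjProd hi₂ hπ₂] at hv₂
  exact Transports.of_exists hA' hB' hAB' (hT₁.conjProd hgA) (hT₂.conjProd hhB) hX hY hv₁ hv₂ h

end Conjugation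

/-! ### The unipotent map between two splittings -/

section Transition

variable {F V : Type*} [Field F] [AddCommGroup V] [Module F V]

/-- `1 + (a' - a) + (b - b') + b' a`. -/
def transitionMap (a b a' b' : V →ₗ[F] V) : V →ₗ[F] V :=
  LinearMap.id + (a' - a) + (b - b') + b' ∘ₗ a

theorem transitionMap_apply (a b a' b' : V →ₗ[F] V) (v : V) :
    transitionMap a b a' b' v = v + (a' v - a v) + (b v - b' v) + b' (a v) := rfl

/-- `a`, `a'` are idempotents with the same kernel, `b`, `b'` idempotents with the same image,
and the image of `b` is contained in the kernel of `a` and vice versa. -/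
structure TransitionData (a b a' b' : V →ₗ[F] V) : Prop where
  aa : ∀ v, a (a v) = a v
  aa' : ∀ v, a (a' v) = a v
  a'a : ∀ v, a' (a v) = a' v
  a'a' : ∀ v, a' (a' v) = a' v
  bb : ∀ v, b (b v) = b v
  bb' : ∀ v, b (b' v) = b' v
  b'b : ∀ v, b' (b v) = b v
  b'b' : ∀ v, b' (b' v) = b' v
  ab : ∀ v, a (b v) = 0
  ab' : ∀ v, a (b' v) = 0
  a'b : ∀ v, a' (b v) = 0
  a'b' : ∀ v, a' (b' v) = 0
  ba : ∀ v, b (a v) = 0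
  b'a' : ∀ v, b' (a' v) = 0

variable {a b a' b' : V →ₗ[F] V}

theorem TransitionData.symm (h : TransitionData a b a' b') : TransitionData a' b' a b :=
  ⟨h.a'a', h.a'a, h.aa', h.aa, h.b'b', h.b'b, h.bb', h.bb, h.a'b', h.a'b, h.ab', h.ab, h.b'a',
    h.ba⟩

/-- The map acts as a' on Im a, as 1 - b' on Ker a ∩ Ker b and as the identity on Im b. It thus
matches the splitting Im a ⊕ (Ker a ∩ Ker b) ⊕ Im b with the primed one, and exchanging the data
undoes it. -/
theorem TransitionData.map_map (h : TransitionData a b a' b') (v : V) :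
    transitionMap a' b' a b (transitionMap a b a' b' v) = v := by
  simp only [transitionMap_apply, map_add, map_sub, h.aa, h.aa', h.a'a, h.a'a', h.bb, h.bb', h.b'b,
    h.b'b', h.ab, h.ab', h.a'b, h.a'b', h.ba, h.b'a', map_zero]
  abel

/-- The isomorphism `1 + (a' - a) + (b - b') + b' a`. -/
def TransitionData.equiv (h : TransitionData a b a' b') : V ≃ₗ[F] V :=
  LinearEquiv.ofLinearMap (transitionMap a b a' b') (transitionMap a' b' a b)
    (LinearMap.ext h.symm.map_map) (LinearMap.ext h.map_map)

theorem TransitionData.equiv_apply (h : TransitionData a b a' b') (v : V) :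
    h.equiv v = v + (a' v - a v) + (b v - b' v) + b' (a v) := rfl

/-- Subtracting the identity leaves a map that sends Im a into Ker a, sends Ker a ∩ Ker b into Im b
and kills Im b: strictly triangular for three summands, so its cube vanishes. -/
theorem TransitionData.unipotent (h : TransitionData a b a' b') :
    (h.equiv.toLinearMap - LinearMap.id : Module.End F V) ^ (2 + 1) = 0 := by
  refine LinearMap.ext fun v => ?_
  simp only [pow_succ, pow_zero, one_mul, Module.End.mul_apply, LinearMap.sub_apply,
    LinearMap.id_apply, LinearEquiv.coe_coe, h.equiv_apply, LinearMap.zero_apply, map_add, map_sub,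
    h.aa, h.aa', h.a'a, h.a'a', h.bb, h.bb', h.b'b, h.b'b', h.ab, h.ab', h.a'b, h.a'b', h.ba,
    h.b'a', map_zero]
  abel

theorem hasFiniteRank_transitionMap_sub {c d c' d' : V →ₗ[F] V} (ha : HasFiniteRank (a - c))
    (hb : HasFiniteRank (b - d)) (ha' : HasFiniteRank (a' - c')) (hb' : HasFiniteRank (b' - d')) :
    HasFiniteRank (transitionMap a b a' b' - transitionMap c d c' d') :=
  (((HasFiniteRank.sub_self _).add_sub_add (ha'.sub_sub_sub ha)).add_sub_add
    (hb.sub_sub_sub hb')).add_sub_add (hb'.comp_sub_comp ha)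

end Transition

/-! ### Pseudo-inverse complexes -/

section InnerInverse

variable {F V W : Type*} [Field F] [AddCommGroup V] [Module F V] [AddCommGroup W] [Module F W]

/-- A finite rank perturbation of an operator has an inner inverse close to a given one. -/
theorem exists_inner_inverse_of_hasFiniteRank_sub {A B : V →ₗ[F] W} {S : W →ₗ[F] V}
    (hS : ∀ v, A (S (A v)) = A v) (h : HasFiniteRank (A - B)) :
    ∃ S' : W →ₗ[F] V, (∀ v, B (S' (B v)) = B v) ∧ HasFiniteRank (S - S') := by
  let R := B - B ∘ₗ S ∘ₗ B
  have hR : HasFiniteRank R := by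
    have e : R = (B - B ∘ₗ S ∘ₗ B) - (A - A ∘ₗ S ∘ₗ A) := by
      ext v
      simp [R, hS]
    rw [e]
    exact h.symm.sub_sub_sub (h.symm.comp_sub_comp ((HasFiniteRank.sub_self S).comp_sub_comp h.symm))
  obtain ⟨Z, hZ⟩ := exists_inner_inverse R
  -- U corrects the defect R of S: since B(1 - SB) = R = (1 - BS)B, one gets BUB = RZRZR = R. Using
  -- ZRZ in place of Z keeps U of finite rank.
  let U : W →ₗ[F] V := (LinearMap.id - S ∘ₗ B) ∘ₗ Z ∘ₗ R ∘ₗ Z ∘ₗ (LinearMap.id - B ∘ₗ S)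
  refine ⟨S + U, fun v => ?_, ?_⟩
  · have hZ' : ∀ v, R (Z (R v)) = R v := LinearMap.congr_fun hZ
    have e₁ : ∀ v, B ((LinearMap.id - S ∘ₗ B : V →ₗ[F] V) v) = R v := fun v => by simp [R]
    have e₂ : ∀ v, (LinearMap.id - B ∘ₗ S : W →ₗ[F] W) (B v) = R v := fun v => by simp [R]
    have e₃ : B (U (B v)) = R v := by
      simp only [U, LinearMap.comp_apply (f := LinearMap.id - S ∘ₗ B),
        LinearMap.comp_apply, e₁, e₂, hZ']
    rw [LinearMap.add_apply, map_add, e₃]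
    simp [R]
  · have e : S - (S + U) = -U := by simp
    rw [e]
    exact (((hR.comp_right _).comp_left _).comp_left _).neg

end InnerInverse

section Homology

variable {F V W : Type*} [Field F] [AddCommGroup V] [Module F V] [AddCommGroup W] [Module F W]

/-- The space Ker yp ∩ Ker dm of harmonic vectors embeds in the homology of the given complex and
maps onto that of the pseudo-inverse one. -/
theorem finiteDimensional_homology_pseudoInverse {dp : V →ₗ[F] W} {dm : W →ₗ[F] V}
    {yp : W →ₗ[F] V} {ym : V →ₗ[F] W} (hp : IsPseudoInverse dp yp) (hm : IsPseudoInverse dm ym)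
    (hy : yp ∘ₗ ym = 0)
    [FiniteDimensional F (LinearMap.ker dm ⧸ (LinearMap.range dp).submoduleOf (LinearMap.ker dm))] :
    FiniteDimensional F
      (LinearMap.ker yp ⧸ (LinearMap.range ym).submoduleOf (LinearMap.ker yp)) := by
  let K := LinearMap.ker yp ⊓ LinearMap.ker dm
  let f : K →ₗ[F] LinearMap.ker dm ⧸ (LinearMap.range dp).submoduleOf (LinearMap.ker dm) :=
    Submodule.mkQ _ ∘ₗ Submodule.inclusion inf_le_right
  have hf : Function.Injective f := by
    rw [injective_iff_map_eq_zero]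
    rintro ⟨w, hw, hw'⟩ h0
    have hmem : w ∈ LinearMap.range dp := (Submodule.Quotient.mk_eq_zero
      ((LinearMap.range dp).submoduleOf (LinearMap.ker dm))).1 h0
    obtain ⟨v, rfl⟩ := hmem
    have h1 : yp (dp v) = 0 := hw
    have h2 := hp.left_apply v
    rw [h1, map_zero] at h2
    exact Subtype.ext h2.symm
  have : FiniteDimensional F K := FiniteDimensional.of_injective f hf
  let g : K →ₗ[F] LinearMap.ker yp ⧸ (LinearMap.range ym).submoduleOf (LinearMap.ker yp) :=
    Submodule.mkQ _ ∘ₗ Submodule.inclusion inf_le_left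
  refine Module.Finite.of_surjective g fun q => ?_
  obtain ⟨⟨w, hw⟩, rfl⟩ := Submodule.mkQ_surjective _ q
  have hw' : yp w = 0 := hw
  have h1 : yp (ym (dm w)) = 0 := LinearMap.congr_fun hy (dm w)
  refine ⟨⟨w - ym (dm w), ?_, ?_⟩, ?_⟩
  · simp [hw', h1]
  · simp [hm.left_apply]
  · refine (Submodule.Quotient.eq _).2 ?_
    change w - ym (dm w) - w ∈ LinearMap.range ym
    exact ⟨-dm w, by simp⟩

end Homology

namespace FredholmComplex

variable {F Xp Xm : Type*} [Field F] [AddCommGroup Xp] [Module F Xp] [AddCommGroup Xm] [Module F Xm]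
  {D E : FredholmComplex F Xp Xm}

theorem IsFiniteRankPerturbation.symm (h : D.IsFiniteRankPerturbation E) :
    E.IsFiniteRankPerturbation D :=
  ⟨h.1.symm, h.2.symm⟩

theorem IsFiniteRankPerturbation.trans {G : FredholmComplex F Xp Xm}
    (h : D.IsFiniteRankPerturbation E) (h' : E.IsFiniteRankPerturbation G) :
    D.IsFiniteRankPerturbation G :=
  ⟨HasFiniteRank.trans h.1 h'.1, HasFiniteRank.trans h.2 h'.2⟩

theorem dPlus_dMinus_apply (D : FredholmComplex F Xp Xm) (w : Xm) : D.dPlus (D.dMinus w) = 0 :=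
  LinearMap.congr_fun D.dPlus_dMinus w

theorem dMinus_dPlus_apply (D : FredholmComplex F Xp Xm) (v : Xp) : D.dMinus (D.dPlus v) = 0 :=
  LinearMap.congr_fun D.dMinus_dPlus v

/-- Inner inverses of the differentials can be modified to form a pseudo-inverse complex. -/
theorem exists_isPseudoInv_of_inner (D : FredholmComplex F Xp Xm) {S : Xm →ₗ[F] Xp}
    {T : Xp →ₗ[F] Xm} (hS : ∀ v, D.dPlus (S (D.dPlus v)) = D.dPlus v)
    (hT : ∀ w, D.dMinus (T (D.dMinus w)) = D.dMinus w) :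
    ∃ Dd : FredholmComplex F Xm Xp, D.IsPseudoInv Dd ∧
      Dd.dPlus = (LinearMap.id - D.dMinus ∘ₗ T) ∘ₗ S ∘ₗ D.dPlus ∘ₗ S ∧
      Dd.dMinus = (LinearMap.id - D.dPlus ∘ₗ S) ∘ₗ T ∘ₗ D.dMinus ∘ₗ T := by
  -- S d₊ S is a pseudo-inverse of d₊. The factor 1 - d₋T is killed by d₋T, which makes the
  -- composite with `ym` vanish, and it is invisible to d₊ because d₊d₋ = 0.
  let yp : Xm →ₗ[F] Xp := (LinearMap.id - D.dMinus ∘ₗ T) ∘ₗ S ∘ₗ D.dPlus ∘ₗ S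
  let ym : Xp →ₗ[F] Xm := (LinearMap.id - D.dPlus ∘ₗ S) ∘ₗ T ∘ₗ D.dMinus ∘ₗ T
  have hp : IsPseudoInverse D.dPlus yp := by
    constructor <;> ext v <;> simp [yp, hS, D.dPlus_dMinus_apply]
  have hm : IsPseudoInverse D.dMinus ym := by
    constructor <;> ext v <;> simp [ym, hT, D.dMinus_dPlus_apply]
  have hpm : yp ∘ₗ ym = 0 := by
    ext v; simp [yp, ym, hS]
  have hmp : ym ∘ₗ yp = 0 := by
    ext v; simp [yp, ym, hT]
  have := D.finite_HPlus
  have := D.finite_HMinus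
  exact ⟨⟨⟨yp, ym, hmp, hpm⟩, finiteDimensional_homology_pseudoInverse hp hm hpm,
    finiteDimensional_homology_pseudoInverse hm hp hmp⟩, ⟨hp, hm⟩, rfl, rfl⟩

theorem exists_isPseudoInv (D : FredholmComplex F Xp Xm) :
    ∃ Dd : FredholmComplex F Xm Xp, D.IsPseudoInv Dd := by
  obtain ⟨S, hS⟩ := exists_inner_inverse D.dPlus
  obtain ⟨T, hT⟩ := exists_inner_inverse D.dMinus
  obtain ⟨Dd, h, -, -⟩ :=
    D.exists_isPseudoInv_of_inner (LinearMap.congr_fun hS) (LinearMap.congr_fun hT)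
  exact ⟨Dd, h⟩

/-- A finite rank perturbation has a pseudo-inverse complex close to a given one. -/
theorem exists_isPseudoInv_close {Dd : FredholmComplex F Xm Xp} (hD : D.IsPseudoInv Dd)
    (h : D.IsFiniteRankPerturbation E) :
    ∃ Ed : FredholmComplex F Xm Xp, E.IsPseudoInv Ed ∧ Dd.IsFiniteRankPerturbation Ed := by
  obtain ⟨S, hS, hS'⟩ := exists_inner_inverse_of_hasFiniteRank_sub hD.plus.left_apply h.1
  obtain ⟨T, hT, hT'⟩ := exists_inner_inverse_of_hasFiniteRank_sub hD.minus.left_apply h.2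
  obtain ⟨Ed, hE, e₁, e₂⟩ := E.exists_isPseudoInv_of_inner hS hT
  refine ⟨Ed, hE, ?_, ?_⟩
  -- Applied to its own differentials, the construction returns the given pseudo-inverse; the two
  -- complexes can then be compared factor by factor.
  · have e : Dd.dPlus =
        (LinearMap.id - D.dMinus ∘ₗ Dd.dMinus) ∘ₗ Dd.dPlus ∘ₗ D.dPlus ∘ₗ Dd.dPlus := by
      ext w
      simp [hD.plus.right_apply, Dd.dMinus_dPlus_apply]
    rw [e₁, e]
    exact ((HasFiniteRank.sub_self _).sub_sub_sub (h.2.comp_sub_comp hT')).comp_sub_comp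
      (hS'.comp_sub_comp (h.1.comp_sub_comp hS'))
  · have e : Dd.dMinus =
        (LinearMap.id - D.dPlus ∘ₗ Dd.dPlus) ∘ₗ Dd.dMinus ∘ₗ D.dMinus ∘ₗ Dd.dMinus := by
      ext w
      simp [hD.minus.right_apply, Dd.dPlus_dMinus_apply]
    rw [e₂, e]
    exact ((HasFiniteRank.sub_self _).sub_sub_sub (h.1.comp_sub_comp hS')).comp_sub_comp
      (hT'.comp_sub_comp (h.2.comp_sub_comp hT'))

end FredholmComplex

theorem transitionData_of_isPseudoInverse {F V W : Type*} [Field F] [AddCommGroup V] [Module F V]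
    [AddCommGroup W] [Module F W] {dp : V →ₗ[F] W} {dm : W →ₗ[F] V} {yp zp : W →ₗ[F] V}
    {ym zm : V →ₗ[F] W} (hyp : IsPseudoInverse dp yp) (hym : IsPseudoInverse dm ym)
    (hzp : IsPseudoInverse dp zp) (hzm : IsPseudoInverse dm zm) (hd : ∀ w, dp (dm w) = 0)
    (hy : ∀ w, ym (yp w) = 0) (hz : ∀ w, zm (zp w) = 0) :
    TransitionData (yp ∘ₗ dp) (dm ∘ₗ ym) (zp ∘ₗ dp) (dm ∘ₗ zm) := by
  constructor <;> intro v <;>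
    simp [hyp.left_apply, hzp.left_apply, hym.left_apply, hzm.left_apply, hd, hy, hz]

/-! ### Independence of the pseudo-inverse complexes -/

namespace FredholmComplex

variable {F Xp Xm : Type*} [Field F] [AddCommGroup Xp] [Module F Xp] [AddCommGroup Xm] [Module F Xm]
  {D E : FredholmComplex F Xp Xm} {Dd Ed Dd' Ed' : FredholmComplex F Xm Xp}

instance finiteDimensional_HPlus (D : FredholmComplex F Xp Xm) :
    FiniteDimensional F D.HPlus := D.finite_HPlus

instance finiteDimensional_HMinus (D : FredholmComplex F Xp Xm) :
    FiniteDimensional F D.HMinus := D.finite_HMinus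

namespace IsPseudoInv

/-- `Ker σ₊ ≅ H₊(D)`. -/
noncomputable def kerEquiv (hD : D.IsPseudoInv Dd) :
    LinearMap.ker (D.sigmaPlus Dd) ≃ₗ[F] D.HPlus :=
  LinearEquiv.ofBijective _ (kerToHomology_bijective hD)

/-- `H₋(D) ≅ Coker σ₊`. -/
noncomputable def cokerEquiv (hD : D.IsPseudoInv Dd) :
    D.HMinus ≃ₗ[F] Xm ⧸ LinearMap.range (D.sigmaPlus Dd) :=
  LinearEquiv.ofBijective _ (homologyToCoker_bijective hD)

/-- The inclusion of `H₊(D) ≅ Ker σ₊` into `X₊`. -/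
noncomputable def incl (hD : D.IsPseudoInv Dd) : D.HPlus →ₗ[F] Xp :=
  (LinearMap.ker (D.sigmaPlus Dd)).subtype ∘ₗ hD.kerEquiv.symm.toLinearMap

/-- The projection of `X₋` onto `Coker σ₊ ≅ H₋(D)`. -/
noncomputable def proj (hD : D.IsPseudoInv Dd) : Xm →ₗ[F] D.HMinus :=
  hD.cokerEquiv.symm.toLinearMap ∘ₗ (LinearMap.range (D.sigmaPlus Dd)).mkQ

theorem isPresentation (hD : D.IsPseudoInv Dd) :
    IsPresentation (D.sigmaPlus Dd) hD.incl hD.proj :=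
  (isPresentation_subtype_mkQ _).comp_equiv _ _

theorem transitionPlus (hD : D.IsPseudoInv Dd) (hD' : D.IsPseudoInv Dd') :
    TransitionData (Dd.dPlus ∘ₗ D.dPlus) (D.dMinus ∘ₗ Dd.dMinus) (Dd'.dPlus ∘ₗ D.dPlus)
      (D.dMinus ∘ₗ Dd'.dMinus) :=
  transitionData_of_isPseudoInverse hD.plus hD.minus hD'.plus hD'.minus D.dPlus_dMinus_apply
    Dd.dMinus_dPlus_apply Dd'.dMinus_dPlus_apply

theorem transitionMinus (hD : D.IsPseudoInv Dd) (hD' : D.IsPseudoInv Dd') :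
    TransitionData (Dd.dMinus ∘ₗ D.dMinus) (D.dPlus ∘ₗ Dd.dPlus) (Dd'.dMinus ∘ₗ D.dMinus)
      (D.dPlus ∘ₗ Dd'.dPlus) :=
  transitionData_of_isPseudoInverse hD.minus hD.plus hD'.minus hD'.plus D.dMinus_dPlus_apply
    Dd.dPlus_dMinus_apply Dd'.dPlus_dMinus_apply

/-- On X₊ the splitting is Im d₊†, Ker σ₊, Im d₋. The operator σ₊ maps the first summand to Im d₊ by
d₊, the last to Im d₋† by d₋†, and kills the middle one; the transition maps respect each of these.
-/
theorem sigmaPlus_transition (hD : D.IsPseudoInv Dd) (hD' : D.IsPseudoInv Dd') (v : Xp) :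
    D.sigmaPlus Dd' ((hD.transitionPlus hD').equiv v) =
      (hD.transitionMinus hD').equiv (D.sigmaPlus Dd v) := by
  simp only [TransitionData.equiv_apply, sigmaPlus, LinearMap.add_apply, LinearMap.comp_apply,
    map_add, map_sub, hD.plus.left_apply, hD'.plus.left_apply, hD.minus.right_apply,
    hD'.minus.right_apply, D.dPlus_dMinus_apply,
    D.dMinus_dPlus_apply, Dd.dPlus_dMinus_apply, Dd'.dMinus_dPlus_apply, map_zero]
  abel

theorem incl_transition (hD : D.IsPseudoInv Dd) (hD' : D.IsPseudoInv Dd') (k : D.HPlus) :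
    hD'.incl k = (hD.transitionPlus hD').equiv (hD.incl k) := by
  obtain ⟨x, rfl⟩ := hD.kerEquiv.surjective k
  have hx : D.sigmaPlus Dd (x : Xp) = 0 := x.2
  have hx' : D.dPlus (x : Xp) = 0 := ker_sigmaPlus_le hD x.2
  let y : LinearMap.ker (D.sigmaPlus Dd') := ⟨(hD.transitionPlus hD').equiv (x : Xp), by
    rw [LinearMap.mem_ker, hD.sigmaPlus_transition hD', hx, map_zero]⟩
  have hxy : hD'.kerEquiv y = hD.kerEquiv x := by
    refine (Submodule.Quotient.eq _).2 ?_
    change (hD.transitionPlus hD').equiv (x : Xp) - (x : Xp) ∈ LinearMap.range D.dMinus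
    -- As d₊x = 0, the transition map moves x only by d₋ of this vector, so the homology class is
    -- unchanged.
    refine ⟨Dd.dMinus x - Dd'.dMinus x, ?_⟩
    rw [TransitionData.equiv_apply]
    simp [hx']
  have e₁ : hD'.incl (hD'.kerEquiv y) = y := by simp [incl]
  have e₂ : hD.incl (hD.kerEquiv x) = x := by simp [incl]
  rw [e₂, ← hxy, e₁]

/-- Write w as a cycle z modulo Im σ₊. The transition map takes Im σ₊ into the new image and moves z
only by an element of Im d₊. -/
theorem proj_transition (hD : D.IsPseudoInv Dd) (hD' : D.IsPseudoInv Dd') (w : Xm) :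
    hD'.proj ((hD.transitionMinus hD').equiv w) = hD.proj w := by
  obtain ⟨z, hz⟩ := Submodule.mkQ_surjective _ (hD.proj w)
  have h1 : hD.cokerEquiv (hD.proj w) = Submodule.mkQ _ w := by simp [proj]
  rw [← hz] at h1 ⊢
  obtain ⟨y, hy⟩ := (Submodule.Quotient.eq _).1
    (h1 : (LinearMap.range (D.sigmaPlus Dd)).mkQ (z : Xm) = Submodule.mkQ _ w)
  have hz0 : D.dMinus (z : Xm) = 0 := z.2
  have h2 := hD.sigmaPlus_transition hD' y
  rw [show D.sigmaPlus Dd y = (z : Xm) - w from hy, map_sub] at h2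
  change hD'.cokerEquiv.symm _ = _
  rw [LinearEquiv.symm_apply_eq]
  change Submodule.mkQ _ _ = (LinearMap.range (D.sigmaPlus Dd')).mkQ (z : Xm)
  refine (Submodule.Quotient.eq _).2 ?_
  have h3 : (hD.transitionMinus hD').equiv (z : Xm) - z ∈
      LinearMap.range (D.sigmaPlus Dd') := by
    refine range_dPlus_le hD' ⟨Dd.dPlus z - Dd'.dPlus z, ?_⟩
    rw [TransitionData.equiv_apply]
    simp [hz0]
  have h4 : (hD.transitionMinus hD').equiv w - z =
      ((hD.transitionMinus hD').equiv (z : Xm) - z) -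
        D.sigmaPlus Dd' ((hD.transitionPlus hD').equiv y) := by
    rw [h2]
    abel
  rw [h4]
  exact Submodule.sub_mem _ h3 ⟨_, rfl⟩

end IsPseudoInv

theorem hasFiniteRank_sigmaPlus_sub (h : D.IsFiniteRankPerturbation E)
    (hd : Dd.IsFiniteRankPerturbation Ed) :
    HasFiniteRank (D.sigmaPlus Dd - E.sigmaPlus Ed) :=
  HasFiniteRank.add_sub_add h.1 hd.2

/-- The transport between the homology lines does not depend on the pseudo-inverse complexes. -/
theorem transports_of_transports {X Y : Type*} [AddCommGroup X] [Module F X] [AddCommGroup Y]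
    [Module F Y] [FiniteDimensional F X] [FiniteDimensional F Y]
    (hD : D.IsPseudoInv Dd) (hE : E.IsPseudoInv Ed) (hD' : D.IsPseudoInv Dd')
    (hE' : E.IsPseudoInv Ed') (h : D.IsFiniteRankPerturbation E)
    (hd : Dd.IsFiniteRankPerturbation Ed) (hd' : Dd'.IsFiniteRankPerturbation Ed')
    (hdimD : Module.finrank F D.HPlus + Module.finrank F X =
      Module.finrank F D.HMinus + Module.finrank F Y)
    (hdimE : Module.finrank F E.HPlus + Module.finrank F X =
      Module.finrank F E.HMinus + Module.finrank F Y) {P}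
    (hP : Transports X Y (D.sigmaPlus Dd) (E.sigmaPlus Ed) hD.incl hD.proj hE.incl hE.proj P) :
    Transports X Y (D.sigmaPlus Dd') (E.sigmaPlus Ed') hD'.incl hD'.proj hE'.incl hE'.proj P := by
  have hs := h.symm
  have hds := hd.symm
  have hds' := hd'.symm
  refine hP.conj hD.isPresentation hE.isPresentation (hasFiniteRank_sigmaPlus_sub h hd)
    hD'.isPresentation hE'.isPresentation (hasFiniteRank_sigmaPlus_sub h hd') hdimD hdimE
    (hD.transitionPlus hD').unipotent (hE.transitionPlus hE').unipotent
    (hD.transitionMinus hD').unipotent (hE.transitionMinus hE').unipotent ?_ ?_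
    (hD.sigmaPlus_transition hD') (hE.sigmaPlus_transition hE') (hD.incl_transition hD')
    (hD.proj_transition hD') (hE.incl_transition hE') (hE.proj_transition hE')
  · exact hasFiniteRank_transitionMap_sub (hds.1.comp_sub_comp hs.1) (hs.2.comp_sub_comp hds.2)
      (hds'.1.comp_sub_comp hs.1) (hs.2.comp_sub_comp hds'.2)
  · exact hasFiniteRank_transitionMap_sub (hds.2.comp_sub_comp hs.2) (hs.1.comp_sub_comp hds.1)
      (hds'.2.comp_sub_comp hs.2) (hs.1.comp_sub_comp hds'.1)

theorem IsPseudoInv.finiteDimensional (hD : D.IsPseudoInv Dd) :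
    FiniteDimensional F (LinearMap.ker (D.sigmaPlus Dd)) ∧
    FiniteDimensional F (Xm ⧸ LinearMap.range (D.sigmaPlus Dd)) :=
  ⟨hD.kerEquiv.symm.finiteDimensional, hD.cokerEquiv.finiteDimensional⟩

/-- The Euler characteristic is invariant under finite rank perturbations. -/
theorem finrank_sub_finrank_eq (h : D.IsFiniteRankPerturbation E) :
    (Module.finrank F D.HPlus : ℤ) - Module.finrank F D.HMinus =
      Module.finrank F E.HPlus - Module.finrank F E.HMinus := by
  obtain ⟨Dd, hD⟩ := D.exists_isPseudoInv
  obtain ⟨Ed, hE, hd⟩ := exists_isPseudoInv_close hD h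
  obtain ⟨_, _⟩ := hD.finiteDimensional
  obtain ⟨_, _⟩ := hE.finiteDimensional
  have hi := opIndex_eq_of_hasFiniteRank_sub (hasFiniteRank_sigmaPlus_sub h hd)
  unfold opIndex at hi
  rwa [hD.kerEquiv.finrank_eq, hE.kerEquiv.finrank_eq, ← hD.cokerEquiv.finrank_eq,
    ← hE.cokerEquiv.finrank_eq] at hi

theorem canonicalIso_eq_detCongr (hD : D.IsPseudoInv Dd) :
    canonicalIso hD = detCongr hD.kerEquiv hD.cokerEquiv := rfl

/-- The canonical isomorphisms turn transport on homology into transport on Ker and Coker of σ₊ and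
τ₊, where it coincides with the defining formula and is unique. -/
theorem isOpPerturbationIso_canonicalIso_iff {p q : ℕ} (hpq : p = 0 ∨ q = 0)
    (hD : D.IsPseudoInv Dd) (hE : E.IsPseudoInv Ed) (h : D.IsFiniteRankPerturbation E)
    (hd : Dd.IsFiniteRankPerturbation Ed)
    (hdim : Module.finrank F D.HPlus + p = Module.finrank F D.HMinus + q)
    {P Q : D.Det ≃ₗ[F] E.Det}
    (hP : Transports (Fin p → F) (Fin q → F) (D.sigmaPlus Dd) (E.sigmaPlus Ed) hD.incl hD.proj
      hE.incl hE.proj P) :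
    IsOpPerturbationIso (D.sigmaPlus Dd) (E.sigmaPlus Ed)
        (((canonicalIso hD).trans Q).trans (canonicalIso hE).symm) ↔ Q = P := by
  obtain ⟨_, _⟩ := hD.finiteDimensional
  obtain ⟨_, _⟩ := hE.finiteDimensional
  have hχ := finrank_sub_finrank_eq h
  have hk : Module.finrank F (LinearMap.ker (D.sigmaPlus Dd)) + p =
      Module.finrank F (Xm ⧸ LinearMap.range (D.sigmaPlus Dd)) + q := by
    rw [hD.kerEquiv.finrank_eq, ← hD.cokerEquiv.finrank_eq, hdim]
  have hkE : Module.finrank F (LinearMap.ker (E.sigmaPlus Ed)) + p =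
      Module.finrank F (Xm ⧸ LinearMap.range (E.sigmaPlus Ed)) + q := by
    rw [hE.kerEquiv.finrank_eq, ← hE.cokerEquiv.finrank_eq]
    omega
  have hP' := Transports.detCongr hD.kerEquiv hD.cokerEquiv hE.kerEquiv hE.cokerEquiv hP
  rw [← canonicalIso_eq_detCongr, ← canonicalIso_eq_detCongr] at hP'
  rw [isOpPerturbationIso_iff_transports hpq hk (hasFiniteRank_sigmaPlus_sub h hd)]
  constructor
  · intro hQ
    have e := Transports.unique (isPresentation_subtype_mkQ _) (isPresentation_subtype_mkQ _)
      (by simpa using hk) (by simpa using hkE) hQ hP'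
    refine LinearEquiv.ext fun x => ?_
    obtain ⟨x, rfl⟩ := (canonicalIso hD).surjective x
    exact (canonicalIso hE).symm.injective (LinearEquiv.congr_fun e x)
  · rintro rfl
    exact hP'

/-- Transport for one choice of pseudo-inverse complexes is transport for every choice, so all
choices produce the same isomorphism. -/
theorem isThePerturbationIso_of_transports {p q : ℕ} (hpq : p = 0 ∨ q = 0)
    (hD : D.IsPseudoInv Dd) (hE : E.IsPseudoInv Ed) (h : D.IsFiniteRankPerturbation E)
    (hd : Dd.IsFiniteRankPerturbation Ed)
    (hdim : Module.finrank F D.HPlus + p = Module.finrank F D.HMinus + q) {P : D.Det ≃ₗ[F] E.Det}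
    (hP : Transports (Fin p → F) (Fin q → F) (D.sigmaPlus Dd) (E.sigmaPlus Ed) hD.incl hD.proj
      hE.incl hE.proj P) : D.IsThePerturbationIso E P := by
  have hχ := finrank_sub_finrank_eq h
  have hdimE : Module.finrank F E.HPlus + p = Module.finrank F E.HMinus + q := by omega
  have key : ∀ {Dd' Ed' : FredholmComplex F Xm Xp} (hD' : D.IsPseudoInv Dd')
      (hE' : E.IsPseudoInv Ed') (hd' : Dd'.IsFiniteRankPerturbation Ed') (Q : D.Det ≃ₗ[F] E.Det),
      IsOpPerturbationIso (D.sigmaPlus Dd') (E.sigmaPlus Ed')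
        (((canonicalIso hD').trans Q).trans (canonicalIso hE').symm) ↔ Q = P :=
    fun hD' hE' hd' Q => isOpPerturbationIso_canonicalIso_iff hpq hD' hE' h hd' hdim
      (transports_of_transports hD hE hD' hE' h hd hd' (by simpa using hdim)
      (by simpa using hdimE) hP)
  intro Q
  constructor
  · rintro ⟨Dd', Ed', hD', hE', hd', hQ⟩
    exact (key hD' hE' hd' Q).1 hQ
  · intro hQ
    exact ⟨Dd, Ed, hD, hE, hd, (key hD hE hd Q).2 hQ⟩

end FredholmComplex

end FredholmPerturbation

set_option maxHeartbeats 800000 in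
theorem theorem3p8 {F Xp Xm : Type*} [Field F] [AddCommGroup Xp] [Module F Xp]
    [AddCommGroup Xm] [Module F Xm]
    (D₁ D₂ D₃ : FredholmPerturbation.FredholmComplex F Xp Xm)
    (h₁₂ : D₁.IsFiniteRankPerturbation D₂) (h₂₃ : D₂.IsFiniteRankPerturbation D₃) :
    ∃ (P₂₁ : D₁.Det ≃ₗ[F] D₂.Det) (P₁₂ : D₂.Det ≃ₗ[F] D₁.Det)
      (P₃₂ : D₂.Det ≃ₗ[F] D₃.Det) (P₃₁ : D₁.Det ≃ₗ[F] D₃.Det),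
      D₁.IsThePerturbationIso D₂ P₂₁ ∧ D₂.IsThePerturbationIso D₁ P₁₂ ∧
      D₂.IsThePerturbationIso D₃ P₃₂ ∧ D₁.IsThePerturbationIso D₃ P₃₁ ∧
      P₁₂ = P₂₁.symm ∧
      P₂₁.trans P₃₂ = P₃₁ := by
  open FredholmPerturbation FredholmComplex in
  obtain ⟨E₁, hE₁⟩ := D₁.exists_isPseudoInv
  obtain ⟨E₂, hE₂, hE₁₂⟩ := exists_isPseudoInv_close hE₁ h₁₂
  obtain ⟨E₃, hE₃, hE₂₃⟩ := exists_isPseudoInv_close hE₂ h₂₃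
  have χ₁₂ := finrank_sub_finrank_eq h₁₂
  have χ₂₃ := finrank_sub_finrank_eq h₂₃
  -- Truncated subtraction makes one of the two numbers zero. By invariance of the Euler
  -- characteristic, the same stabilisation serves all three complexes.
  obtain ⟨p, q, hpq, d₁⟩ : ∃ p q : ℕ, (p = 0 ∨ q = 0) ∧
      Module.finrank F D₁.HPlus + p = Module.finrank F D₁.HMinus + q :=
    ⟨Module.finrank F D₁.HMinus - Module.finrank F D₁.HPlus,
      Module.finrank F D₁.HPlus - Module.finrank F D₁.HMinus, by omega, by omega⟩
  have d₂ : Module.finrank F D₂.HPlus + p = Module.finrank F D₂.HMinus + q := by omega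
  have d₃ : Module.finrank F D₃.HPlus + p = Module.finrank F D₃.HMinus + q := by omega
  have s₁₂ := hasFiniteRank_sigmaPlus_sub h₁₂ hE₁₂
  have s₂₃ := hasFiniteRank_sigmaPlus_sub h₂₃ hE₂₃
  obtain ⟨P, hP⟩ := exists_transports (X := Fin p → F) (Y := Fin q → F) hE₁.isPresentation
    hE₂.isPresentation s₁₂ (by simpa using d₁) (by simpa using d₂)
  obtain ⟨Q, hQ⟩ := exists_transports (X := Fin p → F) (Y := Fin q → F) hE₂.isPresentation
    hE₃.isPresentation s₂₃ (by simpa using d₂) (by simpa using d₃)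
  have hP' := hP.symm hE₁.isPresentation hE₂.isPresentation s₁₂
  have hPQ := hP.trans hE₁.isPresentation hE₂.isPresentation hE₃.isPresentation s₁₂ s₂₃
    (by simpa using d₂) hQ
  refine ⟨P, P.symm, Q, P.trans Q, ?_, ?_, ?_, ?_, rfl, rfl⟩
  · exact isThePerturbationIso_of_transports hpq hE₁ hE₂ h₁₂ hE₁₂ d₁ hP
  · exact isThePerturbationIso_of_transports hpq hE₂ hE₁ h₁₂.symm hE₁₂.symm d₂ hP'
  · exact isThePerturbationIso_of_transports hpq hE₂ hE₃ h₂₃ hE₂₃ d₂ hQ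
  · exact isThePerturbationIso_of_transports hpq hE₁ hE₃ (h₁₂.trans h₂₃) (hE₁₂.trans hE₂₃) d₁ hPQ
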